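/- **Setting.** Let $V$ be a finite-dimensional Euclidean space and $R\subset V^*$ a (non-empty) reduced, crystallographic, irreducible root system, not required to span $V^*$. For $\xi\in V^*\setminus\{0\}$ let $\xi^\vee\in V$ be the vector with $\eta(\xi^\vee)=2\langle\eta,\xi\rangle/\langle\xi,\xi\rangle$ for all $\eta\in V^*$, and let $W\subset O(V)$ be the Weyl group, generated by $s_\alpha(v)=v-\alpha(v)\alpha^\vee$ ($\alpha\in R$). Let $X\subset V^*$ be a full lattice containing $R$ whose dual lattice $Y=\{y\in V: \xi(y)\in\mathbb Z\ \forall \xi\in X\}$ contains all $\alpha^\vee$ ($\alpha\in R$). Let $W^a=W\ltimes Y=\{wt_y\}$, with $wt_y(v)=w(v+y)$, be the extended affine Weyl group, and let $D:W^a\to W$, $D(wt_y)=w$. Let $R^a=R+\mathbb Z1$ be the affine root system, a set of affine linear functions on $V$ on which $W^a$ acts by $wa=a\circ w^{-1}$; write $Da\in R$ for the gradient of $a\in R^a$ and $s_a(v)=v-a(v)(Da)^\vee$, so $s_a\in W^a$. Fix a basis $F$ of $R$ with positive roots $R^+$ and highest root $\theta$, and put $F^a=F\cup\{-\theta+1\}$,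 $R^{a,+}=(R+\mathbb Z_{>0})\cup R^+$, $R^{a,-}=-R^{a,+}$, and $\Omega=\{w\in W^a: R^{a,+}\cap w^{-1}R^{a,-}=\emptyset\}$. Let $k:R^a\to\mathbb C$ be $W^a$-invariant. Let $A(k)$ be the unital associative $\mathbb C$-algebra generated by the algebras $S(V_{\mathbb C})$ and $\mathbb C[W^a]$ subject to $s_a v-s_{Da}(v)s_a=-k_a\,Da(v)$ for $a\in F^a$, $v\in V_{\mathbb C}$, and $\omega v=(D\omega)(v)\,\omega$ for $\omega\in\Omega$, $v\in V_{\mathbb C}$ (the trigonometric Cherednik algebra at critical level). Let $V_{reg}=\{v\in V: a(v)\neq0\ \forall a\in R^a\}$; its connected components are the chambers. Let $C^\omega(V)$ be the space of complex-valued real analytic functions on $V$. For a complex left $W^a$-module $M$ let $B^\omega(V;M)$ be the space of functions $f:V_{reg}\to M$ such that for every chamber $C$ there is $f_C\in C^\omega(V)\otimes_{\mathbb C}M$ (algebraic tensor product) with $f|_C=f_C|_C$. The group $W^a$ acts on it by $(w\cdot f)(v)=w(f(w^{-1}v))$. For $v\in V$ define the operator on $B^\omega(V;M)$ $$\mathcal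 D^{k,M}_v f=\partial_v f-\sum_{a\in R^{a,+}}k_a\,(Da)(v)\,\mathcal I_a\,(s_a\cdot f),$$ where $\partial_v$ is the directional derivative and $\mathcal I_a(x)=1$ if $a(x)<0$, $\mathcal I_a(x)=0$ if $a(x)>0$; at each point of $V_{reg}$ only finitely many terms of the sum are non-zero. **Theorem.** 1. The canonical maps $S(V_{\mathbb C})\to A(k)$ and $\mathbb C[W^a]\to A(k)$ are injective, and multiplication is a linear isomorphism $S(V_{\mathbb C})\otimes_{\mathbb C}\mathbb C[W^a]\to A(k)$. 2. For every complex left $W^a$-module $M$, the assignments $v\mapsto\mathcal D_v^{k,M}$ ($v\in V$) and $w\mapsto w\,\cdot$ ($w\in W^a$) extend uniquely to an algebra homomorphism $\pi_{k,M}:A(k)\to\mathrm{End}_{\mathbb C}(B^\omega(V;M))$. 3. The assignment $M\mapsto B^\omega(V;M)$, with $A(k)$ acting through $\pi_{k,M}$ and with a morphism $\varphi:M\to N$ sent to $f\mapsto\varphi\circ f$, defines a covariant functor $F_{dr}^k:\mathrm{Mod}_{\mathbb C[W^a]}\to\mathrm{Mod}_{A(k)}$. 4. For every $M$ and every $p\in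 S(V_{\mathbb C})^W$ we have $\pi_{k,M}(p)=p(\partial)\otimes\mathrm{Id}_M$; that is, $(\pi_{k,M}(p)f)|_C=\bigl((p(\partial)\otimes\mathrm{Id}_M)f_C\bigr)|_C$ for all $f\in B^\omega(V;M)$ and all chambers $C$, where $p(\partial)$ is the constant-coefficient differential operator on $C^\omega(V)$ associated to $p$. -/

import Mathlib

open scoped TensorProduct

set_option linter.unusedSectionVars false

universe u w

noncomputable section

namespace DunklCherednik

section Reflections

variable {V : Type u} [NormedAddCommGroup V] [InnerProductSpace ℝ V] [FiniteDimensional ℝ V]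

/-- The co-vector `ξ^∨ ∈ V`, i.e. the vector with `η(ξ^∨) = 2⟨η, ξ⟩ / ⟨ξ, ξ⟩`. -/
def coroot (ξ : StrongDual ℝ V) : V :=
  (2 / ‖ξ‖ ^ 2) • (InnerProductSpace.toDual ℝ V).symm ξ

/-- Affine linear functions on `V`: the pair `(ξ, c)` is the function `v ↦ ξ v + c`. The gradient
`Dφ` is the first component. -/
abbrev Aff (V : Type u) [NormedAddCommGroup V] [InnerProductSpace ℝ V] : Type u :=
  StrongDual ℝ V × ℝ

/-- The value of an affine linear function at a point. -/
def Aff.eval (φ : Aff V) (v : V) : ℝ := φ.1 v + φ.2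

/-- The orthogonal reflection in the hyperplane `ξ = 0`. -/
def linRefl (ξ : StrongDual ℝ V) : V ≃ₗᵢ[ℝ] V := (ℝ ∙ coroot ξ)ᗮ.reflection

theorem linRefl_apply (ξ : StrongDual ℝ V) (v : V) : linRefl ξ v = v - ξ v • coroot ξ := by
  by_cases h : ξ = 0
  · subst h
    rw [linRefl, Submodule.reflection_orthogonal_apply, Submodule.reflection_singleton_apply]
    simp [coroot]
  · have hn : ‖ξ‖ ≠ 0 := by simpa using h
    have key : ξ v = inner ℝ ((InnerProductSpace.toDual ℝ V).symm ξ) v := by simp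
    rw [linRefl, Submodule.reflection_orthogonal_apply, Submodule.reflection_singleton_apply,
      coroot, key]
    simp only [norm_smul, inner_smul_left, LinearIsometryEquiv.norm_map, norm_div, norm_pow,
      norm_norm, RCLike.norm_ofNat, RCLike.ofReal_real_eq_id, id, map_div₀, map_pow,
      conj_trivial, smul_smul, neg_sub, two_smul]
    rw [← add_smul]
    congr 2
    field_simp
    ring

/-- The orthogonal reflection `s_φ(v) = v - φ(v) (Dφ)^∨` in the affine hyperplane `φ = 0`
(see `affRefl_apply`). -/
def affRefl (φ : Aff V) : V ≃ᵃⁱ[ℝ] V :=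
  (linRefl φ.1).toAffineIsometryEquiv * AffineIsometryEquiv.constVAdd ℝ V (φ.2 • coroot φ.1)

theorem coroot_pairing {ξ : StrongDual ℝ V} (h : ξ ≠ 0) : ξ (coroot ξ) = 2 := by
  have hn : ‖ξ‖ ≠ 0 := by simpa using h
  have : ξ ((InnerProductSpace.toDual ℝ V).symm ξ) = ‖ξ‖ ^ 2 := by
    have := InnerProductSpace.toDual_symm_apply (𝕜 := ℝ)
      (x := (InnerProductSpace.toDual ℝ V).symm ξ) (y := ξ)
    rw [← this, real_inner_self_eq_norm_sq, LinearIsometryEquiv.norm_map]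
  rw [coroot, map_smul, this, smul_eq_mul]
  field_simp

theorem affRefl_apply (φ : Aff V) (v : V) : affRefl φ v = v - φ.eval v • coroot φ.1 := by
  by_cases h : φ.1 = 0
  · simp [affRefl, linRefl_apply, h, Aff.eval, coroot]
  · simp only [affRefl, AffineIsometryEquiv.coe_mul, Function.comp_apply,
      AffineIsometryEquiv.coe_constVAdd, vadd_eq_add,
      LinearIsometryEquiv.coe_toAffineIsometryEquiv, linRefl_apply, map_add, map_smul,
      coroot_pairing h, Aff.eval]
    module

/-- The action `φ ↦ φ ∘ g⁻¹` of isometries on affine linear functions (see `act_eval`). -/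
def act (g : V ≃ᵃⁱ[ℝ] V) (φ : Aff V) : Aff V :=
  (φ.1.comp (g⁻¹.linearIsometryEquiv : V →L[ℝ] V), φ.1 (g⁻¹ 0) + φ.2)

theorem apply_eq (g : V ≃ᵃⁱ[ℝ] V) (v : V) : g v = g.linearIsometryEquiv v + g 0 := by
  simpa using g.map_vadd 0 v

theorem act_eval (g : V ≃ᵃⁱ[ℝ] V) (φ : Aff V) (v : V) : (act g φ).eval v = φ.eval (g⁻¹ v) := by
  rw [apply_eq g⁻¹ v]
  simp [act, Aff.eval, add_assoc]

end Reflections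

/-- A reduced, crystallographic, irreducible root system `R ⊆ V^*` (not required to span `V^*`),
together with a basis `F` of `R` and a full lattice `X ⊆ V^*` containing the root lattice such that
the dual lattice in `V` contains the co-root lattice. -/
structure RootData (V : Type u) [NormedAddCommGroup V] [InnerProductSpace ℝ V]
    [FiniteDimensional ℝ V] where
  /-- the set of roots -/
  R : Set (StrongDual ℝ V)
  finite : R.Finite
  nonempty : R.Nonempty
  zero_notMem : 0 ∉ R
  reflection_mem : ∀ α ∈ R, ∀ β ∈ R, β - β (coroot α) • α ∈ R
  crystallographic : ∀ α ∈ R, ∀ β ∈ R, ∃ n : ℤ, β (coroot α) = n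
  reduced : ∀ α ∈ R, ∀ c : ℝ, c • α ∈ R → c = 1 ∨ c = -1
  /-- `R` is not a disjoint union of two non-empty mutually orthogonal subsets -/
  irreducible : ∀ S ⊆ R, S.Nonempty → (R \ S).Nonempty →
    ∃ α ∈ S, ∃ β ∈ R \ S, β (coroot α) ≠ 0
  /-- the basis of `R` -/
  F : Set (StrongDual ℝ V)
  F_subset : F ⊆ R
  F_linearIndep : LinearIndepOn ℝ id F
  F_span : ∀ β ∈ R, β ∈ AddSubmonoid.closure F ∨ -β ∈ AddSubmonoid.closure F
  /-- the lattice in `V^*` -/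
  X : AddSubgroup (StrongDual ℝ V)
  X_discrete : DiscreteTopology X
  X_span : Submodule.span ℝ (X : Set (StrongDual ℝ V)) = ⊤
  R_subset_X : R ⊆ X
  coroot_mem_dual : ∀ α ∈ R, ∀ ξ ∈ X, ∃ n : ℤ, ξ (coroot α) = n

namespace RootData

variable {V : Type u} [NormedAddCommGroup V] [InnerProductSpace ℝ V] [FiniteDimensional ℝ V]
  (Φ : RootData V)

/-- The lattice `Y ⊆ V` dual to `X`. -/
def Y : AddSubgroup V where
  carrier := {y | ∀ ξ ∈ Φ.X, ∃ n : ℤ, ξ y = n}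
  zero_mem' ξ _ := ⟨0, by simp⟩
  add_mem' {x y} hx hy ξ hξ := by
    obtain ⟨m, hm⟩ := hx ξ hξ
    obtain ⟨n, hn⟩ := hy ξ hξ
    exact ⟨m + n, by simp [hm, hn]⟩
  neg_mem' {x} hx ξ hξ := by
    obtain ⟨m, hm⟩ := hx ξ hξ
    exact ⟨-m, by simp [hm]⟩

/-- The Weyl group `W`, generated by the reflections in the root hyperplanes. -/
def W : Subgroup (V ≃ₗᵢ[ℝ] V) := Subgroup.closure {s | ∃ α ∈ Φ.R, s = linRefl α}

theorem inv_linRefl (ξ : StrongDual ℝ V) : (linRefl ξ)⁻¹ = linRefl ξ :=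
  Submodule.reflection_symm

theorem coroot_mem_Y {α : StrongDual ℝ V} (h : α ∈ Φ.R) : coroot α ∈ Φ.Y :=
  Φ.coroot_mem_dual α h

theorem W_apply_mem_Y {g : V ≃ₗᵢ[ℝ] V} (hg : g ∈ Φ.W) : ∀ y ∈ Φ.Y, g y ∈ Φ.Y := by
  refine Subgroup.closure_induction'' (p := fun g _ => ∀ y ∈ Φ.Y, g y ∈ Φ.Y) ?_ ?_ ?_ ?_ hg
  · rintro _ ⟨α, hα, rfl⟩ y hy
    obtain ⟨n, hn⟩ := hy α (Φ.R_subset_X hα)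
    rw [linRefl_apply, hn, Int.cast_smul_eq_zsmul]
    exact Φ.Y.sub_mem hy (Φ.Y.zsmul_mem (Φ.coroot_mem_Y hα) n)
  · rintro _ ⟨α, hα, rfl⟩ y hy
    obtain ⟨n, hn⟩ := hy α (Φ.R_subset_X hα)
    rw [inv_linRefl, linRefl_apply, hn, Int.cast_smul_eq_zsmul]
    exact Φ.Y.sub_mem hy (Φ.Y.zsmul_mem (Φ.coroot_mem_Y hα) n)
  · intro y hy
    exact hy
  · intro a b _ _ ha hb y hy
    exact ha _ (hb y hy)

theorem W_comp_mem_R {g : V ≃ₗᵢ[ℝ] V} (hg : g ∈ Φ.W) :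
    ∀ α ∈ Φ.R, α.comp (g : V →L[ℝ] V) ∈ Φ.R := by
  have aux : ∀ α ∈ Φ.R, ∀ β ∈ Φ.R, β.comp (linRefl α : V →L[ℝ] V) ∈ Φ.R := by
    intro α hα β hβ
    convert Φ.reflection_mem α hα β hβ using 1
    ext v
    simp [linRefl_apply, mul_comm]
  refine Subgroup.closure_induction'' 
    (p := fun (g : V ≃ₗᵢ[ℝ] V) _ => ∀ α ∈ Φ.R, α.comp (g : V →L[ℝ] V) ∈ Φ.R) ?_ ?_ ?_ ?_ hg
  · rintro _ ⟨α, hα, rfl⟩ β hβ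
    exact aux α hα β hβ
  · rintro _ ⟨α, hα, rfl⟩ β hβ
    rw [inv_linRefl]
    exact aux α hα β hβ
  · intro β hβ
    exact hβ
  · intro a b _ _ ha hb β hβ
    exact hb _ (ha β hβ)

/-- The extended affine Weyl group `W^a = W ⋉ Y = {w t_y}`, as a group of isometries of `V`; here
`w t_y (v) = w (v + y)`. -/
def Wa : Subgroup (V ≃ᵃⁱ[ℝ] V) where
  carrier := {g | ∃ w ∈ Φ.W, ∃ y ∈ Φ.Y, ∀ v, g v = w (v + y)}
  one_mem' := ⟨1, Φ.W.one_mem, 0, Φ.Y.zero_mem, fun v => by simp⟩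
  mul_mem' := by
    rintro a b ⟨w, hw, y, hy, h⟩ ⟨w', hw', y', hy', h'⟩
    refine ⟨w * w', Φ.W.mul_mem hw hw', y' + w'⁻¹ y,
      Φ.Y.add_mem hy' (Φ.W_apply_mem_Y (Φ.W.inv_mem hw') y hy), fun v => ?_⟩
    simp [h, h', add_assoc]
  inv_mem' := by
    rintro a ⟨w, hw, y, hy, h⟩
    refine ⟨w⁻¹, Φ.W.inv_mem hw, -(w y), Φ.Y.neg_mem (Φ.W_apply_mem_Y hw y hy), fun v => ?_⟩
    apply a.injective
    have h1 : a (a⁻¹ v) = v := a.apply_symm_apply v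
    have h2 : ∀ z, w (w⁻¹ z) = z := w.apply_symm_apply
    rw [h1, h, map_add, h2]
    simp

/-- The affine root system `R^a = R + ℤ1`. -/
def Ra : Set (Aff V) := {a | a.1 ∈ Φ.R ∧ ∃ m : ℤ, a.2 = m}

/-- The positive roots with respect to the basis `F`. -/
def Rpos : Set (StrongDual ℝ V) := {α | α ∈ Φ.R ∧ α ∈ AddSubmonoid.closure Φ.F}

/-- The positive affine roots `R^{a,+} = (R + ℤ_{>0}) ∪ R^+`. -/
def RaPos : Set Φ.Ra := {a | 0 < a.1.2 ∨ (a.1.2 = 0 ∧ a.1.1 ∈ Φ.Rpos)}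

/-- `θ` is the highest root with respect to the basis `F`. -/
def IsHighestRoot (θ : StrongDual ℝ V) : Prop :=
  θ ∈ Φ.R ∧ ∀ β ∈ Φ.R, θ - β ∈ AddSubmonoid.closure Φ.F

/-- The basis `F^a = F ∪ {-θ + 1}` of `R^a`, with `θ` the highest root. -/
def Fa : Set Φ.Ra :=
  {a | (a.1.1 ∈ Φ.F ∧ a.1.2 = 0) ∨ ∃ θ, Φ.IsHighestRoot θ ∧ a.1 = (-θ, 1)}

/-- The length `l(w) = #(R^{a,+} ∩ w⁻¹ R^{a,-})`, where `R^{a,-} = -R^{a,+}`. -/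
def length (g : Φ.Wa) : ℕ∞ :=
  Set.encard {a : Φ.Ra | a ∈ Φ.RaPos ∧ ∃ b ∈ Φ.RaPos, act g.1 a.1 = -b.1}

/-- The affine reflection `s_a` as an element of `W^a`. -/
def refl (a : Φ.Ra) : Φ.Wa :=
  ⟨affRefl a.1, by
    obtain ⟨m, hm⟩ := a.2.2
    refine ⟨linRefl a.1.1, Subgroup.subset_closure ⟨_, a.2.1, rfl⟩, a.1.2 • coroot a.1.1, ?_, ?_⟩
    · rw [hm, Int.cast_smul_eq_zsmul]
      exact Φ.Y.zsmul_mem (Φ.coroot_mem_Y a.2.1) m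
    · intro v
      simp [affRefl, add_comm]⟩

/-- A multiplicity function: a `W^a`-invariant function `k : R^a → ℂ`. -/
structure Multiplicity where
  /-- the function -/
  toFun : Φ.Ra → ℂ
  invariant : ∀ (g : Φ.Wa) (a b : Φ.Ra), act g.1 a.1 = b.1 → toFun a = toFun b

/-! ### The algebra `A(k)` -/

variable (V) in
/-- The complexification `V_ℂ`. -/
abbrev VC : Type u := ℂ ⊗[ℝ] V

variable (V) in
/-- The symmetric algebra `S(V_ℂ)`. -/
abbrev SV : Type u := SymmetricAlgebra ℂ (VC V)

/-- The complex linear extension of an isometry `g` to `V_ℂ`. -/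
def linC (g : V ≃ₗᵢ[ℝ] V) : VC V →ₗ[ℂ] VC V :=
  LinearMap.baseChange ℂ (g.toLinearEquiv : V →ₗ[ℝ] V)

/-- The complex linear extension of `ξ ∈ V^*` to `V_ℂ`. -/
def dualC (ξ : StrongDual ℝ V) : VC V →ₗ[ℂ] ℂ :=
  LinearMap.liftBaseChange ℂ (Complex.ofRealCLM.toLinearMap ∘ₗ ξ.toLinearMap)

/-- The action of `g` on `S(V_ℂ)` by algebra endomorphisms, extending the action on `V_ℂ`. -/
def symAct (g : V ≃ₗᵢ[ℝ] V) : SV V →ₐ[ℂ] SV V :=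
  SymmetricAlgebra.lift (SymmetricAlgebra.ι ℂ (VC V) ∘ₗ linC g)

/-- The free algebra on the disjoint union of (the underlying sets of) `S(V_ℂ)` and `ℂ[W^a]`. -/
abbrev FreeAlg : Type u := FreeAlgebra ℂ (SV V ⊕ MonoidAlgebra ℂ Φ.Wa)

/-- The generator of the free algebra given by `p ∈ S(V_ℂ)`. -/
def genS (p : SV V) : Φ.FreeAlg := FreeAlgebra.ι ℂ (Sum.inl p)

/-- The generator of the free algebra given by `v ∈ V_ℂ`. -/
def genV (v : VC V) : Φ.FreeAlg := Φ.genS (SymmetricAlgebra.ι ℂ (VC V) v)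

/-- The generator of the free algebra given by `x ∈ ℂ[W^a]`. -/
def genW (x : MonoidAlgebra ℂ Φ.Wa) : Φ.FreeAlg := FreeAlgebra.ι ℂ (Sum.inr x)

/-- The generator of the free algebra given by `g ∈ W^a`. -/
def genG (g : Φ.Wa) : Φ.FreeAlg := Φ.genW (MonoidAlgebra.of ℂ Φ.Wa g)

/-- The defining relations of `A(k)`: the maps from `S(V_ℂ)` and from `ℂ[W^a]` are algebra
homomorphisms, `s_a v - s_{Da}(v) s_a = -k_a Da(v)` for `a ∈ F^a`, and `ω v = (Dω)(v) ω` for `ω`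
of length zero. -/
inductive Rel (k : Φ.Multiplicity) : Φ.FreeAlg → Φ.FreeAlg → Prop
  | S_add (p q : SV V) : Rel k (Φ.genS (p + q)) (Φ.genS p + Φ.genS q)
  | S_mul (p q : SV V) : Rel k (Φ.genS (p * q)) (Φ.genS p * Φ.genS q)
  | S_scalar (c : ℂ) : Rel k (Φ.genS (algebraMap ℂ _ c)) (algebraMap ℂ _ c)
  | W_add (x y : MonoidAlgebra ℂ Φ.Wa) : Rel k (Φ.genW (x + y)) (Φ.genW x + Φ.genW y)
  | W_mul (x y : MonoidAlgebra ℂ Φ.Wa) : Rel k (Φ.genW (x * y)) (Φ.genW x * Φ.genW y)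
  | W_scalar (c : ℂ) : Rel k (Φ.genW (algebraMap ℂ _ c)) (algebraMap ℂ _ c)
  | cross (a : Φ.Ra) (ha : a ∈ Φ.Fa) (v : VC V) :
      Rel k (Φ.genG (Φ.refl a) * Φ.genV v - Φ.genV (linC (linRefl a.1.1) v) * Φ.genG (Φ.refl a))
        (algebraMap ℂ _ (-(k.toFun a * dualC a.1.1 v)))
  | omega (g : Φ.Wa) (hg : Φ.length g = 0) (v : VC V) :
      Rel k (Φ.genG g * Φ.genV v) (Φ.genV (linC g.1.linearIsometryEquiv v) * Φ.genG g)

/-- The trigonometric Cherednik algebra `A(k)` at critical level. -/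
def A (k : Φ.Multiplicity) : Type u := RingQuot (Rel Φ k)

instance (k : Φ.Multiplicity) : Ring (Φ.A k) := inferInstanceAs (Ring (RingQuot (Rel Φ k)))

instance (k : Φ.Multiplicity) : Algebra ℂ (Φ.A k) :=
  inferInstanceAs (Algebra ℂ (RingQuot (Rel Φ k)))

/-- The quotient map from the free algebra. -/
def toA (k : Φ.Multiplicity) : Φ.FreeAlg →ₐ[ℂ] Φ.A k := RingQuot.mkAlgHom ℂ (Rel Φ k)

theorem toA_rel (k : Φ.Multiplicity) {x y : Φ.FreeAlg} (h : Rel Φ k x y) :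
    Φ.toA k x = Φ.toA k y :=
  RingQuot.mkAlgHom_rel ℂ h

/-- The canonical algebra homomorphism `S(V_ℂ) → A(k)`. -/
def inclS (k : Φ.Multiplicity) : SV V →ₐ[ℂ] Φ.A k :=
  AlgHom.ofLinearMap
    { toFun := fun p => Φ.toA k (Φ.genS p)
      map_add' := fun p q => by rw [Φ.toA_rel k (.S_add p q), map_add]
      map_smul' := fun c p => by
        rw [Algebra.smul_def, Φ.toA_rel k (.S_mul _ _), map_mul, Φ.toA_rel k (.S_scalar c),
          AlgHom.commutes, RingHom.id_apply, Algebra.smul_def] }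
    (by
      have := Φ.toA_rel k (.S_scalar 1)
      simpa using this)
    (fun p q => by
      have := Φ.toA_rel k (.S_mul p q)
      simpa using this)

/-- The canonical algebra homomorphism `ℂ[W^a] → A(k)`. -/
def inclW (k : Φ.Multiplicity) : MonoidAlgebra ℂ Φ.Wa →ₐ[ℂ] Φ.A k :=
  AlgHom.ofLinearMap
    { toFun := fun p => Φ.toA k (Φ.genW p)
      map_add' := fun p q => by rw [Φ.toA_rel k (.W_add p q), map_add]
      map_smul' := fun c p => by
        rw [Algebra.smul_def, Φ.toA_rel k (.W_mul _ _), map_mul, Φ.toA_rel k (.W_scalar c),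
          AlgHom.commutes, RingHom.id_apply, Algebra.smul_def] }
    (by
      have := Φ.toA_rel k (.W_scalar 1)
      rw [map_one, map_one, map_one] at this
      exact this)
    (fun p q => by
      have := Φ.toA_rel k (.W_mul p q)
      simpa using this)

/-- The multiplication map `S(V_ℂ) ⊗ ℂ[W^a] → A(k)`. -/
def mulMap (k : Φ.Multiplicity) : SV V ⊗[ℂ] MonoidAlgebra ℂ Φ.Wa →ₗ[ℂ] Φ.A k :=
  TensorProduct.lift
    ((LinearMap.mul ℂ (Φ.A k)).compl₁₂ (Φ.inclS k).toLinearMap (Φ.inclW k).toLinearMap)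

/-- The element of `A(k)` given by `v ∈ V`. -/
def vecA (k : Φ.Multiplicity) (v : V) : Φ.A k :=
  Φ.inclS k (SymmetricAlgebra.ι ℂ (VC V) (1 ⊗ₜ v))

/-- The element of `A(k)` given by `g ∈ W^a`. -/
def grpA (k : Φ.Multiplicity) (g : Φ.Wa) : Φ.A k := Φ.inclW k (MonoidAlgebra.of ℂ Φ.Wa g)

/-! ### Real analytic functions -/

variable (V) in
/-- The space `C^ω(V)` of complex-valued real analytic functions on `V`. -/
def Cω : Submodule ℂ (V → ℂ) where
  carrier := {g | AnalyticOnNhd ℝ g Set.univ}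
  add_mem' hf hg := hf.add hg
  zero_mem' := analyticOnNhd_const
  smul_mem' c f hf := by
    have h : AnalyticOnNhd ℝ (fun _ : V => c) Set.univ := analyticOnNhd_const
    exact h.mul hf

theorem Cω.differentiable (g : Cω V) : Differentiable ℝ g.1 :=
  fun x => (g.2 x trivial).differentiableAt

/-- The directional derivative `∂_v` on `C^ω(V)`. -/
def partialD (v : V) : Module.End ℂ (Cω V) where
  toFun g := ⟨fun x => fderiv ℝ g.1 x v, fun x hx => by
    exact ((ContinuousLinearMap.apply ℝ ℂ v).analyticAt _).comp (g.2.fderiv x hx)⟩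
  map_add' f g := by
    ext x
    simp [fderiv_add (Cω.differentiable f x) (Cω.differentiable g x)]
  map_smul' c g := by
    ext x
    simp [fderiv_const_smul (Cω.differentiable g x)]

theorem partialD_apply (v : V) (g : Cω V) (x : V) : (partialD v g).1 x = fderiv ℝ g.1 x v := rfl

theorem partialD_comm (v w : V) : partialD v * partialD w = partialD (V := V) w * partialD v := by
  ext g x
  have hg : Differentiable ℝ (fderiv ℝ g.1) := fun y => (g.2.fderiv y trivial).differentiableAt
  have key : ∀ v w : V, ((partialD v * partialD w) g).1 x = fderiv ℝ (fderiv ℝ g.1) x v w := by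
    intro v w
    change fderiv ℝ (fun y => fderiv ℝ g.1 y w) x v = _
    rw [fderiv_clm_apply (hg x) (differentiableAt_const w)]
    simp
  rw [key, key]
  have hs : IsSymmSndFDerivAt ℝ g.1 x :=
    ((g.2 x trivial).contDiffAt (n := 2)).isSymmSndFDerivAt (by simp)
  exact hs v w

variable (V) in
/-- The real linear map `v ↦ ∂_v`. -/
def partialLin : V →ₗ[ℝ] Module.End ℂ (Cω V) where
  toFun := partialD
  map_add' v w := by
    ext g x
    simp [partialD_apply]
  map_smul' c v := by
    ext g x
    simp [partialD_apply]

variable (V) in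
/-- The complex linear map `V_ℂ → End(C^ω(V))` extending `v ↦ ∂_v`. -/
def partialLinC : VC V →ₗ[ℂ] Module.End ℂ (Cω V) := LinearMap.liftBaseChange ℂ (partialLin V)

theorem partialLinC_comm (v w : VC V) :
    partialLinC V v * partialLinC V w = partialLinC V w * partialLinC V v := by
  change Commute (partialLinC V v) (partialLinC V w)
  induction v using TensorProduct.induction_on with
  | zero => simp
  | add x y hx hy => rw [map_add]; exact hx.add_left hy
  | tmul c v =>
    induction w using TensorProduct.induction_on with
    | zero => simp
    | add x y hx hy => rw [map_add]; exact hx.add_right hy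
    | tmul d w =>
      simp only [partialLinC, LinearMap.liftBaseChange_tmul]
      exact (Commute.smul_left (partialD_comm v w) c).smul_right d

/-- A linear map with pairwise commuting values extends to the symmetric algebra. -/
def symLift {N E : Type*} [AddCommGroup N] [Module ℂ N] [Semiring E] [Algebra ℂ E] (f : N →ₗ[ℂ] E)
    (hf : ∀ x y, f x * f y = f y * f x) : SymmetricAlgebra ℂ N →ₐ[ℂ] E :=
  RingCon.liftₐ _ (TensorAlgebra.lift ℂ f) (RingCon.ringConGen_le.2 fun x y h => by
    induction h with
    | mul_comm x y => simp [RingCon.ker_apply, hf x y])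

theorem symLift_ι {N E : Type*} [AddCommGroup N] [Module ℂ N] [Semiring E] [Algebra ℂ E]
    (f : N →ₗ[ℂ] E) (hf : ∀ x y, f x * f y = f y * f x) (x : N) :
    symLift f hf (SymmetricAlgebra.ι ℂ N x) = f x :=
  TensorAlgebra.lift_ι_apply f x

variable (V) in
/-- The assignment `p ↦ p(∂)` of constant coefficient differential operators on `C^ω(V)`: the
algebra homomorphism on `S(V_ℂ)` extending `v ↦ ∂_v` (see `diffOp_ι`). -/
def diffOp : SV V →ₐ[ℂ] Module.End ℂ (Cω V) := symLift (partialLinC V) partialLinC_comm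

theorem diffOp_ι (v : V) : diffOp V (SymmetricAlgebra.ι ℂ (VC V) (1 ⊗ₜ v)) = partialD v := by
  rw [diffOp, symLift_ι]
  simp [partialLinC, partialLin]

/-! ### The space `B^ω(V; M)` -/

/-- The set of regular elements: the complement of all affine root hyperplanes. -/
def Vreg : Set V := {v | ∀ a ∈ Φ.Ra, a.eval v ≠ 0}

/-- The chambers: the connected components of the set of regular elements. -/
def chambers : Set (Set V) := {C | ∃ x ∈ Φ.Vreg, C = connectedComponentIn Φ.Vreg x}

theorem exists_Ra_comp (g : Φ.Wa) {a : Aff V} (ha : a ∈ Φ.Ra) :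
    ∃ b ∈ Φ.Ra, ∀ v, b.eval v = a.eval (g.1 v) := by
  obtain ⟨w, hw, y, hy, h⟩ := g.2
  obtain ⟨m, hm⟩ := ha.2
  have hR := Φ.W_comp_mem_R hw a.1 ha.1
  obtain ⟨n, hn⟩ := hy _ (Φ.R_subset_X hR)
  refine ⟨(a.1.comp (w : V →L[ℝ] V), n + m), ⟨hR, n + m, by simp⟩, fun v => ?_⟩
  have hn' : a.1 (w y) = n := by simpa using hn
  simp [Aff.eval, h, hm, hn', add_assoc]

theorem smul_mem_Vreg (g : Φ.Wa) {v : V} (hv : v ∈ Φ.Vreg) : g.1 v ∈ Φ.Vreg := by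
  intro a ha
  obtain ⟨b, hb, h⟩ := Φ.exists_Ra_comp g ha
  rw [← h]
  exact hv b hb

variable {M : Type w} [AddCommGroup M] [Module ℂ M]

variable (V M) in
/-- Elements of `C^ω(V) ⊗ M` as `M`-valued functions on `V`. -/
def evalT : Cω V ⊗[ℂ] M →ₗ[ℂ] (V → M) :=
  TensorProduct.lift
    { toFun := fun g =>
        { toFun := fun m x => g.1 x • m
          map_add' := fun m n => by ext x; simp
          map_smul' := fun c m => by ext x; simp [smul_comm c] }
      map_add' := fun f g => by ext m x; simp [add_smul]
      map_smul' := fun c g => by ext m x; simp [mul_smul] }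

theorem evalT_tmul (g : Cω V) (m : M) (x : V) : evalT V M (g ⊗ₜ m) x = g.1 x • m := rfl

variable (M) in
/-- The functions `f : V_reg → M` whose restriction to `C` is the restriction of an element of
`C^ω(V) ⊗ M`. -/
def BOn (C : Set V) : Submodule ℂ (Φ.Vreg → M) where
  carrier := {f | ∃ t : Cω V ⊗[ℂ] M, ∀ x : Φ.Vreg, x.1 ∈ C → f x = evalT V M t x.1}
  add_mem' := by
    rintro f g ⟨s, hs⟩ ⟨t, ht⟩
    exact ⟨s + t, fun x hx => by simp [hs x hx, ht x hx]⟩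
  zero_mem' := ⟨0, fun x _ => by simp⟩
  smul_mem' := by
    rintro c f ⟨s, hs⟩
    exact ⟨c • s, fun x hx => by simp [hs x hx]⟩

variable (M) in
/-- The space `B^ω(V; M)` of functions `f : V_reg → M` such that, for every chamber `C`, the
restriction of `f` to `C` is the restriction of an element of `C^ω(V) ⊗ M`. -/
def B : Submodule ℂ (Φ.Vreg → M) := ⨅ C ∈ Φ.chambers, Φ.BOn M C

theorem mem_B {f : Φ.Vreg → M} :
    f ∈ Φ.B M ↔ ∀ C ∈ Φ.chambers, ∃ t : Cω V ⊗[ℂ] M,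
      ∀ x : Φ.Vreg, x.1 ∈ C → f x = evalT V M t x.1 := by
  simp only [B, Submodule.mem_iInf]
  rfl

/-! ### The action of `W^a` on `B^ω(V; M)` -/

/-- The diagonal action `(w · f)(v) = w (f (w⁻¹ v))` on functions. -/
def dotFun (ρ : Representation ℂ Φ.Wa M) (g : Φ.Wa) : (Φ.Vreg → M) →ₗ[ℂ] (Φ.Vreg → M) where
  toFun f x := ρ g (f ⟨(g⁻¹ : Φ.Wa).1 x.1, Φ.smul_mem_Vreg g⁻¹ x.2⟩)
  map_add' f h := by ext x; simp
  map_smul' c f := by ext x; simp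

theorem image_chamber (g : Φ.Wa) {C : Set V} (hC : C ∈ Φ.chambers) : g.1 '' C ∈ Φ.chambers := by
  obtain ⟨x, hx, rfl⟩ := hC
  refine ⟨g.1 x, Φ.smul_mem_Vreg g hx, ?_⟩
  have himg : g.1 '' Φ.Vreg = Φ.Vreg := by
    apply Set.Subset.antisymm
    · rintro _ ⟨y, hy, rfl⟩
      exact Φ.smul_mem_Vreg g hy
    · intro y hy
      exact ⟨_, Φ.smul_mem_Vreg g⁻¹ hy, g.1.apply_symm_apply y⟩
  have := g.1.toHomeomorph.image_connectedComponentIn hx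
  simpa [himg] using this

/-- The action of isometries on `C^ω(V)` by `(w g)(v) = g (w⁻¹ v)`. -/
def pull (e : V ≃ᵃⁱ[ℝ] V) : Cω V →ₗ[ℂ] Cω V where
  toFun g := ⟨fun x => g.1 (e⁻¹ x), fun x _ => by
    have h : (fun x => e⁻¹ x) = fun x => e⁻¹.linearIsometryEquiv x + e⁻¹ 0 := by
      ext x; exact apply_eq _ x
    refine AnalyticAt.comp (g.2 _ trivial) ?_
    change AnalyticAt ℝ (fun x => e⁻¹ x) x
    rw [h]
    exact (ContinuousLinearMap.analyticAt (e⁻¹.linearIsometryEquiv : V →L[ℝ] V) x).add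
      analyticAt_const⟩
  map_add' _ _ := rfl
  map_smul' _ _ := rfl

theorem evalT_map (e : V ≃ᵃⁱ[ℝ] V) (r : M →ₗ[ℂ] M) (t : Cω V ⊗[ℂ] M) (x : V) :
    evalT V M (TensorProduct.map (pull e) r t) x = r (evalT V M t (e⁻¹ x)) := by
  induction t using TensorProduct.induction_on with
  | zero => simp
  | add s t hs ht => simp [hs, ht]
  | tmul g m => simp [evalT_tmul, pull]

theorem dotFun_mem (ρ : Representation ℂ Φ.Wa M) (g : Φ.Wa) {f : Φ.Vreg → M} (hf : f ∈ Φ.B M) :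
    Φ.dotFun ρ g f ∈ Φ.B M := by
  rw [mem_B] at hf ⊢
  intro C hC
  obtain ⟨t, ht⟩ := hf _ (Φ.image_chamber g⁻¹ hC)
  refine ⟨TensorProduct.map (pull g.1) (ρ g) t, fun x hx => ?_⟩
  rw [evalT_map]
  exact congrArg (ρ g) (ht _ ⟨x.1, hx, rfl⟩)

/-- The diagonal action of `w ∈ W^a` on `B^ω(V; M)`. -/
def dot (ρ : Representation ℂ Φ.Wa M) (g : Φ.Wa) : Module.End ℂ (Φ.B M) :=
  (Φ.dotFun ρ g).restrict fun _ hf => Φ.dotFun_mem ρ g hf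

/-! ### The Dunkl type operators -/

open Classical in
/-- The extension by zero of a function on the regular elements to `V`. -/
def ext (f : Φ.Vreg → M) (x : V) : M := if h : x ∈ Φ.Vreg then f ⟨x, h⟩ else 0

/-- `m` is the derivative at `t = 0` of `t ↦ f (x + t v)`. As `M` carries no topology, this is
tested against all linear functionals on `M`; for functions that take values, near `x`, in a
finite-dimensional subspace of `M` (such as the elements of `B^ω(V; M)`) it is the usual notion.
The set of regular elements is open, so the values of the extension by zero do not matter. -/
def HasDirDeriv (f : Φ.Vreg → M) (x : Φ.Vreg) (v : V) (m : M) : Prop :=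
  ∀ ψ : Module.Dual ℂ M, HasDerivAt (fun t : ℝ => ψ (Φ.ext f (x.1 + t • v))) (ψ m) 0

open Classical in
/-- The directional derivative `(∂_v f)(x)`. -/
def dirDeriv (f : Φ.Vreg → M) (v : V) (x : Φ.Vreg) : M :=
  if h : ∃ m, Φ.HasDirDeriv f x v m then h.choose else 0

/-- The indicator function `ℐ_a` of the set where the affine root `a` is negative. -/
def ind (a : Φ.Ra) (x : Φ.Vreg) : ℂ := if a.1.eval x.1 < 0 then 1 else 0

/-- The function
`∂_v f - ∑_{a ∈ R^{a,+}} k_a (Da)(v) ℐ_a(·) (s_a · f)`; the sum is finite at each point. -/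
def dunklFun (k : Φ.Multiplicity) (ρ : Representation ℂ Φ.Wa M) (v : V) (f : Φ.Vreg → M) :
    Φ.Vreg → M := fun x =>
  Φ.dirDeriv f v x -
    ∑ᶠ a ∈ Φ.RaPos, (k.toFun a * (a.1.1 v : ℂ) * Φ.ind a x) • Φ.dotFun ρ (Φ.refl a) f x

theorem HasDirDeriv.unique {f : Φ.Vreg → M} {x : Φ.Vreg} {v : V} {m n : M}
    (hm : Φ.HasDirDeriv f x v m) (hn : Φ.HasDirDeriv f x v n) : m = n := by
  rw [← sub_eq_zero, ← Module.forall_dual_apply_eq_zero_iff ℂ]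
  intro ψ
  rw [map_sub, (hm ψ).unique (hn ψ), sub_self]

theorem dirDeriv_eq {f : Φ.Vreg → M} {x : Φ.Vreg} {v : V} {m : M} (h : Φ.HasDirDeriv f x v m) :
    Φ.dirDeriv f v x = m := by
  have h' : ∃ m, Φ.HasDirDeriv f x v m := ⟨m, h⟩
  rw [dirDeriv, dif_pos h']
  exact HasDirDeriv.unique Φ h'.choose_spec h

theorem continuous_eval (a : Aff V) : Continuous a.eval :=
  a.1.continuous.add continuous_const

theorem isOpen_Vreg : IsOpen Φ.Vreg := by
  have : Φ.Vreg = ⋂ α ∈ Φ.R, {v | α v ∉ Set.range ((↑) : ℤ → ℝ)} := by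
    ext v
    simp only [Vreg, Ra, Set.mem_ofPred_eq, Set.mem_iInter, Set.mem_range, not_exists]
    constructor
    · intro h α hα m hm
      exact h (α, ((-m : ℤ) : ℝ)) ⟨hα, -m, rfl⟩ (by simp [Aff.eval, hm])
    · rintro h a ⟨ha, m, hm⟩ h0
      refine h a.1 ha (-m) ?_
      rw [Aff.eval, hm] at h0
      push_cast
      linarith
  rw [this]
  refine Φ.finite.isOpen_biInter fun α _ => ?_
  exact (Int.isClosedEmbedding_coe_real.isClosed_range.isOpen_compl).preimage α.continuous

theorem chamber_isOpen {C : Set V} (hC : C ∈ Φ.chambers) : IsOpen C := by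
  obtain ⟨x, -, rfl⟩ := hC
  exact Φ.isOpen_Vreg.connectedComponentIn

theorem finite_neg (x : V) : {a : Φ.Ra | a ∈ Φ.RaPos ∧ a.1.eval x < 0}.Finite := by
  have hfin : (⋃ α ∈ Φ.R, (fun m : ℤ => ((α, (m : ℝ)) : Aff V)) '' Set.Icc 0 ⌈-α x⌉).Finite :=
    Φ.finite.biUnion fun α _ => (Set.finite_Icc _ _).image _
  refine Set.Finite.of_finite_image (hfin.subset ?_) Subtype.val_injective.injOn
  rintro _ ⟨a, ⟨hpos, hneg⟩, rfl⟩
  obtain ⟨m, hm⟩ := a.2.2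
  have h0 : (0 : ℝ) ≤ a.1.2 := by
    rcases hpos with h | h
    · exact h.le
    · exact h.1.ge
  refine Set.mem_biUnion a.2.1 ⟨m, ⟨?_, ?_⟩, ?_⟩
  · rw [hm] at h0
    exact_mod_cast h0
  · have h1 : (m : ℝ) < -a.1.1 x := by
      rw [Aff.eval, hm] at hneg
      linarith
    exact_mod_cast (h1.le.trans (Int.le_ceil _))
  · simp [← hm]

theorem neg_of_chamber {C : Set V} (hC : C ∈ Φ.chambers) {x y : V} (hx : x ∈ C) (hy : y ∈ C)
    (a : Φ.Ra) (h : a.1.eval x < 0) : a.1.eval y < 0 := by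
  obtain ⟨z, hz, rfl⟩ := hC
  by_contra hc
  have hsub := connectedComponentIn_subset Φ.Vreg z
  obtain ⟨u, hu, hu0⟩ := isPreconnected_connectedComponentIn.intermediate_value hx hy
    (continuous_eval a.1).continuousOn ⟨h.le, not_lt.1 hc⟩
  exact hsub hu a.1 a.2 hu0

theorem hasDirDeriv_evalT {f : Φ.Vreg → M} {C : Set V} (hC : C ∈ Φ.chambers) {t : Cω V ⊗[ℂ] M}
    (ht : ∀ x : Φ.Vreg, x.1 ∈ C → f x = evalT V M t x.1) (v : V) (x : Φ.Vreg) (hx : x.1 ∈ C) :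
    Φ.HasDirDeriv f x v (evalT V M ((partialD v).rTensor M t) x.1) := by
  intro ψ
  have h1 : HasDerivAt (fun s : ℝ => ψ (evalT V M t (x.1 + s • v)))
      (ψ (evalT V M ((partialD v).rTensor M t) x.1)) 0 := by
    clear ht
    induction t using TensorProduct.induction_on with
    | zero => simpa using hasDerivAt_const (0 : ℝ) (0 : ℂ)
    | add s t hs ht => simpa [Pi.add_def] using hs.add ht
    | tmul g m =>
      have hl : HasDerivAt (fun s : ℝ => x.1 + s • v) v 0 := by
        simpa using ((hasDerivAt_id (0 : ℝ)).smul_const v).const_add x.1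
      have hg : HasFDerivAt g.1 (fderiv ℝ g.1 x.1) (x.1 + (0 : ℝ) • v) := by
        simpa using (Cω.differentiable g x.1).hasFDerivAt
      have := (hg.comp_hasDerivAt (0 : ℝ) hl).mul_const (ψ m)
      simpa [evalT_tmul, partialD_apply] using this
  refine h1.congr_of_eventuallyEq ?_
  have hc : ContinuousAt (fun s : ℝ => x.1 + s • v) 0 := by fun_prop
  have hmem : C ∈ nhds (x.1 + (0 : ℝ) • v) := by
    simpa using (Φ.chamber_isOpen hC).mem_nhds hx
  filter_upwards [hc hmem] with s hs
  have hr : x.1 + s • v ∈ Φ.Vreg := by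
    obtain ⟨z, -, rfl⟩ := hC
    exact connectedComponentIn_subset _ _ hs
  rw [ext, dif_pos hr, ht ⟨_, hr⟩ hs]

theorem mem_own_chamber (x : Φ.Vreg) : ∃ C ∈ Φ.chambers, x.1 ∈ C :=
  ⟨_, ⟨x.1, x.2, rfl⟩, mem_connectedComponentIn x.2⟩

theorem hasDirDeriv_dirDeriv {f : Φ.Vreg → M} (hf : f ∈ Φ.B M) (v : V) (x : Φ.Vreg) :
    Φ.HasDirDeriv f x v (Φ.dirDeriv f v x) := by
  obtain ⟨C, hC, hx⟩ := Φ.mem_own_chamber x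
  obtain ⟨t, ht⟩ := Φ.mem_B.1 hf C hC
  have h := Φ.hasDirDeriv_evalT hC ht v x hx
  rwa [Φ.dirDeriv_eq h]

theorem dirDeriv_mem {f : Φ.Vreg → M} (hf : f ∈ Φ.B M) (v : V) : Φ.dirDeriv f v ∈ Φ.B M := by
  rw [mem_B] at hf ⊢
  intro C hC
  obtain ⟨t, ht⟩ := hf C hC
  exact ⟨_, fun x hx => Φ.dirDeriv_eq (Φ.hasDirDeriv_evalT hC ht v x hx)⟩

theorem finite_support_term (c : Φ.Ra → M) (d : Φ.Ra → ℂ) (x : Φ.Vreg) :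
    (Φ.RaPos ∩ Function.support fun a : Φ.Ra => (d a * Φ.ind a x) • c a).Finite := by
  refine (Φ.finite_neg x.1).subset fun a ha => ⟨ha.1, ?_⟩
  by_contra hc
  exact ha.2 (by simp [ind, hc])

theorem dunklFun_mem (k : Φ.Multiplicity) (ρ : Representation ℂ Φ.Wa M) (v : V)
    {f : Φ.Vreg → M} (hf : f ∈ Φ.B M) : Φ.dunklFun k ρ v f ∈ Φ.B M := by
  rw [mem_B]
  intro C hC
  obtain ⟨z, hz, hCz⟩ := hC
  have hC : C ∈ Φ.chambers := ⟨z, hz, hCz⟩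
  have hzC : z ∈ C := hCz ▸ mem_connectedComponentIn hz
  let S := (Φ.finite_neg z).toFinset
  have hg : Φ.dirDeriv f v - ∑ a ∈ S, (k.toFun a * (a.1.1 v : ℂ)) • Φ.dotFun ρ (Φ.refl a) f
      ∈ Φ.B M :=
    Submodule.sub_mem _ (Φ.dirDeriv_mem hf v) (Submodule.sum_mem _ fun a _ =>
      Submodule.smul_mem _ _ (Φ.dotFun_mem ρ _ hf))
  obtain ⟨t, ht⟩ := Φ.mem_B.1 hg C hC
  refine ⟨t, fun x hx => ?_⟩
  rw [← ht x hx, dunklFun, Pi.sub_apply, Finset.sum_apply]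
  congr 1
  rw [finsum_mem_def]
  rw [finsum_eq_sum_of_support_subset (s := S)]
  · refine Finset.sum_congr rfl fun a ha => ?_
    have ha' : a ∈ Φ.RaPos ∧ a.1.eval z < 0 := by simpa [S] using ha
    have : a.1.eval x.1 < 0 := Φ.neg_of_chamber hC hzC hx a ha'.2
    simp [ha'.1, ind, this]
  · intro a ha
    by_contra hc
    apply ha
    by_cases hp : a ∈ Φ.RaPos
    · have : ¬ a.1.eval x.1 < 0 := fun h =>
        hc (by simpa [S] using ⟨hp, Φ.neg_of_chamber hC hx hzC a h⟩)
      simp [ind, this]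
    · simp [hp]

/-- The Dunkl type operator `𝒟_v^{k,M}` on `B^ω(V; M)`. -/
def dunkl (k : Φ.Multiplicity) (ρ : Representation ℂ Φ.Wa M) (v : V) : Module.End ℂ (Φ.B M) where
  toFun f := ⟨Φ.dunklFun k ρ v f.1, Φ.dunklFun_mem k ρ v f.2⟩
  map_add' f g := by
    ext x
    have h1 : Φ.dirDeriv (f.1 + g.1) v x = Φ.dirDeriv f.1 v x + Φ.dirDeriv g.1 v x := by
      apply Φ.dirDeriv_eq
      intro ψ
      have := (Φ.hasDirDeriv_dirDeriv f.2 v x ψ).add (Φ.hasDirDeriv_dirDeriv g.2 v x ψ)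
      rw [map_add]
      refine this.congr_of_eventuallyEq (Filter.Eventually.of_forall fun s => ?_)
      by_cases h : x.1 + s • v ∈ Φ.Vreg <;> simp [RootData.ext, h]
    simp only [Submodule.coe_add, dunklFun, h1, Pi.add_apply, map_add, smul_add]
    rw [← add_sub_add_comm]
    congr 1
    exact finsum_mem_add_distrib' (Φ.finite_support_term _ _ x) (Φ.finite_support_term _ _ x)
  map_smul' c f := by
    ext x
    have h1 : Φ.dirDeriv (c • f.1) v x = c • Φ.dirDeriv f.1 v x := by
      apply Φ.dirDeriv_eq
      intro ψ
      have := (Φ.hasDirDeriv_dirDeriv f.2 v x ψ).const_mul c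
      rw [map_smul]
      refine this.congr_of_eventuallyEq (Filter.Eventually.of_forall fun s => ?_)
      by_cases h : x.1 + s • v ∈ Φ.Vreg <;> simp [RootData.ext, h]
    simp only [Submodule.coe_smul, dunklFun, h1, Pi.smul_apply, map_smul, RingHom.id_apply,
      smul_sub]
    congr 1
    rw [smul_finsum]
    refine finsum_congr fun a => ?_
    rw [smul_finsum]
    exact finsum_congr fun _ => smul_comm _ _ _

/-- The algebra homomorphism `π : A(k) → End(B^ω(V; M))` extends the assignments `v ↦ 𝒟_v^{k,M}`
(`v ∈ V`) and `w ↦ w ·` (`w ∈ W^a`). -/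
def Extends (k : Φ.Multiplicity) (ρ : Representation ℂ Φ.Wa M)
    (π : Φ.A k →ₐ[ℂ] Module.End ℂ (Φ.B M)) : Prop :=
  (∀ v : V, π (Φ.vecA k v) = Φ.dunkl k ρ v) ∧ ∀ g : Φ.Wa, π (Φ.grpA k g) = Φ.dot ρ g

end RootData
end DunklCherednik
end

noncomputable section

namespace DunklCherednik

/-! ### Reflections and the isometry action on affine linear functions -/

section Reflections

variable {V : Type u} [NormedAddCommGroup V] [InnerProductSpace ℝ V] [FiniteDimensional ℝ V]

/-! The proof rests on one observation: in the fundamental chamber every positive affine root is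
positive, so all indicators vanish and the Dunkl operators are plain directional derivatives
(`dunklFun_of_dominant`). The group `W^a` carries any regular point into that chamber, and
statements proved there are transported along the group action.

Geometry. Irreducibility gives a highest root (`exists_highestRoot`), hence positive affine roots
are nonnegative integral combinations of the linearly independent set `F^a`. A simple reflection
therefore makes only its own positive root negative, and the number of positive roots negative at a
point can be lowered to zero (`exists_dominant_translate`). It follows that `W^a` is generated by
simple reflections and elements of length zero, which is the induction principle `Wa_induction`.

Existence of the representation. Conjugating a Dunkl operator by `g` replaces the index set
`R^{a,+}` by its image under `g`. Length-zero elements preserve it; a simple reflection exchanges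
only `a` for `-a`, and since the two indicators add up to 1 the difference is the scalar in the
cross relation (`dot_dunkl_omega`, `dot_dunkl_simple`). These relations force the commutator of two
Dunkl operators to be equivariant (`dot_dunklBracket`). It vanishes in the fundamental chamber
because partial derivatives commute, hence everywhere (`dunkl_comm`). Uniqueness and functoriality
need checking only on the generators `V` and `W^a`.

Linear isomorphism. The relations move group elements to the right, which gives surjectivity. For
injectivity `M` is taken to be the regular representation: at a dominant point, the coefficient of
`w` in the action on `h ⊗ 1` is `p_w(∂)(w h)`, where `p_w` is the coefficient of `w`
(`repr_piRep_mulMap`), and exponentials detect every nonzero `p_w`.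

Invariants. Moving a group element past `p` produces a divided difference, which vanishes for
invariant `p`; so `p` commutes with `W^a` in `A(k)`, and its action by `p(∂)` spreads from the
fundamental chamber to all others. -/

theorem Aff.ext_eval {φ ψ : Aff V} (h : ∀ v, φ.eval v = ψ.eval v) : φ = ψ := by
  have h0 : φ.2 = ψ.2 := by simpa [Aff.eval] using h 0
  refine Prod.ext ?_ h0
  ext v
  have := h v
  simp only [Aff.eval, h0] at this
  exact add_right_cancel this

theorem Aff.eval_add (φ ψ : Aff V) (v : V) : (φ + ψ).eval v = φ.eval v + ψ.eval v := by
  simp [Aff.eval]; ring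

theorem Aff.eval_neg (φ : Aff V) (v : V) : (-φ).eval v = -φ.eval v := by
  simp [Aff.eval]; ring

theorem Aff.eval_sub (φ ψ : Aff V) (v : V) : (φ - ψ).eval v = φ.eval v - ψ.eval v := by
  simp [Aff.eval]; ring

theorem Aff.eval_smul (c : ℝ) (φ : Aff V) (v : V) : (c • φ).eval v = c * φ.eval v := by
  simp [Aff.eval]; ring

theorem act_mul (g h : V ≃ᵃⁱ[ℝ] V) (φ : Aff V) : act (g * h) φ = act g (act h φ) :=
  Aff.ext_eval fun v => by simp [act_eval]

theorem act_one (φ : Aff V) : act 1 φ = φ :=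
  Aff.ext_eval fun v => by simp [act_eval]

theorem act_neg (g : V ≃ᵃⁱ[ℝ] V) (φ : Aff V) : act g (-φ) = -act g φ :=
  Aff.ext_eval fun v => by simp [act_eval, Aff.eval_neg]

theorem act_inv_act (g : V ≃ᵃⁱ[ℝ] V) (φ : Aff V) : act g⁻¹ (act g φ) = φ := by
  rw [← act_mul, inv_mul_cancel, act_one]

theorem act_act_inv (g : V ≃ᵃⁱ[ℝ] V) (φ : Aff V) : act g (act g⁻¹ φ) = φ := by
  rw [← act_mul, mul_inv_cancel, act_one]

theorem act_fst_apply (g : V ≃ᵃⁱ[ℝ] V) (φ : Aff V) (v : V) :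
    (act g φ).1 (g.linearIsometryEquiv v) = φ.1 v := by
  change φ.1 ((g.linearIsometryEquiv.symm) (g.linearIsometryEquiv v)) = _
  rw [LinearIsometryEquiv.symm_apply_apply]

theorem coroot_neg (ξ : StrongDual ℝ V) : coroot (-ξ) = -coroot ξ := by
  simp [coroot]

theorem coroot_act (g : V ≃ᵃⁱ[ℝ] V) (φ : Aff V) :
    coroot (act g φ).1 = g.linearIsometryEquiv (coroot φ.1) := by
  have h : (InnerProductSpace.toDual ℝ V).symm (act g φ).1 =
      g.linearIsometryEquiv ((InnerProductSpace.toDual ℝ V).symm φ.1) := by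
    refine ext_inner_right ℝ fun v => ?_
    obtain ⟨w, rfl⟩ := g.linearIsometryEquiv.surjective v
    rw [LinearIsometryEquiv.inner_map_map, InnerProductSpace.toDual_symm_apply,
      InnerProductSpace.toDual_symm_apply, act_fst_apply]
  have hn : ‖(act g φ).1‖ = ‖φ.1‖ := by
    rw [← LinearIsometryEquiv.norm_map (InnerProductSpace.toDual ℝ V).symm, h,
      LinearIsometryEquiv.norm_map, LinearIsometryEquiv.norm_map]
  rw [coroot, coroot, h, hn, map_smul]

theorem affRefl_neg (φ : Aff V) : affRefl (-φ) = affRefl φ := by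
  ext v
  rw [affRefl_apply, affRefl_apply, Aff.eval_neg, Prod.fst_neg, coroot_neg]
  simp

theorem affRefl_act (g : V ≃ᵃⁱ[ℝ] V) (φ : Aff V) : affRefl (act g φ) = g * affRefl φ * g⁻¹ := by
  ext v
  have h : g (g⁻¹ v) = v := g.apply_symm_apply v
  simp only [AffineIsometryEquiv.coe_mul, Function.comp_apply]
  rw [affRefl_apply, affRefl_apply, act_eval, coroot_act, apply_eq g (g⁻¹ v - _), map_sub,
    map_smul, sub_add_eq_add_sub, ← apply_eq, h]

theorem affRefl_mul_self {φ : Aff V} (h : φ.1 ≠ 0) : affRefl φ * affRefl φ = 1 := by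
  ext v
  simp only [AffineIsometryEquiv.coe_mul, Function.comp_apply, AffineIsometryEquiv.coe_one, id]
  rw [affRefl_apply, affRefl_apply]
  have : φ.eval (v - φ.eval v • coroot φ.1) = -φ.eval v := by
    simp only [Aff.eval, map_sub, map_smul, coroot_pairing h, smul_eq_mul]
    ring
  rw [this]
  simp

theorem affRefl_inv {φ : Aff V} (h : φ.1 ≠ 0) : (affRefl φ)⁻¹ = affRefl φ :=
  inv_eq_of_mul_eq_one_left (affRefl_mul_self h)

theorem act_affRefl {φ : Aff V} (h : φ.1 ≠ 0) (ψ : Aff V) :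
    act (affRefl φ) ψ = ψ - ψ.1 (coroot φ.1) • φ := by
  refine Aff.ext_eval fun v => ?_
  rw [act_eval, affRefl_inv h, affRefl_apply, Aff.eval_sub, Aff.eval_smul]
  simp [Aff.eval]
  ring

theorem affRefl_linear (φ : Aff V) : (affRefl φ).linearIsometryEquiv = linRefl φ.1 := by
  ext v
  have h := apply_eq (affRefl φ) v
  rw [affRefl_apply, affRefl_apply] at h
  rw [linRefl_apply]
  have h2 := eq_sub_of_add_eq h.symm
  rw [h2]
  simp only [Aff.eval, map_zero]
  module

theorem linRefl_pairing (ξ : StrongDual ℝ V) (v : V) : ξ (linRefl ξ v) = -ξ v := by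
  by_cases h : ξ = 0
  · simp [h]
  · rw [linRefl_apply, map_sub, map_smul, coroot_pairing h, smul_eq_mul]
    ring

end Reflections

/-! ### Affine roots as a `W^a`-set -/

namespace RootData

variable {V : Type u} [NormedAddCommGroup V] [InnerProductSpace ℝ V] [FiniteDimensional ℝ V]
  (Φ : RootData V)

theorem ne_zero_of_mem {α : StrongDual ℝ V} (h : α ∈ Φ.R) : α ≠ 0 :=
  fun h0 => Φ.zero_notMem (h0 ▸ h)

theorem neg_mem_R {α : StrongDual ℝ V} (h : α ∈ Φ.R) : -α ∈ Φ.R := by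
  have := Φ.reflection_mem α h α h
  rw [coroot_pairing (Φ.ne_zero_of_mem h)] at this
  convert this using 1
  module

theorem neg_mem_Ra {a : Aff V} (h : a ∈ Φ.Ra) : -a ∈ Φ.Ra := by
  obtain ⟨h1, m, hm⟩ := h
  exact ⟨Φ.neg_mem_R h1, -m, by simp [hm]⟩

theorem grad_ne_zero (a : Φ.Ra) : a.1.1 ≠ 0 := Φ.ne_zero_of_mem a.2.1

theorem act_mem_Ra (g : Φ.Wa) {a : Aff V} (h : a ∈ Φ.Ra) : act g.1 a ∈ Φ.Ra := by
  obtain ⟨b, hb, h'⟩ := Φ.exists_Ra_comp g⁻¹ h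
  have : act g.1 a = b := Aff.ext_eval fun v => by rw [act_eval, h']; rfl
  rwa [this]

/-- The negative of an affine root. -/
def negRoot (a : Φ.Ra) : Φ.Ra := ⟨-a.1, Φ.neg_mem_Ra a.2⟩

/-- The permutation of the affine roots induced by an element of `W^a`. -/
def perm (g : Φ.Wa) : Φ.Ra ≃ Φ.Ra where
  toFun a := ⟨act g.1 a.1, Φ.act_mem_Ra g a.2⟩
  invFun a := ⟨act (g⁻¹ : Φ.Wa).1 a.1, Φ.act_mem_Ra g⁻¹ a.2⟩
  left_inv a := Subtype.ext (act_inv_act g.1 a.1)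
  right_inv a := Subtype.ext (act_act_inv g.1 a.1)

theorem perm_val (g : Φ.Wa) (a : Φ.Ra) : (Φ.perm g a).1 = act g.1 a.1 := rfl

theorem perm_symm_val (g : Φ.Wa) (a : Φ.Ra) : ((Φ.perm g).symm a).1 = act g.1⁻¹ a.1 := rfl

theorem perm_mul (g h : Φ.Wa) (a : Φ.Ra) : Φ.perm (g * h) a = Φ.perm g (Φ.perm h a) :=
  Subtype.ext (act_mul g.1 h.1 a.1)

theorem perm_eval (g : Φ.Wa) (a : Φ.Ra) (v : V) :
    (Φ.perm g a).1.eval v = a.1.eval ((g⁻¹ : Φ.Wa).1 v) := act_eval g.1 a.1 v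

theorem perm_neg (g : Φ.Wa) (a : Φ.Ra) : Φ.perm g (Φ.negRoot a) = Φ.negRoot (Φ.perm g a) :=
  Subtype.ext (act_neg g.1 a.1)

theorem negRoot_eval (a : Φ.Ra) (v : V) : (Φ.negRoot a).1.eval v = -a.1.eval v :=
  Aff.eval_neg a.1 v

theorem refl_perm (g : Φ.Wa) (a : Φ.Ra) : Φ.refl (Φ.perm g a) = g * Φ.refl a * g⁻¹ :=
  Subtype.ext (affRefl_act g.1 a.1)

theorem refl_negRoot (a : Φ.Ra) : Φ.refl (Φ.negRoot a) = Φ.refl a :=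
  Subtype.ext (affRefl_neg a.1)

theorem refl_mul_refl (a : Φ.Ra) : Φ.refl a * Φ.refl a = 1 :=
  Subtype.ext (affRefl_mul_self (Φ.grad_ne_zero a))

theorem refl_inv (a : Φ.Ra) : (Φ.refl a)⁻¹ = Φ.refl a :=
  inv_eq_of_mul_eq_one_left (Φ.refl_mul_refl a)

theorem perm_refl_val (a b : Φ.Ra) :
    (Φ.perm (Φ.refl a) b).1 = b.1 - b.1.1 (coroot a.1.1) • a.1 :=
  act_affRefl (Φ.grad_ne_zero a) b.1

theorem perm_refl_self (a : Φ.Ra) : Φ.perm (Φ.refl a) a = Φ.negRoot a := by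
  apply Subtype.ext
  rw [perm_refl_val, coroot_pairing (Φ.grad_ne_zero a)]
  change _ = -a.1
  module

theorem perm_refl_refl (a b : Φ.Ra) : Φ.perm (Φ.refl a) (Φ.perm (Φ.refl a) b) = b := by
  rw [← perm_mul, refl_mul_refl]
  exact Subtype.ext (act_one b.1)

theorem refl_linear (a : Φ.Ra) : (Φ.refl a).1.linearIsometryEquiv = linRefl a.1.1 :=
  affRefl_linear a.1

theorem linear_mem_W (g : Φ.Wa) : g.1.linearIsometryEquiv ∈ Φ.W := by
  obtain ⟨w, hw, y, hy, h⟩ := g.2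
  have : g.1.linearIsometryEquiv = w := by
    ext v
    have h1 := apply_eq g.1 v
    rw [h, h, zero_add, map_add] at h1
    exact (add_right_cancel h1).symm
  rwa [this]

namespace Multiplicity

variable {Φ} (k : Φ.Multiplicity)

theorem perm (g : Φ.Wa) (a : Φ.Ra) : k.toFun (Φ.perm g a) = k.toFun a :=
  (k.invariant g a _ rfl).symm

theorem neg (a : Φ.Ra) : k.toFun (Φ.negRoot a) = k.toFun a := by
  rw [← Φ.perm_refl_self, k.perm]

end Multiplicity

end RootData

/-! ### Cones spanned by linearly independent sets -/

section Coordinates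

variable {E : Type*} [AddCommGroup E] [Module ℝ E]

/-- Extending `S` to a basis of the whole space yields coordinate functionals defined everywhere.
This matters because the roots need not span; the expansion of a vector is only available inside the
span of `S`. -/
theorem exists_coordinates {S : Set E} (hfin : S.Finite) (hS : LinearIndepOn ℝ id S) :
    ∃ c : E → E →ₗ[ℝ] ℝ, (∀ a ∈ S, c a a = 1) ∧ (∀ a ∈ S, ∀ b ∈ S, b ≠ a → c a b = 0) ∧
      (∀ x ∈ Submodule.span ℝ S, x = ∑ a ∈ hfin.toFinset, c a x • a) ∧
      ∀ x ∈ AddSubmonoid.closure S, ∀ a ∈ S, 0 ≤ c a x := by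
  classical
  let b := Module.Basis.extend hS
  have hsub : S ⊆ hS.extend (Set.subset_univ S) := hS.subset_extend _
  -- The value 0 outside the extended basis is a default; only indices in `S` are used.
  let c : E → E →ₗ[ℝ] ℝ := fun a =>
    if h : a ∈ hS.extend (Set.subset_univ S) then b.coord ⟨a, h⟩ else 0
  have hc : ∀ a ∈ S, ∀ x ∈ S, c a x = if a = x then 1 else 0 := by
    intro a ha x hx
    have hx' : x = b ⟨x, hsub hx⟩ := by simp [b]
    simp only [c, dif_pos (hsub ha)]
    conv_lhs => rw [hx']
    simp [Finsupp.single_apply, eq_comm]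
  refine ⟨c, fun a ha => by simp [hc a ha a ha], fun a ha x hx h => by simp [hc a ha x hx, h.symm],
    fun x hx => ?_, fun x hx a ha => ?_⟩
  · let L : E →ₗ[ℝ] E := ∑ a ∈ hfin.toFinset, (c a).smulRight a
    have hL : ∀ x, L x = ∑ a ∈ hfin.toFinset, c a x • a := fun x => by simp [L]
    have : Set.EqOn (LinearMap.id : E →ₗ[ℝ] E) L (Submodule.span ℝ S) := by
      refine LinearMap.eqOn_span fun y hy => ?_
      rw [hL, Finset.sum_eq_single y]
      · simp [hc y hy y hy]
      · intro a ha hay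
        simp [hc a (by simpa using ha) y hy, hay]
      · intro h
        simp [hy] at h
    rw [← hL]
    exact this hx
  · induction hx using AddSubmonoid.closure_induction with
    | mem x hx => rw [hc a ha x hx]; split_ifs <;> norm_num
    | zero => simp
    | add x y _ _ hx hy => rw [map_add]; exact add_nonneg hx hy

theorem closure_le_span (S : Set E) {x : E} (hx : x ∈ AddSubmonoid.closure S) :
    x ∈ Submodule.span ℝ S := by
  have : AddSubmonoid.closure S ≤ (Submodule.span ℝ S).toAddSubmonoid :=
    AddSubmonoid.closure_le.2 Submodule.subset_span
  exact this hx

/-- The half-line through an element of a linearly independent set is a face of the cone spanned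
by the set. -/
theorem eq_smul_of_add_eq_smul {S : Set E} (hfin : S.Finite) (hS : LinearIndepOn ℝ id S) {x y a : E}
    (hx : x ∈ AddSubmonoid.closure S) (hy : y ∈ AddSubmonoid.closure S) (ha : a ∈ S) {r : ℝ}
    (h : x + y = r • a) : ∃ s : ℝ, 0 ≤ s ∧ x = s • a := by
  obtain ⟨c, -, h2, h3, h4⟩ := exists_coordinates hfin hS
  refine ⟨c a x, h4 x hx a ha, ?_⟩
  conv_lhs => rw [h3 x (closure_le_span S hx)]
  refine Finset.sum_eq_single a (fun b hb hba => ?_) fun hn => absurd (by simpa using ha) hn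
  have hb : b ∈ S := by simpa using hb
  -- Away from `a` the coordinates of `x` and `y` are nonnegative and add up to zero, so both
  -- vanish.
  have hsum : c b x + c b y = 0 := by
    rw [← map_add, h, map_smul, h2 b hb a ha hba.symm, smul_zero]
  have : c b x = 0 := by linarith [h4 x hx b hb, h4 y hy b hb]
  rw [this, zero_smul]

end Coordinates

/-! ### The inner product on the dual space -/

section Pairing

variable {V : Type u} [NormedAddCommGroup V] [InnerProductSpace ℝ V] [FiniteDimensional ℝ V]

variable (V) in
/-- The inner product on `V^*`. -/
def dualInner : StrongDual ℝ V →ₗ[ℝ] StrongDual ℝ V →ₗ[ℝ] ℝ :=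
  LinearMap.mk₂ ℝ (fun ξ η => inner ℝ ((InnerProductSpace.toDual ℝ V).symm ξ)
    ((InnerProductSpace.toDual ℝ V).symm η)) (by simp [inner_add_left])
    (by simp [inner_smul_left]) (by simp [inner_add_right]) (by simp [inner_smul_right])

theorem dualInner_apply (ξ η : StrongDual ℝ V) : dualInner V ξ η =
    inner ℝ ((InnerProductSpace.toDual ℝ V).symm ξ) ((InnerProductSpace.toDual ℝ V).symm η) := rfl

theorem dualInner_comm (ξ η : StrongDual ℝ V) : dualInner V ξ η = dualInner V η ξ := by
  rw [dualInner_apply, dualInner_apply, real_inner_comm]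

theorem dualInner_self (ξ : StrongDual ℝ V) : dualInner V ξ ξ = ‖ξ‖ ^ 2 := by
  rw [dualInner_apply, real_inner_self_eq_norm_sq, LinearIsometryEquiv.norm_map]

theorem dualInner_mul_self_le (ξ η : StrongDual ℝ V) :
    dualInner V ξ η * dualInner V ξ η ≤ ‖ξ‖ ^ 2 * ‖η‖ ^ 2 := by
  have := real_inner_mul_inner_self_le ((InnerProductSpace.toDual ℝ V).symm ξ)
    ((InnerProductSpace.toDual ℝ V).symm η)
  simpa [dualInner_apply, real_inner_self_eq_norm_sq] using this

theorem apply_coroot (ξ η : StrongDual ℝ V) :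
    η (coroot ξ) = 2 / ‖ξ‖ ^ 2 * dualInner V η ξ := by
  rw [coroot, map_smul, smul_eq_mul, dualInner_apply, InnerProductSpace.toDual_symm_apply]

theorem apply_coroot_eq_zero {ξ η : StrongDual ℝ V} (h : dualInner V η ξ = 0) :
    η (coroot ξ) = 0 := by
  rw [apply_coroot, h, mul_zero]

theorem apply_coroot_pos {ξ η : StrongDual ℝ V} (h : 0 < dualInner V η ξ) : 0 < η (coroot ξ) := by
  have : ξ ≠ 0 := by rintro rfl; simp at h
  have hn : 0 < ‖ξ‖ := norm_pos_iff.2 this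
  rw [apply_coroot]
  positivity

theorem apply_coroot_neg {ξ η : StrongDual ℝ V} (h : dualInner V η ξ < 0) : η (coroot ξ) < 0 := by
  have := apply_coroot_pos (ξ := ξ) (η := -η) (by simpa using h)
  simpa using this

/-- Reflexivity of a finite-dimensional space, obtained by applying the Riesz isomorphism twice. -/
theorem exists_apply_eq (L : StrongDual ℝ V →ₗ[ℝ] ℝ) : ∃ z : V, ∀ ξ : StrongDual ℝ V, ξ z = L ξ := by
  let e : V →ₗ[ℝ] StrongDual ℝ V :=
    { toFun := InnerProductSpace.toDual ℝ V
      map_add' := by simp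
      map_smul' := by simp }
  let l : StrongDual ℝ V := LinearMap.toContinuousLinearMap (L ∘ₗ e)
  refine ⟨(InnerProductSpace.toDual ℝ V).symm l, fun ξ => ?_⟩
  obtain ⟨x, rfl⟩ := (InnerProductSpace.toDual ℝ V).surjective ξ
  rw [InnerProductSpace.toDual_apply_apply, real_inner_comm, InnerProductSpace.toDual_symm_apply]
  rfl

end Pairing

/-! ### The finite root system and its highest root -/

namespace RootData

variable {V : Type u} [NormedAddCommGroup V] [InnerProductSpace ℝ V] [FiniteDimensional ℝ V]
  (Φ : RootData V)

theorem finite_F : Φ.F.Finite := Φ.finite.subset Φ.F_subset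

/-- The sum of the coordinate functionals of `F` is evaluation at some vector. Its value on a root
is the height, the quantity on which later inductions and maximality arguments run. -/
theorem exists_height : ∃ z : V, ∀ α ∈ Φ.F, α z = 1 := by
  obtain ⟨c, h1, h2, -⟩ := exists_coordinates Φ.finite_F Φ.F_linearIndep
  obtain ⟨z, hz⟩ := exists_apply_eq (∑ a ∈ Φ.finite_F.toFinset, c a)
  refine ⟨z, fun α hα => ?_⟩
  rw [hz, LinearMap.sum_apply, Finset.sum_eq_single α, h1 α hα]
  · intro b hb hb'
    exact h2 b (by simpa using hb) α hα hb'.symm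
  · intro h
    simp [hα] at h

theorem dualInner_nonneg_of_mem_closure {ξ : StrongDual ℝ V} (h : ∀ α ∈ Φ.F, 0 ≤ dualInner V ξ α)
    {x : StrongDual ℝ V} (hx : x ∈ AddSubmonoid.closure Φ.F) : 0 ≤ dualInner V ξ x := by
  induction hx using AddSubmonoid.closure_induction with
  | mem x hx => exact h x hx
  | zero => simp
  | add x y _ _ hx hy => rw [map_add]; exact add_nonneg hx hy

theorem eq_zero_of_mem_closure_of_neg_mem {x : StrongDual ℝ V} (hx : x ∈ AddSubmonoid.closure Φ.F)
    (hx' : -x ∈ AddSubmonoid.closure Φ.F) : x = 0 := by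
  obtain ⟨c, h1, h2, h3, h4⟩ := exists_coordinates Φ.finite_F Φ.F_linearIndep
  rw [h3 x (closure_le_span _ hx)]
  refine Finset.sum_eq_zero fun a ha => ?_
  have ha : a ∈ Φ.F := by simpa using ha
  have := h4 _ hx' a ha
  rw [map_neg] at this
  have h0 : c a x = 0 := le_antisymm (by linarith) (h4 x hx a ha)
  rw [h0, zero_smul]

/-- Otherwise the reflection of `α` in `β` would be a root with coefficient 1 at `α` and a negative
coefficient at `β`, against the sign dichotomy for roots. -/
theorem dualInner_simple_nonpos {α β : StrongDual ℝ V} (hα : α ∈ Φ.F) (hβ : β ∈ Φ.F)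
    (h : α ≠ β) : dualInner V α β ≤ 0 := by
  by_contra! hpos
  have hn := apply_coroot_pos hpos
  obtain ⟨c, h1, h2, -, h4⟩ := exists_coordinates Φ.finite_F Φ.F_linearIndep
  rcases Φ.F_span _ (Φ.reflection_mem β (Φ.F_subset hβ) α (Φ.F_subset hα)) with hx | hx
  · have := h4 _ hx β hβ
    rw [map_sub, map_smul, h1 β hβ, h2 β hβ α hα h, smul_eq_mul] at this
    linarith
  · have := h4 _ hx α hα
    rw [map_neg, map_sub, map_smul, h1 α hα, h2 α hα β hβ h.symm, smul_eq_mul] at this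
    linarith

/-- If the reflected root were negative, `β` plus its opposite would be a multiple of `α`. The
half-line of `α` is a face of the positive cone, so `β` would be a nonnegative multiple of `α`,
hence `α` itself as `R` is reduced. -/
theorem simple_reflection_pos {α β : StrongDual ℝ V} (hα : α ∈ Φ.F) (hβ : β ∈ Φ.R)
    (hpos : β ∈ AddSubmonoid.closure Φ.F) (h : β ≠ α) :
    β - β (coroot α) • α ∈ AddSubmonoid.closure Φ.F := by
  refine (Φ.F_span _ (Φ.reflection_mem α (Φ.F_subset hα) β hβ)).resolve_right fun hx => ?_
  obtain ⟨s, hs, rfl⟩ := eq_smul_of_add_eq_smul Φ.finite_F Φ.F_linearIndep hpos hx hα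
    (r := β (coroot α)) (by module)
  rcases Φ.reduced α (Φ.F_subset hα) s hβ with h1 | h1
  · exact h (by rw [h1, one_smul])
  · linarith

/-- If no simple root paired positively with `β`, summing over the expansion of `β` would give a
nonpositive squared norm. -/
theorem exists_simple_pairing_pos {β : StrongDual ℝ V} (hβ : β ∈ Φ.R)
    (hpos : β ∈ AddSubmonoid.closure Φ.F) : ∃ α ∈ Φ.F, 0 < dualInner V β α := by
  by_contra! h
  have := Φ.dualInner_nonneg_of_mem_closure (ξ := -β) (fun α hα => by simpa using h α hα) hpos
  rw [map_neg, LinearMap.neg_apply, dualInner_self] at this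
  have hn : 0 < ‖β‖ := norm_pos_iff.2 (Φ.ne_zero_of_mem hβ)
  nlinarith

theorem height_nat {z : V} (hz : ∀ α ∈ Φ.F, α z = 1) {x : StrongDual ℝ V}
    (hx : x ∈ AddSubmonoid.closure Φ.F) : ∃ n : ℕ, x z = n := by
  induction hx using AddSubmonoid.closure_induction with
  | mem x hx => exact ⟨1, by simp [hz x hx]⟩
  | zero => exact ⟨0, by simp⟩
  | add x y _ _ hx hy =>
    obtain ⟨m, hm⟩ := hx
    obtain ⟨n, hn⟩ := hy
    exact ⟨m + n, by simp [hm, hn]⟩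

/-- Every positive root is obtained from a simple root by simple reflections. -/
theorem positive_root_induction {P : StrongDual ℝ V → Prop} (base : ∀ α ∈ Φ.F, P α)
    (step : ∀ α ∈ Φ.F, ∀ β ∈ Φ.R, P β → P (β - β (coroot α) • α)) {β : StrongDual ℝ V}
    (hβ : β ∈ Φ.R) (hpos : β ∈ AddSubmonoid.closure Φ.F) : P β := by
  obtain ⟨z, hz⟩ := Φ.exists_height
  obtain ⟨n, hn⟩ := Φ.height_nat hz hpos
  induction n using Nat.strong_induction_on generalizing β with
  | _ n ih =>
    by_cases hF : β ∈ Φ.F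
    · exact base β hF
    obtain ⟨α, hα, hip⟩ := Φ.exists_simple_pairing_pos hβ hpos
    have h0 := Φ.ne_zero_of_mem (Φ.F_subset hα)
    have hc := apply_coroot_pos hip
    have hne : β ≠ α := by rintro rfl; exact hF hα
    have hpos' := Φ.simple_reflection_pos hα hβ hpos hne
    have hR := Φ.reflection_mem α (Φ.F_subset hα) β hβ
    obtain ⟨m, hm⟩ := Φ.height_nat hz hpos'
    have hlt : m < n := by
      have : (m : ℝ) < n := by
        rw [← hm, ← hn]
        simp [hz α hα, hc]
      exact_mod_cast this
    -- Reflecting the root of smaller height once more in `α` returns `β`.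
    have := step α hα _ hR (ih m hlt hR hpos' hm)
    convert this using 1
    simp only [sub_apply, smul_apply, coroot_pairing h0,
      smul_eq_mul]
    module

/-- The two Cartan integers are positive and, by Cauchy–Schwarz, have product at most 4. If one
equals 1, a reflection is the difference up to sign; otherwise both equal 2, which forces `α - β` to
have norm zero. -/
theorem sub_mem_R {α β : StrongDual ℝ V} (hα : α ∈ Φ.R) (hβ : β ∈ Φ.R)
    (h : 0 < dualInner V α β) : α = β ∨ α - β ∈ Φ.R := by
  have hα0 : 0 < ‖α‖ := norm_pos_iff.2 (Φ.ne_zero_of_mem hα)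
  have hβ0 : 0 < ‖β‖ := norm_pos_iff.2 (Φ.ne_zero_of_mem hβ)
  obtain ⟨m, hm⟩ := Φ.crystallographic β hβ α hα
  obtain ⟨n, hn⟩ := Φ.crystallographic α hα β hβ
  have hm0 : 0 < m := by exact_mod_cast hm ▸ apply_coroot_pos h
  have hn0 : 0 < n := by exact_mod_cast hn ▸ apply_coroot_pos (dualInner_comm α β ▸ h)
  have em : (m : ℝ) * ‖β‖ ^ 2 = 2 * dualInner V α β := by
    rw [← hm, apply_coroot]; field_simp
  have en : (n : ℝ) * ‖α‖ ^ 2 = 2 * dualInner V α β := by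
    rw [← hn, apply_coroot, dualInner_comm]; field_simp
  have hcs := dualInner_mul_self_le α β
  have hmn : m * n ≤ 4 := by
    have h1 : ((m * n : ℤ) : ℝ) * (‖α‖ ^ 2 * ‖β‖ ^ 2) ≤ 4 * (‖α‖ ^ 2 * ‖β‖ ^ 2) := by
      calc ((m * n : ℤ) : ℝ) * (‖α‖ ^ 2 * ‖β‖ ^ 2)
          = (m * ‖β‖ ^ 2) * (n * ‖α‖ ^ 2) := by push_cast; ring
        _ = 4 * (dualInner V α β * dualInner V α β) := by rw [em, en]; ring
        _ ≤ _ := by linarith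
    have h2 := le_of_mul_le_mul_right h1 (by positivity)
    exact_mod_cast h2
  by_cases h1 : m = 1
  · right
    have := Φ.reflection_mem β hβ α hα
    rwa [hm, h1, Int.cast_one, one_smul] at this
  by_cases h2 : n = 1
  · right
    have := Φ.neg_mem_R (Φ.reflection_mem α hα β hβ)
    rwa [hn, h2, Int.cast_one, one_smul, neg_sub] at this
  left
  have hm2 : m = 2 := by nlinarith [show 2 ≤ m by omega, show 2 ≤ n by omega]
  have hn2 : n = 2 := by nlinarith [show 2 ≤ m by omega, show 2 ≤ n by omega]
  rw [hm2] at em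
  rw [hn2] at en
  push_cast at em en
  have : ‖α - β‖ ^ 2 = 0 := by
    rw [← dualInner_self]
    simp only [map_sub, LinearMap.sub_apply, dualInner_self, dualInner_comm β α]
    linarith
  exact sub_eq_zero.1 (norm_eq_zero.1 (pow_eq_zero_iff two_ne_zero |>.1 this))

/-- A dominant root has full support. -/
theorem coordinate_pos_of_dominant {θ : StrongDual ℝ V} (hθ : θ ∈ Φ.R)
    (hpos : θ ∈ AddSubmonoid.closure Φ.F) (hdom : ∀ α ∈ Φ.F, 0 ≤ dualInner V θ α)
    {c : StrongDual ℝ V → StrongDual ℝ V →ₗ[ℝ] ℝ} (h1 : ∀ a ∈ Φ.F, c a a = 1)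
    (h2 : ∀ a ∈ Φ.F, ∀ b ∈ Φ.F, b ≠ a → c a b = 0)
    (h3 : ∀ x ∈ Submodule.span ℝ Φ.F, x = ∑ a ∈ Φ.finite_F.toFinset, c a x • a)
    (h4 : ∀ x ∈ AddSubmonoid.closure Φ.F, ∀ a ∈ Φ.F, 0 ≤ c a x) {α : StrongDual ℝ V}
    (hα : α ∈ Φ.F) : 0 < c α θ := by
  by_contra! hle
  have hα0 : c α θ = 0 := le_antisymm hle (h4 θ hpos α hα)
  have hmem : ∀ {a}, a ∈ Φ.finite_F.toFinset ↔ a ∈ Φ.F := by simp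
  have hθsum := h3 θ (closure_le_span _ hpos)
  -- The support of `θ` and its complement turn out to be orthogonal. If the complement contained
  -- `α`, all of `R` would split along the two spans, contradicting irreducibility.
  let S := {a ∈ Φ.F | c a θ ≠ 0}
  let S' := {a ∈ Φ.F | c a θ = 0}
  have horth : ∀ a ∈ S, ∀ b ∈ S', dualInner V a b = 0 := by
    rintro a ⟨ha, hca⟩ b ⟨hb, hcb⟩
    have hterm : ∀ x ∈ Φ.finite_F.toFinset, c x θ * dualInner V x b ≤ 0 := by
      intro x hx
      by_cases hxb : x = b
      · simp [hxb, hcb]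
      · exact mul_nonpos_of_nonneg_of_nonpos (h4 θ hpos x (hmem.1 hx))
          -- For `b` outside the support, dominance makes the pairing with `θ` nonnegative, while it
          -- is a sum of nonpositive terms; so every term is zero.
          (Φ.dualInner_simple_nonpos (hmem.1 hx) hb hxb)
    have hsum : dualInner V θ b = ∑ x ∈ Φ.finite_F.toFinset, c x θ * dualInner V x b := by
      conv_lhs => rw [hθsum]
      simp
    have hz : ∑ x ∈ Φ.finite_F.toFinset, c x θ * dualInner V x b = 0 :=
      le_antisymm (Finset.sum_nonpos hterm) (hsum ▸ hdom b hb)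
    have := (Finset.sum_eq_zero_iff_of_nonpos hterm).1 hz a (hmem.2 ha)
    exact (mul_eq_zero.1 this).resolve_left hca
  have horth1 : ∀ x ∈ Submodule.span ℝ S, ∀ b ∈ S', dualInner V x b = 0 := by
    intro x hx b hb
    induction hx using Submodule.span_induction with
    | mem x hx => exact horth x hx b hb
    | zero => simp
    | add x y _ _ hx hy => simp [hx, hy]
    | smul r x _ hx => simp [hx]
  have horth2 : ∀ x ∈ Submodule.span ℝ S, ∀ y ∈ Submodule.span ℝ S', dualInner V x y = 0 := by
    intro x hx y hy
    induction hy using Submodule.span_induction with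
    | mem y hy => exact horth1 x hx y hy
    | zero => simp
    | add y z _ _ hy hz => simp [hy, hz]
    | smul r y _ hy => simp [hy]
  have hF : ∀ a ∈ Φ.F, a ∈ S ∨ a ∈ S' := by
    intro a ha
    by_cases h : c a θ = 0
    · exact Or.inr ⟨ha, h⟩
    · exact Or.inl ⟨ha, h⟩
  -- A simple reflection either stays within a span or, by orthogonality, fixes it pointwise; so
  -- generation of the positive roots by simple reflections preserves the alternative.
  have hpure : ∀ β ∈ Φ.R, β ∈ AddSubmonoid.closure Φ.F →
      β ∈ Submodule.span ℝ S ∨ β ∈ Submodule.span ℝ S' := by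
    intro β hβ hβ'
    refine Φ.positive_root_induction
      (P := fun β => β ∈ Submodule.span ℝ S ∨ β ∈ Submodule.span ℝ S')
      (fun a ha => (hF a ha).imp (fun h => Submodule.subset_span h)
        fun h => Submodule.subset_span h) ?_ hβ hβ'
    rintro a ha β - (hβ | hβ) <;> rcases hF a ha with h | h
    · exact Or.inl (sub_mem hβ (Submodule.smul_mem _ _ (Submodule.subset_span h)))
    · rw [apply_coroot_eq_zero (horth2 β hβ a (Submodule.subset_span h))]
      exact Or.inl (by simpa using hβ)
    · rw [apply_coroot_eq_zero (by
        rw [dualInner_comm]; exact horth2 a (Submodule.subset_span h) β hβ)]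
      exact Or.inr (by simpa using hβ)
    · exact Or.inr (sub_mem hβ (Submodule.smul_mem _ _ (Submodule.subset_span h)))
  have hpure' : ∀ β ∈ Φ.R, β ∈ Submodule.span ℝ S ∨ β ∈ Submodule.span ℝ S' := by
    intro β hβ
    rcases Φ.F_span β hβ with h | h
    · exact hpure β hβ h
    · simpa using hpure (-β) (Φ.neg_mem_R hβ) h
  have hθS : θ ∈ Submodule.span ℝ S := by
    rw [hθsum]
    refine Submodule.sum_mem _ fun a ha => ?_
    by_cases h : c a θ = 0
    · rw [h, zero_smul]; exact zero_mem _
    · exact Submodule.smul_mem _ _ (Submodule.subset_span ⟨hmem.1 ha, h⟩)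
  have hαS : α ∉ Submodule.span ℝ S := by
    intro h
    have hle : Submodule.span ℝ S ≤ LinearMap.ker (c α) := by
      refine Submodule.span_le.2 fun a ha => ?_
      have : a ≠ α := by rintro rfl; exact ha.2 hα0
      exact h2 α hα a ha.1 this
    have := hle h
    rw [LinearMap.mem_ker, h1 α hα] at this
    exact one_ne_zero this
  obtain ⟨x, hx, y, hy, hxy⟩ := Φ.irreducible {β ∈ Φ.R | β ∈ Submodule.span ℝ S}
    (fun β hβ => hβ.1) ⟨θ, hθ, hθS⟩ ⟨α, Φ.F_subset hα, fun h => hαS h.2⟩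
  have hyS : y ∈ Submodule.span ℝ S' := (hpure' y hy.1).resolve_left fun h => hy.2 ⟨hy.1, h⟩
  exact hxy (apply_coroot_eq_zero (by rw [dualInner_comm]; exact horth2 x hx.2 y hyS))

theorem mem_closure_of_dominant {β : StrongDual ℝ V} (hβ : β ∈ Φ.R)
    (hdom : ∀ α ∈ Φ.F, 0 ≤ dualInner V β α) : β ∈ AddSubmonoid.closure Φ.F := by
  refine (Φ.F_span β hβ).resolve_right fun h => ?_
  have := Φ.dualInner_nonneg_of_mem_closure hdom h
  rw [map_neg, dualInner_self] at this
  have hn : 0 < ‖β‖ := norm_pos_iff.2 (Φ.ne_zero_of_mem hβ)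
  nlinarith

/-- In the expansion of `θ` all coefficients are positive by full support, and all pairings of
simple roots with `β` are nonnegative with at least one positive. -/
theorem dualInner_pos_of_dominant {θ β : StrongDual ℝ V} (hθ : θ ∈ Φ.R) (hβ : β ∈ Φ.R)
    (hdθ : ∀ α ∈ Φ.F, 0 ≤ dualInner V θ α) (hdβ : ∀ α ∈ Φ.F, 0 ≤ dualInner V β α) :
    0 < dualInner V θ β := by
  obtain ⟨c, h1, h2, h3, h4⟩ := exists_coordinates Φ.finite_F Φ.F_linearIndep
  have hθ' := Φ.mem_closure_of_dominant hθ hdθ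
  obtain ⟨α, hα, hpos⟩ := Φ.exists_simple_pairing_pos hβ (Φ.mem_closure_of_dominant hβ hdβ)
  have hmem : ∀ {a}, a ∈ Φ.finite_F.toFinset ↔ a ∈ Φ.F := by simp
  rw [h3 θ (closure_le_span _ hθ'), map_sum, LinearMap.sum_apply]
  refine Finset.sum_pos' (fun a ha => ?_) ⟨α, hmem.2 hα, ?_⟩
  · rw [map_smul, LinearMap.smul_apply, smul_eq_mul, dualInner_comm]
    exact mul_nonneg (h4 θ hθ' a (hmem.1 ha)) (hdβ a (hmem.1 ha))
  · rw [map_smul, LinearMap.smul_apply, smul_eq_mul, dualInner_comm]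
    exact mul_pos (Φ.coordinate_pos_of_dominant hθ hθ' hdθ h1 h2 h3 h4 hα) hpos

/-- Above every root there is a dominant root. -/
theorem exists_dominant_above {z : V} (hz : ∀ α ∈ Φ.F, α z = 1) {β : StrongDual ℝ V}
    (hβ : β ∈ Φ.R) : ∃ γ ∈ Φ.R, γ - β ∈ AddSubmonoid.closure Φ.F ∧
      ∀ α ∈ Φ.F, 0 ≤ dualInner V γ α := by
  obtain ⟨γ, ⟨hγ, hγβ⟩, hmax⟩ := Set.exists_max_image
    {γ | γ ∈ Φ.R ∧ γ - β ∈ AddSubmonoid.closure Φ.F} (fun γ => γ z)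
    (Φ.finite.subset fun γ h => h.1) ⟨β, hβ, by simp⟩
  refine ⟨γ, hγ, hγβ, fun α hα => ?_⟩
  by_contra! hneg
  have hc := apply_coroot_neg hneg
  obtain ⟨n, hn⟩ := Φ.crystallographic α (Φ.F_subset hα) γ hγ
  have hn0 : n < 0 := by exact_mod_cast hn ▸ hc
  obtain ⟨m, rfl⟩ := Int.exists_eq_neg_ofNat hn0.le
  -- A negative pairing with `α` would make the reflected root `γ + m α` with `m > 0`, still above
  -- `β` but of larger height.
  have := hmax (γ - γ (coroot α) • α) ⟨Φ.reflection_mem α (Φ.F_subset hα) γ hγ, by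
    have : γ - γ (coroot α) • α - β = (γ - β) + m • α := by
      rw [hn]; push_cast; rw [← Nat.cast_smul_eq_nsmul ℝ]; module
    rw [this]
    exact add_mem hγβ (nsmul_mem (AddSubmonoid.subset_closure hα) m)⟩
  simp only [sub_apply, smul_apply, hz α hα,
    smul_eq_mul] at this
  linarith

/-- A dominant root `θ` of maximal height works. Every root lies below a dominant root `γ`; since
`θ` and `γ` pair positively, `θ - γ` is zero or a root, and maximality of the height excludes a
negative root. -/
theorem exists_highestRoot : ∃ θ, Φ.IsHighestRoot θ := by
  obtain ⟨z, hz⟩ := Φ.exists_height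
  obtain ⟨δ, hδ, hmax⟩ := Set.exists_max_image Φ.R (fun γ => γ z) Φ.finite Φ.nonempty
  obtain ⟨θ, hθ, hθδ, hdθ⟩ := Φ.exists_dominant_above hz hδ
  have hθmax : ∀ γ ∈ Φ.R, γ z ≤ θ z := by
    intro γ hγ
    obtain ⟨n, hn⟩ := Φ.height_nat hz hθδ
    have := hmax γ hγ
    have h0 : (0 : ℝ) ≤ n := n.cast_nonneg
    rw [← hn, sub_apply] at h0
    linarith
  refine ⟨θ, hθ, fun β hβ => ?_⟩
  obtain ⟨γ, hγ, hγβ, hdγ⟩ := Φ.exists_dominant_above hz hβ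
  have hθγ : θ - γ ∈ AddSubmonoid.closure Φ.F := by
    rcases Φ.sub_mem_R hθ hγ (Φ.dualInner_pos_of_dominant hθ hγ hdθ hdγ) with h | h
    · simp [h]
    · refine (Φ.F_span _ h).resolve_right fun hneg => Φ.ne_zero_of_mem h ?_
      refine Φ.eq_zero_of_mem_closure_of_neg_mem ?_ hneg
      obtain ⟨c, h1, h2, h3, h4⟩ := exists_coordinates Φ.finite_F Φ.F_linearIndep
      have hle := hθmax γ hγ
      have hsum := h3 _ (closure_le_span _ hneg)
      have hnn : ∀ a ∈ Φ.finite_F.toFinset, 0 ≤ c a (-(θ - γ)) :=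
        fun a ha => h4 _ hneg a (by simpa using ha)
      have hval : (-(θ - γ)) z = ∑ a ∈ Φ.finite_F.toFinset, c a (-(θ - γ)) := by
        conv_lhs => rw [hsum]
        rw [sum_apply]
        refine Finset.sum_congr rfl fun a ha => ?_
        rw [smul_apply, hz a (by simpa using ha), smul_eq_mul, mul_one]
      -- The height of `γ - θ` is at most zero but is also the sum of its nonnegative coordinates,
      -- so all of them vanish.
      have hz0 : ∑ a ∈ Φ.finite_F.toFinset, c a (-(θ - γ)) = 0 := by
        refine le_antisymm (hval ▸ ?_) (Finset.sum_nonneg hnn)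
        simp only [neg_apply, sub_apply]
        linarith
      have h0 := (Finset.sum_eq_zero_iff_of_nonneg hnn).1 hz0
      have : -(θ - γ) = 0 := by
        rw [hsum]
        exact Finset.sum_eq_zero fun a ha => by rw [h0 a ha, zero_smul]
      rw [neg_eq_zero.1 this]
      exact zero_mem _
  have := add_mem hθγ hγβ
  rwa [sub_add_sub_cancel] at this

/-! ### The fundamental chamber, simple affine roots and generators of `W^a` -/

/-- All positive affine roots are positive at `x`, that is, `x` lies in the fundamental chamber. -/
def Dominant (x : V) : Prop := ∀ a ∈ Φ.RaPos, 0 < a.1.eval x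

theorem mem_RaPos_or_neg (a : Φ.Ra) : a ∈ Φ.RaPos ∨ Φ.negRoot a ∈ Φ.RaPos := by
  obtain ⟨m, hm⟩ := a.2.2
  rcases lt_trichotomy 0 a.1.2 with h | h | h
  · exact Or.inl (Or.inl h)
  · rcases Φ.F_span a.1.1 a.2.1 with hF | hF
    · exact Or.inl (Or.inr ⟨h.symm, a.2.1, hF⟩)
    · exact Or.inr (Or.inr ⟨by change -a.1.2 = 0; rw [← h, neg_zero],
        Φ.neg_mem_R a.2.1, hF⟩)
  · exact Or.inr (Or.inl (neg_pos.2 h))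

/-- The height vector is positive on positive roots; scaling it down makes the value of every root
exceed -1, so adding a positive integer constant keeps the affine root positive. -/
theorem exists_dominant : ∃ z, Φ.Dominant z := by
  obtain ⟨z, hz⟩ := Φ.exists_height
  obtain ⟨B, hB⟩ := (Φ.finite.image fun β => |β z|).bddAbove
  have hC : 0 < |B| + 1 := by positivity
  refine ⟨(|B| + 1)⁻¹ • z, ?_⟩
  have hpos : ∀ x ∈ AddSubmonoid.closure Φ.F, x = 0 ∨ 0 < x z := by
    intro x hx
    induction hx using AddSubmonoid.closure_induction with
    | mem x hx => right; rw [hz x hx]; exact one_pos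
    | zero => exact Or.inl rfl
    | add x y _ _ hx hy =>
      rcases hx with rfl | hx
      · simpa using hy
      · rcases hy with rfl | hy
        · right; simpa using hx
        · right; simpa using add_pos hx hy
  rintro a (h | ⟨h0, h1, h2⟩)
  · obtain ⟨m, hm⟩ := a.2.2
    have hm1 : (1 : ℝ) ≤ a.1.2 := by
      rw [hm] at h ⊢
      have : 0 < m := by exact_mod_cast h
      exact_mod_cast this
    have hle : |a.1.1 z| ≤ |B| := (hB ⟨a.1.1, a.2.1, rfl⟩).trans (le_abs_self B)
    have h3 : -(|B| + 1) < a.1.1 z := by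
      have := neg_abs_le (a.1.1 z)
      linarith
    have : -1 < (|B| + 1)⁻¹ * a.1.1 z := by
      rw [inv_mul_eq_div, lt_div_iff₀ hC]
      linarith
    rw [Aff.eval, map_smul, smul_eq_mul]
    linarith
  · have := (hpos _ h2).resolve_left (Φ.ne_zero_of_mem h1)
    rw [Aff.eval, map_smul, h0, add_zero, smul_eq_mul]
    positivity

theorem not_mem_RaPos_and_neg (a : Φ.Ra) (h : a ∈ Φ.RaPos) : Φ.negRoot a ∉ Φ.RaPos := by
  obtain ⟨z, hz⟩ := Φ.exists_dominant
  intro hn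
  have h1 := hz _ h
  have h2 := hz _ hn
  rw [negRoot_eval] at h2
  linarith

variable {Φ} in
theorem Dominant.mem_Vreg {z : V} (hz : Φ.Dominant z) : z ∈ Φ.Vreg := by
  intro a ha h0
  rcases Φ.mem_RaPos_or_neg ⟨a, ha⟩ with h | h
  · exact (hz _ h).ne' h0
  · have := hz _ h
    rw [negRoot_eval] at this
    change 0 < -a.eval z at this
    rw [h0] at this
    linarith

theorem IsHighestRoot.mem_closure {θ : StrongDual ℝ V} (h : Φ.IsHighestRoot θ) :
    θ ∈ AddSubmonoid.closure Φ.F := by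
  refine (Φ.F_span θ h.1).elim id fun hn => ?_
  have := add_mem hn (h.2 _ (Φ.neg_mem_R h.1))
  convert this using 1
  module

theorem IsHighestRoot.unique {θ θ' : StrongDual ℝ V} (h : Φ.IsHighestRoot θ)
    (h' : Φ.IsHighestRoot θ') : θ = θ' := by
  have := Φ.eq_zero_of_mem_closure_of_neg_mem (h.2 _ h'.1) (by rw [neg_sub]; exact h'.2 _ h.1)
  exact sub_eq_zero.1 this

/-- The affine linear functions underlying the simple affine roots. -/
def simpleAff : Set (Aff V) := Subtype.val '' Φ.Fa

/-- Uniqueness of the highest root leaves a single affine element, so finiteness and independence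
reduce to those of `F`. -/
theorem simpleAff_eq {θ : StrongDual ℝ V} (h : Φ.IsHighestRoot θ) :
    Φ.simpleAff = insert (-θ, 1) (LinearMap.inl ℝ (StrongDual ℝ V) ℝ '' Φ.F) := by
  ext φ
  constructor
  · rintro ⟨a, ⟨h1, h2⟩ | ⟨θ', h1, h2⟩, rfl⟩
    · exact Or.inr ⟨a.1.1, h1, Prod.ext rfl h2.symm⟩
    · left
      rw [h2, IsHighestRoot.unique Φ h1 h]
  · rintro (rfl | ⟨α, hα, rfl⟩)
    · exact ⟨⟨(-θ, 1), Φ.neg_mem_R h.1, 1, by simp⟩, Or.inr ⟨θ, h, rfl⟩, rfl⟩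
    · exact ⟨⟨(α, 0), Φ.F_subset hα, 0, by simp⟩, Or.inl ⟨hα, rfl⟩, rfl⟩

theorem finite_simpleAff : Φ.simpleAff.Finite := by
  obtain ⟨θ, h⟩ := Φ.exists_highestRoot
  rw [Φ.simpleAff_eq h]
  exact (Φ.finite_F.image _).insert _

/-- The constant term vanishes on the span of `F` but not on `-θ + 1`. -/
theorem linearIndepOn_simpleAff : LinearIndepOn ℝ id Φ.simpleAff := by
  obtain ⟨θ, h⟩ := Φ.exists_highestRoot
  rw [Φ.simpleAff_eq h]
  refine LinearIndepOn.id_insert ?_ ?_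
  · refine LinearIndepOn.id_image (v := LinearMap.inl ℝ (StrongDual ℝ V) ℝ) ?_
    exact Φ.F_linearIndep.map_injOn (LinearMap.inl ℝ (StrongDual ℝ V) ℝ)
      (LinearMap.inl_injective.injOn)
  · intro hmem
    have hle : Submodule.span ℝ (LinearMap.inl ℝ (StrongDual ℝ V) ℝ '' Φ.F) ≤
        LinearMap.ker (LinearMap.snd ℝ (StrongDual ℝ V) ℝ) := by
      refine Submodule.span_le.2 ?_
      rintro _ ⟨α, -, rfl⟩
      simp
    have := hle hmem
    simp at this

theorem mem_closure_simpleAff {a : Φ.Ra} (ha : a ∈ Φ.RaPos) :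
    a.1 ∈ AddSubmonoid.closure Φ.simpleAff := by
  obtain ⟨θ, h⟩ := Φ.exists_highestRoot
  have hT := Φ.simpleAff_eq h
  have hF : ∀ x ∈ AddSubmonoid.closure Φ.F, ((x, 0) : Aff V) ∈ AddSubmonoid.closure Φ.simpleAff := by
    intro x hx
    induction hx using AddSubmonoid.closure_induction with
    | mem x hx =>
      refine AddSubmonoid.subset_closure ?_
      rw [hT]
      exact Or.inr ⟨x, hx, rfl⟩
    | zero => exact zero_mem _
    | add x y _ _ hx hy => simpa using add_mem hx hy
  rcases ha with hp | ⟨h0, h1, h2⟩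
  · obtain ⟨m, hm⟩ := a.2.2
    rw [hm] at hp
    have hp' : 0 < m := by exact_mod_cast hp
    obtain ⟨n, rfl⟩ : ∃ n : ℕ, m = n + 1 := ⟨(m - 1).toNat, by omega⟩
    -- With constant term `m = n + 1`, this writes `α + m` as `m(-θ + 1) + (θ + α) + nθ`; the middle
    -- term is a nonnegative combination because `θ` lies above the root `-α`.
    have e : a.1 = (n + 1) • ((-θ, 1) : Aff V) + (((θ - -a.1.1) + n • θ, 0) : Aff V) := by
      refine Prod.ext ?_ ?_
      · simp only [Prod.fst_add, Prod.smul_fst]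
        module
      · simp [hm]
    rw [e]
    refine add_mem (nsmul_mem (AddSubmonoid.subset_closure ?_) _) (hF _ (add_mem
      (h.2 _ (Φ.neg_mem_R a.2.1)) (nsmul_mem (IsHighestRoot.mem_closure Φ h) n)))
    rw [hT]
    exact Or.inl rfl
  · have e : a.1 = (a.1.1, 0) := Prod.ext rfl h0
    rw [e]
    exact hF _ h2

theorem Fa_subset_RaPos : Φ.Fa ⊆ Φ.RaPos := by
  rintro a (⟨h1, h2⟩ | ⟨θ, -, h⟩)
  · exact Or.inr ⟨h2, Φ.F_subset h1, AddSubmonoid.subset_closure h1⟩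
  · left
    rw [h]
    exact one_pos

/-- A simple affine reflection permutes the positive affine roots other than its own. -/
theorem perm_simple_mem_RaPos {a b : Φ.Ra} (ha : a ∈ Φ.Fa) (hb : b ∈ Φ.RaPos) (hne : b ≠ a) :
    Φ.perm (Φ.refl a) b ∈ Φ.RaPos := by
  refine (Φ.mem_RaPos_or_neg _).resolve_right fun hn => ?_
  obtain ⟨s, hs, hsa⟩ := eq_smul_of_add_eq_smul Φ.finite_simpleAff Φ.linearIndepOn_simpleAff
    (Φ.mem_closure_simpleAff hb) (Φ.mem_closure_simpleAff hn) ⟨a, ha, rfl⟩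
    (r := b.1.1 (coroot a.1.1)) (by
      change b.1 + -(Φ.perm (Φ.refl a) b).1 = _
      rw [perm_refl_val]
      module)
  have hR : s • a.1.1 ∈ Φ.R := by
    have := b.2.1
    rwa [hsa] at this
  rcases Φ.reduced _ a.2.1 s hR with h1 | h1
  · exact hne (Subtype.ext (by rw [hsa, h1, one_smul]))
  · linarith

theorem exists_simple_neg {x : V} {b : Φ.Ra} (hb : b ∈ Φ.RaPos) (h : b.1.eval x < 0) :
    ∃ a ∈ Φ.Fa, a.1.eval x < 0 := by
  by_contra! hc
  have : ∀ φ ∈ AddSubmonoid.closure Φ.simpleAff, 0 ≤ φ.eval x := by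
    intro φ hφ
    induction hφ using AddSubmonoid.closure_induction with
    | mem φ hφ =>
      obtain ⟨a, ha, rfl⟩ := hφ
      exact hc a ha
    | zero => simp [Aff.eval]
    | add φ ψ _ _ h1 h2 => rw [Aff.eval_add]; exact add_nonneg h1 h2
  exact h.not_ge (this _ (Φ.mem_closure_simpleAff hb))

/-- The positive affine roots that are negative at `x`. -/
def negSet (x : V) : Set Φ.Ra := {a | a ∈ Φ.RaPos ∧ a.1.eval x < 0}

theorem refl_eval (a b : Φ.Ra) (x : V) :
    (Φ.perm (Φ.refl a) b).1.eval x = b.1.eval ((Φ.refl a).1 x) := by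
  rw [perm_eval, refl_inv]

/-- The reflection in `a` sends the roots counted at the reflected point injectively into those
counted at `x`. It misses `a`, whose preimage `-a` is not a positive root. -/
theorem ncard_negSet_lt {a : Φ.Ra} (ha : a ∈ Φ.Fa) {x : V} (h : a.1.eval x < 0) :
    (Φ.negSet ((Φ.refl a).1 x)).ncard < (Φ.negSet x).ncard := by
  have haself : a.1.eval ((Φ.refl a).1 x) = -a.1.eval x := by
    rw [← refl_eval, perm_refl_self, negRoot_eval]
  have haP := Φ.Fa_subset_RaPos ha
  rw [← Set.ncard_image_of_injective _ (Φ.perm (Φ.refl a)).injective]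
  refine Set.ncard_lt_ncard ⟨?_, fun hsub => ?_⟩ (Φ.finite_neg x)
  · rintro _ ⟨b, ⟨hb, hbx⟩, rfl⟩
    refine ⟨Φ.perm_simple_mem_RaPos ha hb ?_, by rwa [refl_eval]⟩
    rintro rfl
    rw [haself] at hbx
    linarith
  · obtain ⟨b, ⟨hb, -⟩, hba⟩ := hsub ⟨haP, h⟩
    have : b = Φ.negRoot a := by
      rw [← Φ.perm_refl_self, ← Φ.perm_refl_refl a b, hba]
    rw [this] at hb
    exact Φ.not_mem_RaPos_and_neg a haP hb

/-- The group generated by the affine simple reflections acts transitively on the chambers. -/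
theorem exists_dominant_translate {x : V} (hx : x ∈ Φ.Vreg) :
    ∃ g ∈ Subgroup.closure (Φ.refl '' Φ.Fa), Φ.Dominant (g.1 x) := by
  induction hn : (Φ.negSet x).ncard using Nat.strong_induction_on generalizing x with
  | _ n ih =>
    by_cases hd : Φ.Dominant x
    · exact ⟨1, one_mem _, hd⟩
    simp only [Dominant, not_forall, not_lt] at hd
    obtain ⟨b, hb, hbx⟩ := hd
    obtain ⟨a, ha, hax⟩ := Φ.exists_simple_neg hb (lt_of_le_of_ne hbx (hx _ b.2))
    obtain ⟨g, hg, hgx⟩ := ih _ (hn ▸ Φ.ncard_negSet_lt ha hax)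
      (Φ.smul_mem_Vreg (Φ.refl a) hx) rfl
    exact ⟨g * Φ.refl a, mul_mem hg (Subgroup.subset_closure ⟨a, ha, rfl⟩), hgx⟩

theorem perm_mem_RaPos_of_length_eq_zero {g : Φ.Wa} (hg : Φ.length g = 0) (a : Φ.Ra) :
    Φ.perm g a ∈ Φ.RaPos ↔ a ∈ Φ.RaPos := by
  have key : ∀ a ∈ Φ.RaPos, Φ.perm g a ∈ Φ.RaPos := by
    intro a ha
    refine (Φ.mem_RaPos_or_neg _).resolve_right fun hn => ?_
    rw [length, Set.encard_eq_zero] at hg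
    have : a ∈ (∅ : Set Φ.Ra) := by
      rw [← hg]
      refine ⟨ha, _, hn, ?_⟩
      exact (neg_neg _).symm
    exact this
  refine ⟨fun h => (Φ.mem_RaPos_or_neg a).resolve_right fun hn => ?_, key a⟩
  have := key _ hn
  rw [perm_neg] at this
  exact Φ.not_mem_RaPos_and_neg _ h this

/-- A positive root made negative by `g` would have to be both positive and negative at `g⁻¹ z`. -/
theorem length_eq_zero_of_dominant {g : Φ.Wa} {z : V} (hz : Φ.Dominant z)
    (h : Φ.Dominant ((g⁻¹ : Φ.Wa).1 z)) : Φ.length g = 0 := by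
  rw [length, Set.encard_eq_zero, Set.eq_empty_iff_forall_notMem]
  rintro a ⟨ha, b, hb, hab⟩
  have h1 := h a ha
  have h2 := hz b hb
  rw [← perm_eval, perm_val, hab, Aff.eval_neg] at h1
  linarith

/-- `W^a` is generated by the simple affine reflections and the elements of length zero. -/
theorem closure_generators :
    Subgroup.closure (Φ.refl '' Φ.Fa ∪ {g | Φ.length g = 0}) = ⊤ := by
  rw [Subgroup.eq_top_iff']
  intro g
  obtain ⟨z, hz⟩ := Φ.exists_dominant
  obtain ⟨h, hh, hd⟩ := Φ.exists_dominant_translate (Φ.smul_mem_Vreg g⁻¹ hz.mem_Vreg)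
  -- The inverse of `g h⁻¹` sends `z` to `h (g⁻¹ z)`, which is dominant by the choice of `h`.
  have h0 : Φ.length (g * h⁻¹) = 0 := by
    refine Φ.length_eq_zero_of_dominant hz ?_
    rw [mul_inv_rev, inv_inv]
    exact hd
  have hg : g = g * h⁻¹ * h := by simp
  rw [hg]
  exact mul_mem (Subgroup.subset_closure (Or.inr h0))
    (Subgroup.closure_mono Set.subset_union_left hh)

theorem length_inv_eq_zero {g : Φ.Wa} (hg : Φ.length g = 0) : Φ.length g⁻¹ = 0 := by
  obtain ⟨z, hz⟩ := Φ.exists_dominant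
  refine Φ.length_eq_zero_of_dominant hz fun a ha => ?_
  have h := Φ.perm_mem_RaPos_of_length_eq_zero hg ((Φ.perm g).symm a)
  rw [Equiv.apply_symm_apply] at h
  have := hz _ (h.1 ha)
  rw [perm_symm_val] at this
  rw [inv_inv]
  rw [act_eval, inv_inv] at this
  exact this

/-- A property that holds for the simple affine reflections and the elements of length zero, and
is preserved by products, holds on `W^a`. -/
theorem Wa_induction {P : Φ.Wa → Prop} (simple : ∀ a ∈ Φ.Fa, P (Φ.refl a))
    (omega : ∀ g, Φ.length g = 0 → P g) (mul : ∀ g h, P g → P h → P (g * h)) (g : Φ.Wa) : P g := by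
  have hg : g ∈ Subgroup.closure (Φ.refl '' Φ.Fa ∪ {g | Φ.length g = 0}) := by
    rw [closure_generators]; trivial
  have hone : P 1 := by
    obtain ⟨z, hz⟩ := Φ.exists_dominant
    exact omega 1 (Φ.length_eq_zero_of_dominant hz (by simpa using hz))
  -- `P` need not be stable under inversion, because the generating set is.
  refine Subgroup.closure_induction'' (p := fun g _ => P g) ?_ ?_ hone
    (fun g h _ _ => mul g h) hg
  · rintro _ (⟨a, ha, rfl⟩ | h)
    · exact simple a ha
    · exact omega _ h
  · rintro _ (⟨a, ha, rfl⟩ | h)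
    · rw [refl_inv]; exact simple a ha
    · exact omega _ (Φ.length_inv_eq_zero h)

/-! ### Straightening in the algebra `A(k)` -/

theorem linC_tmul (g : V ≃ₗᵢ[ℝ] V) (c : ℂ) (v : V) : linC g (c ⊗ₜ v) = c ⊗ₜ g v := by
  simp [linC]

theorem dualC_tmul (ξ : StrongDual ℝ V) (c : ℂ) (v : V) : dualC ξ (c ⊗ₜ v) = c * (ξ v : ℂ) := by
  simp [dualC]

theorem linC_linRefl (ξ : StrongDual ℝ V) (x : VC V) :
    linC (linRefl ξ) x = x - dualC ξ x • ((1 : ℂ) ⊗ₜ[ℝ] coroot ξ) := by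
  induction x using TensorProduct.induction_on with
  | zero => simp
  | add x y hx hy => rw [map_add, map_add, hx, hy, add_smul]; abel
  | tmul c v =>
    rw [linC_tmul, dualC_tmul, linRefl_apply, TensorProduct.tmul_sub, TensorProduct.tmul_smul,
      TensorProduct.smul_tmul', TensorProduct.smul_tmul', smul_eq_mul, mul_one, mul_comm c,
      Complex.real_smul]

theorem symAct_ι (g : V ≃ₗᵢ[ℝ] V) (x : VC V) :
    symAct g (SymmetricAlgebra.ι ℂ (VC V) x) = SymmetricAlgebra.ι ℂ (VC V) (linC g x) := by
  simp [symAct]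

theorem grpA_mul (k : Φ.Multiplicity) (g h : Φ.Wa) :
    Φ.grpA k (g * h) = Φ.grpA k g * Φ.grpA k h := by
  rw [grpA, map_mul, map_mul]; rfl

theorem grpA_cross (k : Φ.Multiplicity) {a : Φ.Ra} (ha : a ∈ Φ.Fa) (x : VC V) :
    Φ.grpA k (Φ.refl a) * Φ.inclS k (SymmetricAlgebra.ι ℂ (VC V) x) =
      Φ.inclS k (SymmetricAlgebra.ι ℂ (VC V) (linC (linRefl a.1.1) x)) * Φ.grpA k (Φ.refl a) +
        Φ.inclS k (algebraMap ℂ _ (-(k.toFun a * dualC a.1.1 x))) := by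
  have := Φ.toA_rel k (.cross a ha x)
  rw [map_sub, map_mul, map_mul, AlgHom.commutes, sub_eq_iff_eq_add'] at this
  rw [AlgHom.commutes]
  exact this

theorem grpA_omega (k : Φ.Multiplicity) {g : Φ.Wa} (hg : Φ.length g = 0) (x : VC V) :
    Φ.grpA k g * Φ.inclS k (SymmetricAlgebra.ι ℂ (VC V) x) =
      Φ.inclS k (SymmetricAlgebra.ι ℂ (VC V) (linC g.1.linearIsometryEquiv x)) * Φ.grpA k g := by
  have := Φ.toA_rel k (.omega g hg x)
  rw [map_mul, map_mul] at this
  exact this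

/-- Reduces any property of `S(V_ℂ)` that cuts out a subalgebra to real vectors, where the Dunkl
operators and derivatives are defined. -/
theorem ι_mem_of_tmul_mem {E : Type*} [Ring E] [Algebra ℂ E] (S : Subalgebra ℂ E)
    (f : SV V →ₐ[ℂ] E) (h : ∀ v : V, f (SymmetricAlgebra.ι ℂ (VC V) (1 ⊗ₜ v)) ∈ S) (p : SV V) :
    f p ∈ S := by
  induction p using SymmetricAlgebra.induction with
  | algebraMap r => rw [AlgHom.commutes]; exact S.algebraMap_mem r
  | ι x =>
    induction x using TensorProduct.induction_on with
    | zero => simp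
    | add x y hx hy => rw [map_add, map_add]; exact add_mem hx hy
    | tmul c v =>
      have : c ⊗ₜ[ℝ] v = c • ((1 : ℂ) ⊗ₜ[ℝ] v) := by simp [TensorProduct.smul_tmul']
      rw [this, map_smul, map_smul]
      exact S.smul_mem (h v) c
  | mul p q hp hq => rw [map_mul]; exact mul_mem hp hq
  | add p q hp hq => rw [map_add]; exact add_mem hp hq

/-- `A(k)` is generated by `V` and `W^a`. -/
theorem A_generated (k : Φ.Multiplicity) (S : Subalgebra ℂ (Φ.A k)) (hv : ∀ v, Φ.vecA k v ∈ S)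
    (hg : ∀ g, Φ.grpA k g ∈ S) (a : Φ.A k) : a ∈ S := by
  obtain ⟨x, rfl⟩ : ∃ x, Φ.toA k x = a := RingQuot.mkAlgHom_surjective ℂ _ a
  induction x using FreeAlgebra.induction with
  | grade0 r => rw [AlgHom.commutes]; exact S.algebraMap_mem r
  | grade1 y =>
    rcases y with p | y
    · exact ι_mem_of_tmul_mem S (Φ.inclS k) hv p
    · change Φ.inclW k y ∈ S
      induction y using MonoidAlgebra.induction_on with
      | of g => exact hg g
      | add x y hx hy => rw [map_add]; exact add_mem hx hy
      | smul c x hx => rw [map_smul]; exact S.smul_mem hx c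
  | mul x y hx hy => rw [map_mul]; exact mul_mem hx hy
  | add x y hx hy => rw [map_add]; exact add_mem hx hy

/-- The correction `q` is `-k_a` times the divided difference of `p`. It is recorded through its
product with the coroot so that no division is needed, and it is built by the twisted Leibniz rule.
-/
theorem grpA_refl_mul_inclS (k : Φ.Multiplicity) {a : Φ.Ra} (ha : a ∈ Φ.Fa) (p : SV V) :
    ∃ q : SV V, Φ.grpA k (Φ.refl a) * Φ.inclS k p =
        Φ.inclS k (symAct (linRefl a.1.1) p) * Φ.grpA k (Φ.refl a) + Φ.inclS k q ∧
      q * SymmetricAlgebra.ι ℂ (VC V) (1 ⊗ₜ coroot a.1.1) =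
        -k.toFun a • (p - symAct (linRefl a.1.1) p) := by
  induction p using SymmetricAlgebra.induction with
  | algebraMap r =>
    refine ⟨0, ?_, by simp⟩
    simp only [AlgHom.commutes, map_zero, add_zero]
    exact (Algebra.commutes r _).symm
  | ι x =>
    refine ⟨algebraMap ℂ _ (-(k.toFun a * dualC a.1.1 x)), ?_, ?_⟩
    · rw [symAct_ι]
      exact Φ.grpA_cross k ha x
    · rw [symAct_ι, linC_linRefl, map_sub, map_smul, sub_sub_cancel, ← Algebra.smul_def, smul_smul,
        neg_mul]
  | mul p p' hp hp' =>
    obtain ⟨q, h1, h2⟩ := hp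
    obtain ⟨q', h1', h2'⟩ := hp'
    refine ⟨symAct (linRefl a.1.1) p * q' + q * p', ?_, ?_⟩
    · rw [map_mul, ← mul_assoc, h1, add_mul, mul_assoc, h1']
      simp only [map_mul, map_add, mul_add, mul_assoc, add_assoc]
    · rw [add_mul, mul_assoc, h2', mul_right_comm, h2, map_mul]
      simp only [Algebra.smul_def]
      ring
  | add p p' hp hp' =>
    obtain ⟨q, h1, h2⟩ := hp
    obtain ⟨q', h1', h2'⟩ := hp'
    refine ⟨q + q', ?_, ?_⟩
    · simp only [map_add, mul_add, add_mul, h1, h1']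
      abel
    · rw [add_mul, h2, h2', map_add, ← smul_add]
      congr 1
      abel

theorem grpA_omega_mul_inclS (k : Φ.Multiplicity) {g : Φ.Wa} (hg : Φ.length g = 0) (p : SV V) :
    Φ.grpA k g * Φ.inclS k p = Φ.inclS k (symAct g.1.linearIsometryEquiv p) * Φ.grpA k g := by
  induction p using SymmetricAlgebra.induction with
  | algebraMap r =>
    simp only [AlgHom.commutes]
    exact (Algebra.commutes r _).symm
  | ι x => rw [symAct_ι]; exact Φ.grpA_omega k hg x
  | mul p q hp hq => rw [map_mul, ← mul_assoc, hp, mul_assoc, hq, map_mul, map_mul, mul_assoc]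
  | add p q hp hq => rw [map_add, mul_add, hp, hq, map_add, map_add, add_mul]

theorem mulMap_tmul (k : Φ.Multiplicity) (p : SV V) (y : MonoidAlgebra ℂ Φ.Wa) :
    Φ.mulMap k (p ⊗ₜ y) = Φ.inclS k p * Φ.inclW k y := rfl

/-- For simple reflections and length-zero elements the straightening formula moves the group
element past `S(V_ℂ)`; the general case follows since stability of the range passes to products. -/
theorem grpA_mul_mem_range (k : Φ.Multiplicity) (g : Φ.Wa) :
    ∀ x ∈ LinearMap.range (Φ.mulMap k), Φ.grpA k g * x ∈ LinearMap.range (Φ.mulMap k) := by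
  have key : ∀ g : Φ.Wa, (∀ p, ∃ p' q, Φ.grpA k g * Φ.inclS k p =
      Φ.inclS k p' * Φ.grpA k g + Φ.inclS k q) →
      ∀ x ∈ LinearMap.range (Φ.mulMap k), Φ.grpA k g * x ∈ LinearMap.range (Φ.mulMap k) := by
    rintro g h _ ⟨t, rfl⟩
    induction t using TensorProduct.induction_on with
    | zero => simp
    | add s t hs ht => rw [map_add, mul_add]; exact add_mem hs ht
    | tmul p y =>
      obtain ⟨p', q, hpq⟩ := h p
      refine ⟨p' ⊗ₜ (MonoidAlgebra.of ℂ Φ.Wa g * y) + q ⊗ₜ y, ?_⟩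
      rw [map_add, mulMap_tmul, mulMap_tmul, mulMap_tmul, ← mul_assoc, hpq, add_mul, map_mul,
        mul_assoc]
      rfl
  induction g using Φ.Wa_induction with
  | simple a ha =>
    refine key _ fun p => ?_
    obtain ⟨q, h, -⟩ := Φ.grpA_refl_mul_inclS k ha p
    exact ⟨_, q, h⟩
  | omega g hg => exact key _ fun p => ⟨_, 0, by simpa using Φ.grpA_omega_mul_inclS k hg p⟩
  | mul g h hg hh =>
    intro x hx
    rw [grpA_mul, mul_assoc]
    exact hg _ (hh x hx)

/-- The range is stable under left multiplication by the generators, hence a left ideal, and it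
contains 1. -/
theorem mulMap_surjective (k : Φ.Multiplicity) : Function.Surjective (Φ.mulMap k) := by
  intro a
  let S : Subalgebra ℂ (Φ.A k) :=
    { carrier := {a | ∀ x ∈ LinearMap.range (Φ.mulMap k), a * x ∈ LinearMap.range (Φ.mulMap k)}
      mul_mem' := fun {a b} ha hb x hx => by rw [mul_assoc]; exact ha _ (hb x hx)
      add_mem' := fun {a b} ha hb x hx => by rw [add_mul]; exact add_mem (ha x hx) (hb x hx)
      algebraMap_mem' := fun r x hx => by
        rw [← Algebra.smul_def]
        exact Submodule.smul_mem _ r hx }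
  have ha : a ∈ S := by
    refine Φ.A_generated k S (fun v => ?_) (fun g => Φ.grpA_mul_mem_range k g) a
    rintro _ ⟨t, rfl⟩
    induction t using TensorProduct.induction_on with
    | zero => simp
    | add s t hs ht => rw [map_add, mul_add]; exact add_mem hs ht
    | tmul p y =>
      refine ⟨(SymmetricAlgebra.ι ℂ (VC V) (1 ⊗ₜ v) * p) ⊗ₜ y, ?_⟩
      rw [mulMap_tmul, mulMap_tmul, map_mul, mul_assoc]
      rfl
  have := ha 1 ⟨1 ⊗ₜ 1, by rw [mulMap_tmul, map_one, map_one, mul_one]⟩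
  rwa [mul_one] at this

instance : IsDomain (SV V) :=
  (SymmetricAlgebra.equivMvPolynomial
    (Module.Basis.ofVectorSpace ℂ (VC V))).toMulEquiv.isDomain _

/-- Evaluation at `ξ` takes the value 2 on it. In the domain `S(V_ℂ)` this factor can therefore be
cancelled from divided differences. -/
theorem ι_coroot_ne_zero {ξ : StrongDual ℝ V} (h : ξ ≠ 0) :
    SymmetricAlgebra.ι ℂ (VC V) (1 ⊗ₜ coroot ξ) ≠ 0 := by
  intro h0
  have := congrArg (SymmetricAlgebra.lift (dualC ξ)) h0
  rw [SymmetricAlgebra.lift_ι_apply, dualC_tmul, coroot_pairing h, map_zero] at this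
  norm_num at this

/-- Invariant elements of `S(V_ℂ)` commute with `W^a` in `A(k)`. -/
theorem grpA_mul_inclS_of_invariant (k : Φ.Multiplicity) {p : SV V}
    (hp : ∀ g ∈ Φ.W, symAct g p = p) (g : Φ.Wa) :
    Φ.grpA k g * Φ.inclS k p = Φ.inclS k p * Φ.grpA k g := by
  induction g using Φ.Wa_induction with
  | simple a ha =>
    obtain ⟨q, h1, h2⟩ := Φ.grpA_refl_mul_inclS k ha p
    have hs := hp _ (Φ.linear_mem_W (Φ.refl a))
    rw [refl_linear] at hs
    rw [hs, sub_self, smul_zero] at h2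
    -- Invariance annihilates the product of `q` with the coroot, so `q` itself vanishes.
    have hq := (mul_eq_zero.1 h2).resolve_right (ι_coroot_ne_zero (Φ.grad_ne_zero a))
    rw [h1, hs, hq, map_zero, add_zero]
  | omega g hg => rw [Φ.grpA_omega_mul_inclS k hg, hp _ (Φ.linear_mem_W g)]
  | mul g h hg hh => rw [grpA_mul, mul_assoc, hh, ← mul_assoc, hg, mul_assoc]

/-! ### The diagonal action on functions on the regular set -/

variable {M : Type w} [AddCommGroup M] [Module ℂ M]

/-- The action of `W^a` on the regular elements. -/
def move (g : Φ.Wa) (x : Φ.Vreg) : Φ.Vreg := ⟨g.1 x.1, Φ.smul_mem_Vreg g x.2⟩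

theorem move_inv_move (g : Φ.Wa) (x : Φ.Vreg) : Φ.move g⁻¹ (Φ.move g x) = x :=
  Subtype.ext (g.1.symm_apply_apply x.1)

theorem move_mul (g h : Φ.Wa) (x : Φ.Vreg) : Φ.move (g * h) x = Φ.move g (Φ.move h x) := rfl

theorem dotFun_apply (ρ : Representation ℂ Φ.Wa M) (g : Φ.Wa) (f : Φ.Vreg → M) (x : Φ.Vreg) :
    Φ.dotFun ρ g f x = ρ g (f (Φ.move g⁻¹ x)) := rfl

theorem dotFun_mul (ρ : Representation ℂ Φ.Wa M) (g h : Φ.Wa) (f : Φ.Vreg → M) :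
    Φ.dotFun ρ (g * h) f = Φ.dotFun ρ g (Φ.dotFun ρ h f) := by
  ext x
  rw [dotFun_apply, dotFun_apply, dotFun_apply, map_mul, mul_inv_rev, move_mul]
  rfl

theorem dotFun_one (ρ : Representation ℂ Φ.Wa M) (f : Φ.Vreg → M) : Φ.dotFun ρ 1 f = f := by
  ext x
  rw [dotFun_apply, map_one, inv_one]
  rfl

theorem dotFun_move (ρ : Representation ℂ Φ.Wa M) (g : Φ.Wa) (f : Φ.Vreg → M) (x : Φ.Vreg) :
    Φ.dotFun ρ g f (Φ.move g x) = ρ g (f x) := by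
  rw [dotFun_apply, move_inv_move]

theorem coe_dot (ρ : Representation ℂ Φ.Wa M) (g : Φ.Wa) (f : Φ.B M) :
    (Φ.dot ρ g f).1 = Φ.dotFun ρ g f.1 := rfl

theorem coe_dunkl (k : Φ.Multiplicity) (ρ : Representation ℂ Φ.Wa M) (v : V) (f : Φ.B M) :
    (Φ.dunkl k ρ v f).1 = Φ.dunklFun k ρ v f.1 := rfl

/-- The diagonal action of `W^a` on `B^ω(V; M)` as a representation. -/
def dotHom (ρ : Representation ℂ Φ.Wa M) : Φ.Wa →* Module.End ℂ (Φ.B M) where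
  toFun := Φ.dot ρ
  map_one' := LinearMap.ext fun f => Subtype.ext (Φ.dotFun_one ρ f.1)
  map_mul' g h := LinearMap.ext fun f => Subtype.ext (Φ.dotFun_mul ρ g h f.1)

theorem dot_mul (ρ : Representation ℂ Φ.Wa M) (g h : Φ.Wa) :
    Φ.dot ρ (g * h) = Φ.dot ρ g * Φ.dot ρ h := (Φ.dotHom ρ).map_mul g h

/-! ### Equivariance of the Dunkl type operators -/

theorem ext_dotFun (ρ : Representation ℂ Φ.Wa M) (g : Φ.Wa) (f : Φ.Vreg → M) (y : V) :
    Φ.ext (Φ.dotFun ρ g f) (g.1 y) = ρ g (Φ.ext f y) := by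
  by_cases h : y ∈ Φ.Vreg
  · rw [ext, dif_pos (Φ.smul_mem_Vreg g h), ext, dif_pos h]
    exact Φ.dotFun_move ρ g f ⟨y, h⟩
  · rw [ext, dif_neg, ext, dif_neg h, map_zero]
    intro h'
    refine h ?_
    have := Φ.smul_mem_Vreg g⁻¹ h'
    rwa [show (g⁻¹ : Φ.Wa).1 (g.1 y) = y from g.1.symm_apply_apply y] at this

theorem dirDeriv_dotFun (ρ : Representation ℂ Φ.Wa M) (g : Φ.Wa) {f : Φ.Vreg → M} (hf : f ∈ Φ.B M)
    (v : V) (x : Φ.Vreg) :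
    Φ.dirDeriv (Φ.dotFun ρ g f) (g.1.linearIsometryEquiv v) (Φ.move g x) =
      ρ g (Φ.dirDeriv f v x) := by
  refine Φ.dirDeriv_eq fun ψ => ?_
  -- Derivatives are tested against functionals, so `ρ g` is absorbed into the functional and no
  -- topology on `M` is needed.
  have h := Φ.hasDirDeriv_dirDeriv hf v x (ψ ∘ₗ ρ g)
  refine h.congr_of_eventuallyEq (Filter.Eventually.of_forall fun t => ?_)
  have : (Φ.move g x).1 + t • g.1.linearIsometryEquiv v = g.1 (x.1 + t • v) := by
    change g.1 x.1 + _ = _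
    rw [apply_eq g.1 (x.1 + t • v), apply_eq g.1 x.1, map_add, map_smul]
    abel
  simp only [this, ext_dotFun]
  rfl

/-- The summands of the Dunkl type operators. -/
def dunklTerm (k : Φ.Multiplicity) (ρ : Representation ℂ Φ.Wa M) (v : V) (f : Φ.Vreg → M)
    (x : Φ.Vreg) (a : Φ.Ra) : M :=
  (k.toFun a * (a.1.1 v : ℂ) * Φ.ind a x) • Φ.dotFun ρ (Φ.refl a) f x

theorem dunklFun_apply (k : Φ.Multiplicity) (ρ : Representation ℂ Φ.Wa M) (v : V)
    (f : Φ.Vreg → M) (x : Φ.Vreg) : Φ.dunklFun k ρ v f x =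
      Φ.dirDeriv f v x - ∑ᶠ a ∈ Φ.RaPos, Φ.dunklTerm k ρ v f x a := rfl

theorem dunklTerm_eq_zero (k : Φ.Multiplicity) (ρ : Representation ℂ Φ.Wa M) (v : V)
    (f : Φ.Vreg → M) {x : Φ.Vreg} {a : Φ.Ra} (h : ¬ a.1.eval x.1 < 0) :
    Φ.dunklTerm k ρ v f x a = 0 := by
  simp [dunklTerm, ind, h]

/-- Only finitely many positive roots are negative at a given point; this supplies the finite
support that `finsum` manipulations require. -/
theorem finite_support_of_eval {F : Φ.Ra → M} (y : V) (h : ∀ a, ¬ a.1.eval y < 0 → F a = 0)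
    {S : Set Φ.Ra} (hS : S ⊆ Φ.RaPos) : (S ∩ Function.support F).Finite :=
  (Φ.finite_neg y).subset fun a ha => ⟨hS ha.1, by_contra fun hc => ha.2 (h a hc)⟩

theorem perm_eval_move (g : Φ.Wa) (a : Φ.Ra) (x : Φ.Vreg) :
    (Φ.perm g a).1.eval (Φ.move g x).1 = a.1.eval x.1 := by
  rw [perm_eval]
  exact congrArg (fun y : Φ.Vreg => a.1.eval y.1) (Φ.move_inv_move g x)

theorem dunklTerm_perm (k : Φ.Multiplicity) (ρ : Representation ℂ Φ.Wa M) (g : Φ.Wa) (v : V)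
    (f : Φ.Vreg → M) (x : Φ.Vreg) (a : Φ.Ra) :
    Φ.dunklTerm k ρ (g.1.linearIsometryEquiv v) (Φ.dotFun ρ g f) (Φ.move g x) (Φ.perm g a) =
      ρ g (Φ.dunklTerm k ρ v f x a) := by
  have h1 : (Φ.perm g a).1.1 (g.1.linearIsometryEquiv v) = a.1.1 v := act_fst_apply g.1 a.1 v
  have h2 : Φ.ind (Φ.perm g a) (Φ.move g x) = Φ.ind a x := by
    simp only [ind, perm_eval_move]
  have h3 : Φ.dotFun ρ (Φ.refl (Φ.perm g a)) (Φ.dotFun ρ g f) (Φ.move g x) =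
      ρ g (Φ.dotFun ρ (Φ.refl a) f x) := by
    rw [← dotFun_mul, refl_perm, inv_mul_cancel_right, dotFun_mul, dotFun_move]
  rw [dunklTerm, dunklTerm, h1, h2, h3, k.perm, map_smul]

/-- Conjugation by `g` affects the Dunkl operator, apart from turning `v`, only through its index
set. The difference between `R^{a,+}` and its image under `g` is the sole source of the corrections
in the cross relations. -/
theorem dotFun_dunklFun (k : Φ.Multiplicity) (ρ : Representation ℂ Φ.Wa M) (g : Φ.Wa) (v : V)
    {f : Φ.Vreg → M} (hf : f ∈ Φ.B M) (x : Φ.Vreg) :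
    Φ.dotFun ρ g (Φ.dunklFun k ρ v f) (Φ.move g x) =
      Φ.dirDeriv (Φ.dotFun ρ g f) (g.1.linearIsometryEquiv v) (Φ.move g x) -
        ∑ᶠ a ∈ Φ.RaPos, Φ.dunklTerm k ρ (g.1.linearIsometryEquiv v) (Φ.dotFun ρ g f)
          (Φ.move g x) (Φ.perm g a) := by
  rw [dotFun_move, dunklFun_apply, map_sub, dirDeriv_dotFun Φ ρ g hf]
  congr 1
  have := AddMonoidHom.map_finsum_mem' (s := Φ.RaPos) (f := Φ.dunklTerm k ρ v f x)
    (ρ g).toAddMonoidHom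
    (Φ.finite_support_of_eval x.1 (fun a => Φ.dunklTerm_eq_zero k ρ v f) subset_rfl)
  refine Eq.trans this ?_
  simp only [dunklTerm_perm]
  rfl

theorem move_surjective (g : Φ.Wa) (x : Φ.Vreg) : ∃ y, Φ.move g y = x :=
  ⟨Φ.move g⁻¹ x, by have := Φ.move_inv_move g⁻¹ x; rwa [inv_inv] at this⟩

theorem dot_dunkl_omega (k : Φ.Multiplicity) (ρ : Representation ℂ Φ.Wa M) {g : Φ.Wa}
    (hg : Φ.length g = 0) (v : V) :
    Φ.dot ρ g * Φ.dunkl k ρ v = Φ.dunkl k ρ (g.1.linearIsometryEquiv v) * Φ.dot ρ g := by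
  refine LinearMap.ext fun f => Subtype.ext (funext fun x => ?_)
  obtain ⟨y, rfl⟩ := Φ.move_surjective g x
  refine (Φ.dotFun_dunklFun k ρ g v f.2 y).trans ?_
  refine Eq.trans ?_ (Φ.dunklFun_apply k ρ _ _ _).symm
  congr 1
  refine finsum_mem_eq_of_bijOn (Φ.perm g) ⟨fun a ha => ?_, (Φ.perm g).injective.injOn,
    fun b hb => ⟨(Φ.perm g).symm b, ?_, (Φ.perm g).apply_symm_apply b⟩⟩ fun a _ => rfl
  · exact (Φ.perm_mem_RaPos_of_length_eq_zero hg a).2 ha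
  · rw [← Φ.perm_mem_RaPos_of_length_eq_zero hg, Equiv.apply_symm_apply]
    exact hb

/-- At a regular point exactly one of `a` and `-a` is negative, while `a` and `-a` have opposite
gradients and the same reflection; the indicator thus disappears from the difference. -/
theorem dunklTerm_sub_neg (k : Φ.Multiplicity) (ρ : Representation ℂ Φ.Wa M) (v : V)
    (f : Φ.Vreg → M) (x : Φ.Vreg) (a : Φ.Ra) :
    Φ.dunklTerm k ρ v f x a - Φ.dunklTerm k ρ v f x (Φ.negRoot a) =
      (k.toFun a * (a.1.1 v : ℂ)) • Φ.dotFun ρ (Φ.refl a) f x := by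
  have h1 : ((Φ.negRoot a).1.1 v : ℂ) = -(a.1.1 v : ℂ) := by
    change (((-a.1.1) v : ℝ) : ℂ) = _
    simp
  have h2 : Φ.ind a x + Φ.ind (Φ.negRoot a) x = 1 := by
    have := x.2 a.1 a.2
    simp only [ind, negRoot_eval]
    rcases lt_or_gt_of_ne this with h | h
    · simp [h, h.le]
    · simp [h, h.le]
  rw [dunklTerm, dunklTerm, refl_negRoot, k.neg, h1, ← sub_smul]
  congr 1
  linear_combination (k.toFun a * (a.1.1 v : ℂ)) * h2

/-- The reflection permutes the positive roots other than `a`, so the two sums differ only in the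
terms at `-a` and `a`, and that difference is the scalar correction. -/
theorem dot_dunkl_simple (k : Φ.Multiplicity) (ρ : Representation ℂ Φ.Wa M) {a : Φ.Ra}
    (ha : a ∈ Φ.Fa) (v : V) :
    Φ.dot ρ (Φ.refl a) * Φ.dunkl k ρ v =
      Φ.dunkl k ρ (linRefl a.1.1 v) * Φ.dot ρ (Φ.refl a) - (k.toFun a * (a.1.1 v : ℂ)) • 1 := by
  refine LinearMap.ext fun f => Subtype.ext (funext fun x => ?_)
  obtain ⟨y, rfl⟩ := Φ.move_surjective (Φ.refl a) x
  set s := Φ.refl a with hs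
  set x := Φ.move s y
  have hlin : s.1.linearIsometryEquiv = linRefl a.1.1 := Φ.refl_linear a
  have h1 := Φ.dotFun_dunklFun k ρ s v f.2 y
  rw [hlin] at h1
  set v' := linRefl a.1.1 v with hv'
  set h := Φ.dotFun ρ s f.1
  have haP := Φ.Fa_subset_RaPos ha
  have hins : Φ.RaPos = insert a (Φ.RaPos \ {a}) := by
    rw [Set.insert_sdiff_singleton, Set.insert_eq_of_mem haP]
  have hna : a ∉ Φ.RaPos \ {a} := fun h => h.2 rfl
  have hmaps : ∀ b ∈ Φ.RaPos \ {a}, Φ.perm s b ∈ Φ.RaPos \ {a} := by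
    rintro b ⟨hb, hba⟩
    refine ⟨Φ.perm_simple_mem_RaPos ha hb hba, fun hc => ?_⟩
    have : b = Φ.negRoot a := by
      rw [← Φ.perm_refl_self, ← Φ.perm_refl_refl a b]
      congr 1
    rw [this] at hb
    exact Φ.not_mem_RaPos_and_neg a haP hb
  have hbij : Set.BijOn (Φ.perm s) (Φ.RaPos \ {a}) (Φ.RaPos \ {a}) :=
    ⟨hmaps, (Φ.perm s).injective.injOn, fun b hb => ⟨Φ.perm s b, hmaps b hb,
      Φ.perm_refl_refl a b⟩⟩
  have hfin1 := Φ.finite_support_of_eval (F := fun b => Φ.dunklTerm k ρ v' h x (Φ.perm s b)) y.1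
    (fun b hb => Φ.dunklTerm_eq_zero k ρ v' h (by rwa [perm_eval_move]))
    (Set.sdiff_subset : Φ.RaPos \ {a} ⊆ Φ.RaPos)
  have hfin2 := Φ.finite_support_of_eval (F := Φ.dunklTerm k ρ v' h x) x.1
    (fun b hb => Φ.dunklTerm_eq_zero k ρ v' h hb)
    (Set.sdiff_subset : Φ.RaPos \ {a} ⊆ Φ.RaPos)
  rw [hins, finsum_mem_insert' _ hna hfin1, perm_refl_self,
    finsum_mem_eq_of_bijOn (g := Φ.dunklTerm k ρ v' h x) (Φ.perm s) hbij fun b _ => rfl] at h1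
  have h2 := Φ.dunklFun_apply k ρ v' h x
  rw [hins, finsum_mem_insert' _ hna hfin2] at h2
  have h3 := Φ.dunklTerm_sub_neg k ρ v' h x a
  -- The remaining term reflects `h`, itself the reflection of `f`; the two cancel, which is why the
  -- correction acts as a scalar.
  have h4 : Φ.dotFun ρ (Φ.refl a) h = f.1 := by
    rw [← Φ.dotFun_mul, refl_mul_refl, dotFun_one]
  rw [h4, hv', linRefl_pairing] at h3
  change Φ.dotFun ρ s (Φ.dunklFun k ρ v f.1) x =
    Φ.dunklFun k ρ v' h x - (k.toFun a * (a.1.1 v : ℂ)) • f.1 x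
  rw [h1, h2]
  have h5 : (k.toFun a * (a.1.1 v : ℂ)) • f.1 x = Φ.dunklTerm k ρ v' h x (Φ.negRoot a) -
      Φ.dunklTerm k ρ v' h x a := by
    rw [← neg_sub (Φ.dunklTerm k ρ v' h x a), h3]
    push_cast
    module
  rw [h5]
  abel

/-! ### Linearity -/

theorem dirDeriv_eq_evalT {f : Φ.Vreg → M} {C : Set V} (hC : C ∈ Φ.chambers) {t : Cω V ⊗[ℂ] M}
    (ht : ∀ x : Φ.Vreg, x.1 ∈ C → f x = evalT V M t x.1) (v : V) (x : Φ.Vreg) (hx : x.1 ∈ C) :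
    Φ.dirDeriv f v x = evalT V M ((partialD v).rTensor M t) x.1 :=
  Φ.dirDeriv_eq (Φ.hasDirDeriv_evalT hC ht v x hx)

/-- Additivity in the direction is not formal for derivatives along lines; it comes from the
analytic representative on the chamber. -/
theorem dirDeriv_add {f : Φ.Vreg → M} (hf : f ∈ Φ.B M) (u v : V) (x : Φ.Vreg) :
    Φ.dirDeriv f (u + v) x = Φ.dirDeriv f u x + Φ.dirDeriv f v x := by
  obtain ⟨C, hC, hx⟩ := Φ.mem_own_chamber x
  obtain ⟨t, ht⟩ := Φ.mem_B.1 hf C hC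
  rw [Φ.dirDeriv_eq_evalT hC ht _ x hx, Φ.dirDeriv_eq_evalT hC ht _ x hx,
    Φ.dirDeriv_eq_evalT hC ht _ x hx,
    show partialD (u + v) = partialD u + partialD v from (partialLin V).map_add u v,
    LinearMap.rTensor_add, LinearMap.add_apply, map_add, Pi.add_apply]

theorem dirDeriv_smul {f : Φ.Vreg → M} (hf : f ∈ Φ.B M) (c : ℝ) (v : V) (x : Φ.Vreg) :
    Φ.dirDeriv f (c • v) x = (c : ℂ) • Φ.dirDeriv f v x := by
  obtain ⟨C, hC, hx⟩ := Φ.mem_own_chamber x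
  obtain ⟨t, ht⟩ := Φ.mem_B.1 hf C hC
  rw [Φ.dirDeriv_eq_evalT hC ht _ x hx, Φ.dirDeriv_eq_evalT hC ht _ x hx,
    show partialD (c • v) = (c : ℂ) • partialD v from (partialLin V).map_smul c v,
    LinearMap.rTensor_smul, LinearMap.smul_apply, map_smul, Pi.smul_apply]

/-- The real linear map `v ↦ 𝒟_v`. -/
def dunklLin (k : Φ.Multiplicity) (ρ : Representation ℂ Φ.Wa M) :
    V →ₗ[ℝ] Module.End ℂ (Φ.B M) where
  toFun := Φ.dunkl k ρ
  map_add' u v := by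
    refine LinearMap.ext fun f => Subtype.ext (funext fun x => ?_)
    change Φ.dunklFun k ρ (u + v) f.1 x = Φ.dunklFun k ρ u f.1 x + Φ.dunklFun k ρ v f.1 x
    have hfin := fun v => Φ.finite_support_of_eval (F := Φ.dunklTerm k ρ v f.1 x) x.1
      (fun b hb => Φ.dunklTerm_eq_zero k ρ v f.1 hb) subset_rfl
    rw [dunklFun_apply, dunklFun_apply, dunklFun_apply, Φ.dirDeriv_add f.2, ← add_sub_add_comm,
      ← finsum_mem_add_distrib' (hfin u) (hfin v)]
    congr 1
    refine finsum_congr fun a => finsum_congr fun _ => ?_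
    simp only [dunklTerm, ← add_smul]
    congr 1
    push_cast [map_add]
    ring
  map_smul' c v := by
    refine LinearMap.ext fun f => Subtype.ext (funext fun x => ?_)
    change Φ.dunklFun k ρ (c • v) f.1 x = (c : ℂ) • Φ.dunklFun k ρ v f.1 x
    rw [dunklFun_apply, dunklFun_apply, Φ.dirDeriv_smul f.2, smul_sub, smul_finsum]
    congr 1
    refine finsum_congr fun a => ?_
    rw [smul_finsum]
    refine finsum_congr fun _ => ?_
    simp only [dunklTerm, smul_smul, map_smul, smul_eq_mul]
    congr 1
    push_cast
    ring

theorem dunklLin_apply (k : Φ.Multiplicity) (ρ : Representation ℂ Φ.Wa M) (v : V) :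
    Φ.dunklLin k ρ v = Φ.dunkl k ρ v := rfl

/-! ### Commutativity -/

variable {Φ} in
theorem Dominant.of_mem_chamber {C : Set V} (hC : C ∈ Φ.chambers) {x y : V} (hx : x ∈ C)
    (hy : y ∈ C) (h : Φ.Dominant x) : Φ.Dominant y := by
  intro a ha
  have := Φ.neg_of_chamber hC hx hy (Φ.negRoot a) (by
    rw [negRoot_eval]
    linarith [h a ha])
  rw [negRoot_eval] at this
  linarith

theorem dunklFun_of_dominant (k : Φ.Multiplicity) (ρ : Representation ℂ Φ.Wa M) (v : V)
    (f : Φ.Vreg → M) {x : Φ.Vreg} (hx : Φ.Dominant x.1) :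
    Φ.dunklFun k ρ v f x = Φ.dirDeriv f v x := by
  rw [dunklFun_apply, sub_eq_self, finsum_mem_eq_zero_of_forall_eq_zero]
  exact fun a ha => Φ.dunklTerm_eq_zero k ρ v f (hx a ha).not_gt

theorem dunkl_comm_of_dominant (k : Φ.Multiplicity) (ρ : Representation ℂ Φ.Wa M) (u v : V)
    (f : Φ.B M) {x : Φ.Vreg} (hx : Φ.Dominant x.1) :
    ((Φ.dunkl k ρ u * Φ.dunkl k ρ v) f).1 x = ((Φ.dunkl k ρ v * Φ.dunkl k ρ u) f).1 x := by
  obtain ⟨C, hC, hxC⟩ := Φ.mem_own_chamber x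
  obtain ⟨t, ht⟩ := Φ.mem_B.1 f.2 C hC
  have key : ∀ u v : V, ((Φ.dunkl k ρ u * Φ.dunkl k ρ v) f).1 x =
      evalT V M ((partialD u * partialD v).rTensor M t) x.1 := by
    intro u v
    change Φ.dunklFun k ρ u (Φ.dunklFun k ρ v f.1) x = _
    rw [Φ.dunklFun_of_dominant k ρ u _ hx, Φ.dirDeriv_eq_evalT hC
      (t := (partialD v).rTensor M t) (fun y hy => ?_) u x hxC, LinearMap.rTensor_mul]
    · rfl
    · rw [Φ.dunklFun_of_dominant k ρ v _ (hx.of_mem_chamber hC hxC hy),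
        Φ.dirDeriv_eq_evalT hC ht v y hy]
  rw [key, key, partialD_comm]

/-- The commutator of two Dunkl type operators. -/
def dunklBracket (k : Φ.Multiplicity) (ρ : Representation ℂ Φ.Wa M) (u v : V) :
    Module.End ℂ (Φ.B M) := Φ.dunkl k ρ u * Φ.dunkl k ρ v - Φ.dunkl k ρ v * Φ.dunkl k ρ u

theorem dunkl_linRefl (k : Φ.Multiplicity) (ρ : Representation ℂ Φ.Wa M) (ξ : StrongDual ℝ V)
    (v : V) : Φ.dunkl k ρ (linRefl ξ v) =
      Φ.dunkl k ρ v - (ξ v : ℂ) • Φ.dunkl k ρ (coroot ξ) := by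
  rw [linRefl_apply, ← dunklLin_apply, map_sub, map_smul]
  rfl

/-- Each product acquires two first-order corrections. Since both primed operators differ from the
unprimed ones by multiples of the same `D`, with the coefficients that occur in the cross relations,
these corrections cancel in the commutator. -/
theorem mul_commutator_of_cross {E : Type*} [Ring E] [Algebra ℂ E] {s D₁ D₁' D₂ D₂' D : E}
    {c x y : ℂ} (h₁ : s * D₁ = D₁' * s - (c * x) • 1) (h₂ : s * D₂ = D₂' * s - (c * y) • 1)
    (e₁ : D₁' = D₁ - x • D) (e₂ : D₂' = D₂ - y • D) :
    s * (D₁ * D₂ - D₂ * D₁) = (D₁' * D₂' - D₂' * D₁') * s := by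
  have k₁ : s * (D₁ * D₂) = D₁' * D₂' * s - (c * y) • D₁' - (c * x) • D₂ := by
    rw [← mul_assoc, h₁, sub_mul, mul_assoc, h₂, mul_sub, smul_mul_assoc, one_mul,
      mul_smul_comm, mul_one, mul_assoc]
  have k₂ : s * (D₂ * D₁) = D₂' * D₁' * s - (c * x) • D₂' - (c * y) • D₁ := by
    rw [← mul_assoc, h₂, sub_mul, mul_assoc, h₁, mul_sub, smul_mul_assoc, one_mul,
      mul_smul_comm, mul_one, mul_assoc]
  have k₃ : (c * y) • D₁' + (c * x) • D₂ = (c * x) • D₂' + (c * y) • D₁ := by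
    rw [e₁, e₂]
    module
  rw [mul_sub, k₁, k₂, sub_mul, ← sub_eq_zero]
  rw [← sub_eq_zero, ← neg_eq_zero] at k₃
  rw [← k₃]
  abel

theorem mul_commutator_of_intertwine {E : Type*} [Ring E] {s D₁ D₁' D₂ D₂' : E}
    (h₁ : s * D₁ = D₁' * s) (h₂ : s * D₂ = D₂' * s) :
    s * (D₁ * D₂ - D₂ * D₁) = (D₁' * D₂' - D₂' * D₁') * s := by
  rw [mul_sub, ← mul_assoc, h₁, mul_assoc, h₂, ← mul_assoc s, h₂, mul_assoc D₂', h₁, sub_mul,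
    mul_assoc, mul_assoc]

theorem dot_dunklBracket (k : Φ.Multiplicity) (ρ : Representation ℂ Φ.Wa M) (g : Φ.Wa) :
    ∀ u v : V, Φ.dot ρ g * Φ.dunklBracket k ρ u v = Φ.dunklBracket k ρ
      (g.1.linearIsometryEquiv u) (g.1.linearIsometryEquiv v) * Φ.dot ρ g := by
  induction g using Φ.Wa_induction with
  | simple a ha =>
    intro u v
    rw [refl_linear]
    exact mul_commutator_of_cross (E := Module.End ℂ (Φ.B M)) (Φ.dot_dunkl_simple k ρ ha u) (Φ.dot_dunkl_simple k ρ ha v)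
      (Φ.dunkl_linRefl k ρ a.1.1 u) (Φ.dunkl_linRefl k ρ a.1.1 v)
  | omega g hg =>
    intro u v
    exact mul_commutator_of_intertwine (E := Module.End ℂ (Φ.B M)) (Φ.dot_dunkl_omega k ρ hg u)
      (Φ.dot_dunkl_omega k ρ hg v)
  | mul g h hg hh =>
    intro u v
    rw [dot_mul, mul_assoc, hh, ← mul_assoc, hg, mul_assoc]
    rfl

theorem rep_injective (ρ : Representation ℂ Φ.Wa M) (g : Φ.Wa) : Function.Injective (ρ g) :=
  Function.LeftInverse.injective (g := ρ g⁻¹) fun m => by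
    rw [← Module.End.mul_apply, ← map_mul, inv_mul_cancel, map_one, Module.End.one_apply]

/-- Equivariance of the bracket transports its value at any regular point to a dominant one, where
it is a commutator of partial derivatives; injectivity of `ρ g` brings the vanishing back. -/
theorem dunkl_comm (k : Φ.Multiplicity) (ρ : Representation ℂ Φ.Wa M) (u v : V) :
    Φ.dunkl k ρ u * Φ.dunkl k ρ v = Φ.dunkl k ρ v * Φ.dunkl k ρ u := by
  rw [← sub_eq_zero]
  change Φ.dunklBracket k ρ u v = 0
  refine LinearMap.ext fun f => Subtype.ext (funext fun x => ?_)
  obtain ⟨g, -, hg⟩ := Φ.exists_dominant_translate x.2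
  apply Φ.rep_injective ρ g
  rw [← dotFun_move]
  have h := congrArg (fun T : Module.End ℂ (Φ.B M) => (T f).1 (Φ.move g x))
    (Φ.dot_dunklBracket k ρ g u v)
  refine h.trans ?_
  change ((Φ.dunkl k ρ _ * Φ.dunkl k ρ _) (Φ.dot ρ g f)).1 (Φ.move g x) -
    ((Φ.dunkl k ρ _ * Φ.dunkl k ρ _) (Φ.dot ρ g f)).1 (Φ.move g x) = _
  rw [Φ.dunkl_comm_of_dominant k ρ _ _ _ hg, sub_self]
  exact (map_zero (ρ g)).symm

/-! ### The representation of `A(k)` -/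

/-- The complex linear map `V_ℂ → End(B^ω(V; M))` extending `v ↦ 𝒟_v`. -/
def dunklLinC (k : Φ.Multiplicity) (ρ : Representation ℂ Φ.Wa M) :
    VC V →ₗ[ℂ] Module.End ℂ (Φ.B M) := LinearMap.liftBaseChange ℂ (Φ.dunklLin k ρ)

theorem dunklLinC_tmul (k : Φ.Multiplicity) (ρ : Representation ℂ Φ.Wa M) (c : ℂ) (v : V) :
    Φ.dunklLinC k ρ (c ⊗ₜ v) = c • Φ.dunkl k ρ v := LinearMap.liftBaseChange_tmul ℂ _ c v

theorem dunklLinC_comm (k : Φ.Multiplicity) (ρ : Representation ℂ Φ.Wa M) (x y : VC V) :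
    Φ.dunklLinC k ρ x * Φ.dunklLinC k ρ y = Φ.dunklLinC k ρ y * Φ.dunklLinC k ρ x := by
  change Commute (Φ.dunklLinC k ρ x) (Φ.dunklLinC k ρ y)
  induction x using TensorProduct.induction_on with
  | zero => simp
  | add x y hx hy => rw [map_add]; exact hx.add_left hy
  | tmul c v =>
    induction y using TensorProduct.induction_on with
    | zero => simp
    | add x y hx hy => rw [map_add]; exact hx.add_right hy
    | tmul d w =>
      rw [dunklLinC_tmul, dunklLinC_tmul]
      exact (Commute.smul_left (Φ.dunkl_comm k ρ v w) c).smul_right d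

/-- The action of `S(V_ℂ)` on `B^ω(V; M)` by Dunkl type operators. -/
def dunklS (k : Φ.Multiplicity) (ρ : Representation ℂ Φ.Wa M) :
    SV V →ₐ[ℂ] Module.End ℂ (Φ.B M) := symLift (Φ.dunklLinC k ρ) (Φ.dunklLinC_comm k ρ)

theorem dunklS_ι (k : Φ.Multiplicity) (ρ : Representation ℂ Φ.Wa M) (x : VC V) :
    Φ.dunklS k ρ (SymmetricAlgebra.ι ℂ (VC V) x) = Φ.dunklLinC k ρ x := symLift_ι _ _ x

/-- The action of `ℂ[W^a]` on `B^ω(V; M)`. -/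
def dotW (ρ : Representation ℂ Φ.Wa M) : MonoidAlgebra ℂ Φ.Wa →ₐ[ℂ] Module.End ℂ (Φ.B M) :=
  MonoidAlgebra.lift ℂ _ Φ.Wa (Φ.dotHom ρ)

theorem dotW_of (ρ : Representation ℂ Φ.Wa M) (g : Φ.Wa) :
    Φ.dotW ρ (MonoidAlgebra.of ℂ Φ.Wa g) = Φ.dot ρ g := MonoidAlgebra.lift_of _ g

theorem dot_dunklLinC_omega (k : Φ.Multiplicity) (ρ : Representation ℂ Φ.Wa M) {g : Φ.Wa}
    (hg : Φ.length g = 0) (x : VC V) : Φ.dot ρ g * Φ.dunklLinC k ρ x =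
      Φ.dunklLinC k ρ (linC g.1.linearIsometryEquiv x) * Φ.dot ρ g := by
  induction x using TensorProduct.induction_on with
  | zero => simp
  | add x y hx hy => rw [map_add, mul_add, hx, hy, map_add, map_add, add_mul]
  | tmul c v =>
    rw [linC_tmul, dunklLinC_tmul, dunklLinC_tmul, mul_smul_comm, smul_mul_assoc,
      Φ.dot_dunkl_omega k ρ hg]

theorem smul_sub_smul_one {E : Type*} [Ring E] [Algebra ℂ E] (x : E) (c d r : ℂ) :
    c • (x - (d * r) • 1) = c • x + algebraMap ℂ E (-(d * (c * r))) := by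
  rw [Algebra.algebraMap_eq_smul_one]
  module

theorem dot_dunklLinC_simple (k : Φ.Multiplicity) (ρ : Representation ℂ Φ.Wa M) {a : Φ.Ra}
    (ha : a ∈ Φ.Fa) (x : VC V) : Φ.dot ρ (Φ.refl a) * Φ.dunklLinC k ρ x =
      Φ.dunklLinC k ρ (linC (linRefl a.1.1) x) * Φ.dot ρ (Φ.refl a) +
        algebraMap ℂ (Module.End ℂ (Φ.B M)) (-(k.toFun a * dualC a.1.1 x)) := by
  induction x using TensorProduct.induction_on with
  | zero => simp
  | add x y hx hy =>
    rw [map_add, mul_add, hx, hy, map_add, map_add, add_mul, map_add, mul_add, neg_add, map_add]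
    abel
  | tmul c v =>
    rw [linC_tmul, dunklLinC_tmul, dunklLinC_tmul, mul_smul_comm, smul_mul_assoc,
      Φ.dot_dunkl_simple k ρ ha, dualC_tmul]
    exact smul_sub_smul_one (E := Module.End ℂ (Φ.B M)) _ c _ _

/-- The representation of the free algebra underlying `π_{k,M}`. -/
def freeRep (k : Φ.Multiplicity) (ρ : Representation ℂ Φ.Wa M) :
    Φ.FreeAlg →ₐ[ℂ] Module.End ℂ (Φ.B M) :=
  FreeAlgebra.lift ℂ (Sum.elim (Φ.dunklS k ρ) (Φ.dotW ρ))

theorem freeRep_genS (k : Φ.Multiplicity) (ρ : Representation ℂ Φ.Wa M) (p : SV V) :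
    Φ.freeRep k ρ (Φ.genS p) = Φ.dunklS k ρ p := FreeAlgebra.lift_ι_apply _ _

theorem freeRep_genW (k : Φ.Multiplicity) (ρ : Representation ℂ Φ.Wa M)
    (x : MonoidAlgebra ℂ Φ.Wa) : Φ.freeRep k ρ (Φ.genW x) = Φ.dotW ρ x :=
  FreeAlgebra.lift_ι_apply _ _

theorem freeRep_genV (k : Φ.Multiplicity) (ρ : Representation ℂ Φ.Wa M) (x : VC V) :
    Φ.freeRep k ρ (Φ.genV x) = Φ.dunklLinC k ρ x := by
  rw [genV, freeRep_genS, dunklS_ι]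

theorem freeRep_genG (k : Φ.Multiplicity) (ρ : Representation ℂ Φ.Wa M) (g : Φ.Wa) :
    Φ.freeRep k ρ (Φ.genG g) = Φ.dot ρ g := by
  rw [genG, freeRep_genW, dotW_of]

theorem freeRep_rel (k : Φ.Multiplicity) (ρ : Representation ℂ Φ.Wa M) ⦃x y : Φ.FreeAlg⦄
    (h : Rel Φ k x y) : Φ.freeRep k ρ x = Φ.freeRep k ρ y := by
  induction h with
  | S_add p q => simp only [map_add, freeRep_genS]
  | S_mul p q => simp only [map_mul, freeRep_genS]
  | S_scalar c => rw [freeRep_genS, AlgHom.commutes, AlgHom.commutes]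
  | W_add x y => simp only [map_add, freeRep_genW]
  | W_mul x y => simp only [map_mul, freeRep_genW]
  | W_scalar c => rw [freeRep_genW, AlgHom.commutes, AlgHom.commutes]
  | cross a ha x =>
    refine (map_sub (Φ.freeRep k ρ) _ _).trans ?_
    rw [map_mul, map_mul, freeRep_genG, freeRep_genV, freeRep_genV, AlgHom.commutes]
    exact sub_eq_iff_eq_add'.2 (Φ.dot_dunklLinC_simple k ρ ha x)
  | omega g hg x =>
    rw [map_mul, map_mul, freeRep_genG, freeRep_genV, freeRep_genV,
      Φ.dot_dunklLinC_omega k ρ hg]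

/-- The representation `π_{k,M}` of `A(k)` on `B^ω(V; M)`. -/
def piRep (k : Φ.Multiplicity) (ρ : Representation ℂ Φ.Wa M) :
    Φ.A k →ₐ[ℂ] Module.End ℂ (Φ.B M) :=
  RingQuot.liftAlgHom ℂ ⟨Φ.freeRep k ρ, Φ.freeRep_rel k ρ⟩

theorem piRep_toA (k : Φ.Multiplicity) (ρ : Representation ℂ Φ.Wa M) (x : Φ.FreeAlg) :
    Φ.piRep k ρ (Φ.toA k x) = Φ.freeRep k ρ x :=
  RingQuot.liftAlgHom_mkAlgHom_apply ℂ _ _ x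

theorem piRep_extends (k : Φ.Multiplicity) (ρ : Representation ℂ Φ.Wa M) :
    Φ.Extends k ρ (Φ.piRep k ρ) := by
  refine ⟨fun v => ?_, fun g => ?_⟩
  · refine (Φ.piRep_toA k ρ (Φ.genV (1 ⊗ₜ v))).trans ?_
    rw [freeRep_genV, dunklLinC_tmul, one_smul]
  · exact (Φ.piRep_toA k ρ (Φ.genG g)).trans (Φ.freeRep_genG k ρ g)

variable {Φ} in
theorem Extends.unique {k : Φ.Multiplicity} {ρ : Representation ℂ Φ.Wa M}
    {π π' : Φ.A k →ₐ[ℂ] Module.End ℂ (Φ.B M)} (h : Φ.Extends k ρ π) (h' : Φ.Extends k ρ π') :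
    π = π' := by
  ext1 a
  exact Φ.A_generated k (AlgHom.equalizer π π') (fun v => (h.1 v).trans (h'.1 v).symm)
    (fun g => (h.2 g).trans (h'.2 g).symm) a

/-! ### The action of `S(V_ℂ)` on the fundamental chamber -/

variable {Φ} in
-- The statement ranges over all `f` and all representatives `t` so that the good `p` form a
-- subalgebra: in a product, the second factor yields a new function with a new representative, to
-- which the first is applied.
theorem Extends.inclS_of_dominant {k : Φ.Multiplicity} {ρ : Representation ℂ Φ.Wa M}
    {π : Φ.A k →ₐ[ℂ] Module.End ℂ (Φ.B M)} (h : Φ.Extends k ρ π) {C : Set V}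
    (hC : C ∈ Φ.chambers) (hdom : ∀ x ∈ C, Φ.Dominant x) (p : SV V) :
    ∀ (f : Φ.B M) (t : Cω V ⊗[ℂ] M), (∀ x : Φ.Vreg, x.1 ∈ C → f.1 x = evalT V M t x.1) →
      ∀ x : Φ.Vreg, x.1 ∈ C →
        (π (Φ.inclS k p) f).1 x = evalT V M ((diffOp V p).rTensor M t) x.1 := by
  let S : Subalgebra ℂ (SV V) :=
    { carrier := {p | ∀ (f : Φ.B M) (t : Cω V ⊗[ℂ] M),
        (∀ x : Φ.Vreg, x.1 ∈ C → f.1 x = evalT V M t x.1) → ∀ x : Φ.Vreg, x.1 ∈ C →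
          (π (Φ.inclS k p) f).1 x = evalT V M ((diffOp V p).rTensor M t) x.1}
      mul_mem' := fun {p q} hp hq f t hf x hx => by
        rw [map_mul, map_mul, map_mul, LinearMap.rTensor_mul]
        exact hp _ _ (hq f t hf) x hx
      add_mem' := fun {p q} hp hq f t hf x hx => by
        rw [map_add, map_add, map_add, LinearMap.rTensor_add]
        change (π (Φ.inclS k p) f).1 x + (π (Φ.inclS k q) f).1 x = evalT V M (_ + _) x.1
        rw [hp f t hf x hx, hq f t hf x hx, map_add]
        rfl
      algebraMap_mem' := fun r f t hf x hx => by
        rw [AlgHom.commutes, AlgHom.commutes, AlgHom.commutes, Algebra.algebraMap_eq_smul_one,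
          Algebra.algebraMap_eq_smul_one, LinearMap.rTensor_smul, Module.End.one_eq_id,
          Module.End.one_eq_id, LinearMap.rTensor_id]
        change r • f.1 x = evalT V M (r • t) x.1
        rw [hf x hx, map_smul]
        rfl }
  refine ι_mem_of_tmul_mem S (AlgHom.id ℂ _) (fun v f t hf x hx => ?_) p
  rw [AlgHom.id_apply, diffOp_ι, ← Φ.dirDeriv_eq_evalT hC hf v x hx,
    ← Φ.dunklFun_of_dominant k ρ v f.1 (hdom _ hx)]
  have := h.1 v
  rw [vecA] at this
  rw [this]
  rfl

/-! ### Injectivity of the multiplication map -/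

/-- The exponential of a complex linear form, as an analytic function on `V`. -/
def expω (l : VC V →ₗ[ℂ] ℂ) : Cω V :=
  ⟨fun y => Complex.exp (l (1 ⊗ₜ y)), fun x _ => by
    let L : V →L[ℝ] ℂ := LinearMap.toContinuousLinearMap
      ((l.restrictScalars ℝ) ∘ₗ (TensorProduct.mk ℝ ℂ V 1))
    have hL : AnalyticAt ℝ (fun y : V => l (1 ⊗ₜ y)) x := L.analyticAt x
    exact AnalyticAt.comp (g := Complex.exp) (analyticAt_cexp.restrictScalars) hL⟩

theorem partialD_expω (l : VC V →ₗ[ℂ] ℂ) (v : V) : partialD v (expω l) = l (1 ⊗ₜ v) • expω l := by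
  apply Subtype.ext
  funext x
  let L : V →L[ℝ] ℂ := LinearMap.toContinuousLinearMap
    ((l.restrictScalars ℝ) ∘ₗ (TensorProduct.mk ℝ ℂ V 1))
  have h : HasFDerivAt (expω l).1 (Complex.exp (L x) • L) x :=
    (L.hasFDerivAt (x := x)).cexp
  rw [partialD_apply, h.fderiv]
  exact mul_comm _ _

/-- Exponentials are joint eigenvectors of the derivatives, with `p` acting by its value at `l`. -/
theorem diffOp_expω (l : VC V →ₗ[ℂ] ℂ) (p : SV V) :
    diffOp V p (expω l) = SymmetricAlgebra.lift l p • expω l := by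
  let S : Subalgebra ℂ (SV V) :=
    { carrier := {p | diffOp V p (expω l) = SymmetricAlgebra.lift l p • expω l}
      mul_mem' := fun {p q} hp hq => by
        rw [Set.mem_ofPred_eq] at hp hq ⊢
        rw [map_mul, Module.End.mul_apply, hq, map_smul, hp, smul_smul, map_mul, mul_comm]
      add_mem' := fun {p q} hp hq => by
        rw [Set.mem_ofPred_eq] at hp hq ⊢
        rw [map_add, LinearMap.add_apply, hp, hq, map_add, add_smul]
      algebraMap_mem' := fun r => by
        rw [Set.mem_ofPred_eq, AlgHom.commutes, AlgHom.commutes, Module.algebraMap_end_apply]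
        rfl }
  refine ι_mem_of_tmul_mem S (AlgHom.id ℂ _) (fun v => ?_) p
  change diffOp V (SymmetricAlgebra.ι ℂ (VC V) (1 ⊗ₜ v)) (expω l) = _
  rw [diffOp_ι, partialD_expω, AlgHom.id_apply, SymmetricAlgebra.lift_ι_apply]

/-- In a basis of `V_ℂ` this says that a polynomial over the infinite field `ℂ` vanishing at all
points is zero. -/
theorem eq_zero_of_lift_eq_zero {p : SV V}
    (h : ∀ l : VC V →ₗ[ℂ] ℂ, SymmetricAlgebra.lift l p = 0) : p = 0 := by
  let b := Module.Basis.ofVectorSpace ℂ (VC V)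
  let e := SymmetricAlgebra.equivMvPolynomial b
  apply e.injective
  rw [map_zero]
  refine MvPolynomial.funext fun a => ?_
  have hc : (MvPolynomial.aeval a).comp e.toAlgHom =
      SymmetricAlgebra.lift (b.constr ℂ a) := by
    apply SymmetricAlgebra.algHom_ext
    refine b.ext fun i => ?_
    have : e (SymmetricAlgebra.ι ℂ (VC V) (b i)) = MvPolynomial.X i :=
      SymmetricAlgebra.equivMvPolynomial_ι_apply b i
    change MvPolynomial.aeval a (e (SymmetricAlgebra.ι ℂ (VC V) (b i))) =
      SymmetricAlgebra.lift (b.constr ℂ a) (SymmetricAlgebra.ι ℂ (VC V) (b i))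
    rw [this, MvPolynomial.aeval_X, SymmetricAlgebra.lift_ι_apply, Module.Basis.constr_basis]
  have := DFunLike.congr_fun hc p
  rw [h] at this
  rw [map_zero]
  simpa [MvPolynomial.aeval_eq_eval] using this

theorem eq_zero_of_diffOp_eq_zero {p : SV V} (x : V) (h : ∀ g : Cω V, (diffOp V p g).1 x = 0) :
    p = 0 := by
  refine eq_zero_of_lift_eq_zero fun l => ?_
  have := h (expω l)
  rw [diffOp_expω] at this
  exact (mul_eq_zero.1 this).resolve_right (Complex.exp_ne_zero _)

/-- The regular representation of `W^a`. -/
def regRep : Representation ℂ Φ.Wa (MonoidAlgebra ℂ Φ.Wa) :=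
  (Algebra.lmul ℂ (MonoidAlgebra ℂ Φ.Wa) : _ →* _).comp (MonoidAlgebra.of ℂ Φ.Wa)

theorem regRep_apply (g : Φ.Wa) (y : MonoidAlgebra ℂ Φ.Wa) :
    Φ.regRep g y = MonoidAlgebra.of ℂ Φ.Wa g * y := rfl

/-- The basis of `ℂ[W^a]` given by the elements of `W^a`. -/
def groupBasis : Module.Basis Φ.Wa ℂ (MonoidAlgebra ℂ Φ.Wa) :=
  MonoidAlgebra.basis Φ.Wa ℂ

theorem groupBasis_apply (g : Φ.Wa) : Φ.groupBasis g = MonoidAlgebra.of ℂ Φ.Wa g := by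
  simp [groupBasis]

open Classical in
/-- The coefficients in `S(V_ℂ)` of an element of `S(V_ℂ) ⊗ ℂ[W^a]`. -/
def coef : SV V ⊗[ℂ] MonoidAlgebra ℂ Φ.Wa ≃ₗ[ℂ] Φ.Wa →₀ SV V :=
  TensorProduct.equivFinsuppOfBasisRight Φ.groupBasis

theorem coef_tmul (p : SV V) (y : MonoidAlgebra ℂ Φ.Wa) (g : Φ.Wa) :
    Φ.coef (p ⊗ₜ y) g = Φ.groupBasis.repr y g • p :=
  by classical exact TensorProduct.equivFinsuppOfBasisRight_apply_tmul_apply ..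

/-- The function `g ⊗ m` on the regular elements. -/
def pureB (g : Cω V) (m : M) : Φ.B M :=
  ⟨fun x => evalT V M (g ⊗ₜ m) x.1, Φ.mem_B.2 fun _ _ => ⟨g ⊗ₜ m, fun _ _ => rfl⟩⟩

theorem dot_pureB (ρ : Representation ℂ Φ.Wa M) (w : Φ.Wa) (g : Cω V) (m : M) :
    Φ.dot ρ w (Φ.pureB g m) = Φ.pureB (pull w.1 g) (ρ w m) := by
  refine Subtype.ext (funext fun x => ?_)
  exact (evalT_map w.1 (ρ w) (g ⊗ₜ m) x.1).symm

/-- In the regular representation `w` moves the test vector 1 to the basis vector `w`, so terms with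
different group elements land in different coordinates. At a dominant point `S(V_ℂ)` acts by
differential operators. -/
theorem repr_piRep_mulMap (k : Φ.Multiplicity) {x : Φ.Vreg} (hx : Φ.Dominant x.1) (h : Cω V)
    (w : Φ.Wa) (T : SV V ⊗[ℂ] MonoidAlgebra ℂ Φ.Wa) :
    Φ.groupBasis.repr ((Φ.piRep k Φ.regRep (Φ.mulMap k T) (Φ.pureB h 1)).1 x) w =
      (diffOp V (Φ.coef T w) (pull w.1 h)).1 x.1 := by
  induction T using TensorProduct.induction_on with
  | zero => simp
  | add S T hS hT =>
    simp only [map_add, LinearMap.add_apply, Submodule.coe_add, Pi.add_apply, Finsupp.add_apply,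
      hS, hT]
  | tmul p y =>
    obtain ⟨C, hC, hxC⟩ := Φ.mem_own_chamber x
    rw [mulMap_tmul, map_mul, coef_tmul]
    induction y using MonoidAlgebra.induction_on with
    | of g =>
      have h1 : Φ.piRep k Φ.regRep (Φ.inclW k (MonoidAlgebra.of ℂ Φ.Wa g)) (Φ.pureB h 1) =
          Φ.pureB (pull g.1 h) (MonoidAlgebra.of ℂ Φ.Wa g) := by
        have := (Φ.piRep_extends k Φ.regRep).2 g
        rw [grpA] at this
        rw [this, dot_pureB, regRep_apply, mul_one]
      rw [Module.End.mul_apply, h1, (Φ.piRep_extends k Φ.regRep).inclS_of_dominant hC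
        (fun y hy => hx.of_mem_chamber hC hxC hy) p _ (pull g.1 h ⊗ₜ MonoidAlgebra.of ℂ Φ.Wa g)
        (fun _ _ => rfl) x hxC, LinearMap.rTensor_tmul, evalT_tmul, map_smul, Finsupp.smul_apply,
        ← groupBasis_apply, Module.Basis.repr_self]
      by_cases hgw : g = w
      · subst hgw
        simp
      · simp [hgw]
    | add y z hy hz =>
      simp only [map_add, mul_add, LinearMap.add_apply, Submodule.coe_add, Pi.add_apply,
        Finsupp.add_apply, add_smul, hy, hz]
    | smul c y hy =>
      simp only [map_smul, mul_smul_comm, LinearMap.smul_apply, Submodule.coe_smul, Pi.smul_apply,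
        Finsupp.smul_apply, smul_assoc, hy]

theorem pull_surjective (e : V ≃ᵃⁱ[ℝ] V) (g : Cω V) : ∃ h, pull e h = g := by
  refine ⟨pull e⁻¹ g, Subtype.ext (funext fun x => ?_)⟩
  change g.1 ((e⁻¹)⁻¹ (e⁻¹ x)) = g.1 x
  rw [inv_inv]
  exact congrArg g.1 (e.apply_symm_apply x)

theorem mulMap_injective (k : Φ.Multiplicity) : Function.Injective (Φ.mulMap k) := by
  rw [injective_iff_map_eq_zero]
  intro T hT
  obtain ⟨z, hz⟩ := Φ.exists_dominant
  refine Φ.coef.map_eq_zero_iff.1 (Finsupp.ext fun w => ?_)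
  refine eq_zero_of_diffOp_eq_zero z fun g => ?_
  -- Translation by `w` is invertible, so the translated test function is still arbitrary.
  obtain ⟨h, rfl⟩ := pull_surjective w.1 g
  have := Φ.repr_piRep_mulMap k (x := ⟨z, hz.mem_Vreg⟩) hz h w T
  rw [← this, hT]
  simp

theorem inclS_injective (k : Φ.Multiplicity) : Function.Injective (Φ.inclS k) := by
  rw [injective_iff_map_eq_zero]
  intro p hp
  have h : p ⊗ₜ[ℂ] (MonoidAlgebra.of ℂ Φ.Wa 1) = 0 := by
    apply Φ.mulMap_injective k
    rw [mulMap_tmul, hp, zero_mul, map_zero]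
  have := Φ.coef_tmul p (MonoidAlgebra.of ℂ Φ.Wa 1) 1
  rw [h, ← groupBasis_apply, Module.Basis.repr_self] at this
  simpa using this.symm

theorem inclW_injective (k : Φ.Multiplicity) : Function.Injective (Φ.inclW k) := by
  rw [injective_iff_map_eq_zero]
  intro y hy
  have h : (1 : SV V) ⊗ₜ[ℂ] y = 0 := by
    apply Φ.mulMap_injective k
    rw [mulMap_tmul, hy, mul_zero, map_zero]
  apply Φ.groupBasis.repr.injective
  ext w
  have := Φ.coef_tmul 1 y w
  rw [h, map_zero] at this
  simpa using this.symm

/-! ### Functoriality -/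

variable {N : Type w} [AddCommGroup N] [Module ℂ N]

theorem evalT_lTensor (φ : M →ₗ[ℂ] N) (t : Cω V ⊗[ℂ] M) (x : V) :
    evalT V N (φ.lTensor (Cω V) t) x = φ (evalT V M t x) := by
  induction t using TensorProduct.induction_on with
  | zero => simp
  | add s t hs ht => simp [hs, ht]
  | tmul g m => simp [evalT_tmul]

/-- The map `f ↦ φ ∘ f` on `B^ω(V; M)`. -/
def postcomp (φ : M →ₗ[ℂ] N) : Φ.B M →ₗ[ℂ] Φ.B N where
  toFun f := ⟨fun x => φ (f.1 x), Φ.mem_B.2 fun C hC => by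
    obtain ⟨t, ht⟩ := Φ.mem_B.1 f.2 C hC
    exact ⟨φ.lTensor _ t, fun x hx => by rw [evalT_lTensor, ht x hx]⟩⟩
  map_add' f g := Subtype.ext (funext fun x => map_add φ _ _)
  map_smul' c f := Subtype.ext (funext fun x => map_smul φ c _)

theorem postcomp_apply (φ : M →ₗ[ℂ] N) (f : Φ.B M) (x : Φ.Vreg) :
    (Φ.postcomp φ f).1 x = φ (f.1 x) := rfl

theorem dirDeriv_postcomp (φ : M →ₗ[ℂ] N) (f : Φ.B M) (v : V) (x : Φ.Vreg) :
    Φ.dirDeriv (Φ.postcomp φ f).1 v x = φ (Φ.dirDeriv f.1 v x) := by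
  obtain ⟨C, hC, hx⟩ := Φ.mem_own_chamber x
  obtain ⟨t, ht⟩ := Φ.mem_B.1 f.2 C hC
  rw [Φ.dirDeriv_eq_evalT hC ht v x hx, Φ.dirDeriv_eq_evalT hC (t := φ.lTensor _ t)
    (fun y hy => by rw [evalT_lTensor, postcomp_apply, ht y hy]) v x hx, ← evalT_lTensor]
  have hcomp : (partialD v).rTensor N ∘ₗ φ.lTensor (Cω V) =
      φ.lTensor (Cω V) ∘ₗ (partialD v).rTensor M := by
    rw [LinearMap.rTensor_comp_lTensor, LinearMap.lTensor_comp_rTensor]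
  exact congrArg (fun s => evalT V N s x.1) (DFunLike.congr_fun hcomp t)

theorem dotFun_postcomp {ρ : Representation ℂ Φ.Wa M} {σ : Representation ℂ Φ.Wa N}
    {φ : M →ₗ[ℂ] N} (hφ : ∀ g m, φ (ρ g m) = σ g (φ m)) (g : Φ.Wa) (f : Φ.B M) (x : Φ.Vreg) :
    Φ.dotFun σ g (Φ.postcomp φ f).1 x = φ (Φ.dotFun ρ g f.1 x) := by
  rw [dotFun_apply, dotFun_apply, hφ, postcomp_apply]

theorem dunkl_postcomp (k : Φ.Multiplicity) {ρ : Representation ℂ Φ.Wa M}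
    {σ : Representation ℂ Φ.Wa N} {φ : M →ₗ[ℂ] N} (hφ : ∀ g m, φ (ρ g m) = σ g (φ m)) (v : V)
    (f : Φ.B M) : Φ.dunkl k σ v (Φ.postcomp φ f) = Φ.postcomp φ (Φ.dunkl k ρ v f) := by
  refine Subtype.ext (funext fun x => ?_)
  rw [postcomp_apply, coe_dunkl, coe_dunkl, dunklFun_apply, dunklFun_apply, dirDeriv_postcomp,
    map_sub]
  congr 1
  have := AddMonoidHom.map_finsum_mem' (s := Φ.RaPos) (f := Φ.dunklTerm k ρ v f.1 x)
    φ.toAddMonoidHom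
    (Φ.finite_support_of_eval x.1 (fun a => Φ.dunklTerm_eq_zero k ρ v f.1) subset_rfl)
  refine Eq.trans ?_ this.symm
  refine finsum_congr fun a => finsum_congr fun _ => ?_
  change _ = φ _
  rw [dunklTerm, dunklTerm, map_smul, Φ.dotFun_postcomp hφ]

variable {Φ} in
-- The elements intertwined by `φ` form a subalgebra, so the Dunkl operators and the group action
-- suffice.
theorem Extends.postcomp {k : Φ.Multiplicity} {ρ : Representation ℂ Φ.Wa M}
    {σ : Representation ℂ Φ.Wa N} {π : Φ.A k →ₐ[ℂ] Module.End ℂ (Φ.B M)}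
    {π' : Φ.A k →ₐ[ℂ] Module.End ℂ (Φ.B N)} (h : Φ.Extends k ρ π) (h' : Φ.Extends k σ π')
    {φ : M →ₗ[ℂ] N} (hφ : ∀ g m, φ (ρ g m) = σ g (φ m)) (a : Φ.A k) :
    ∀ f : Φ.B M, π' a (Φ.postcomp φ f) = Φ.postcomp φ (π a f) := by
  let S : Subalgebra ℂ (Φ.A k) :=
    { carrier := {a | ∀ f : Φ.B M, π' a (Φ.postcomp φ f) = Φ.postcomp φ (π a f)}
      mul_mem' := fun {a b} ha hb f => by
        rw [map_mul, map_mul, Module.End.mul_apply, Module.End.mul_apply, hb, ha]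
      add_mem' := fun {a b} ha hb f => by
        rw [map_add, map_add, LinearMap.add_apply, LinearMap.add_apply, map_add, ha, hb]
      algebraMap_mem' := fun r f => by
        rw [AlgHom.commutes, AlgHom.commutes, Module.algebraMap_end_apply,
          Module.algebraMap_end_apply, map_smul] }
  refine Φ.A_generated k S (fun v f => ?_) (fun g f => ?_) a
  · rw [h.1, h'.1, Φ.dunkl_postcomp k hφ]
  · rw [h.2, h'.2]
    exact Subtype.ext (funext fun x => Φ.dotFun_postcomp hφ g f x)

/-- The functor `M ↦ B^ω(V; M)` from `ℂ[W^a]`-modules to `A(k)`-modules. -/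
def functorB (k : Φ.Multiplicity) (π : ∀ M : Rep.{w} ℂ Φ.Wa, Φ.A k →ₐ[ℂ] Module.End ℂ (Φ.B M))
    (hπ : ∀ M, Φ.Extends k M.ρ (π M)) :
    CategoryTheory.Functor (Rep.{w} ℂ Φ.Wa) (ModuleCat.{max u w} (Φ.A k)) where
  -- The module structure depends on the chosen `π`, hence it is passed explicitly instead of being
  -- an instance.
  obj M := @ModuleCat.of (Φ.A k) _ (Φ.B M) _ (Module.compHom (Φ.B M) (π M).toRingHom)
  map {M N} φ := @ModuleCat.ofHom (Φ.A k) _ (Φ.B M) (Φ.B N) _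
    (Module.compHom (Φ.B M) (π M).toRingHom) _ (Module.compHom (Φ.B N) (π N).toRingHom)
    (@LinearMap.mk _ _ _ _ (RingHom.id (Φ.A k)) _ _ _ _
      (Module.compHom (Φ.B M) (π M).toRingHom) (Module.compHom (Φ.B N) (π N).toRingHom)
      ⟨Φ.postcomp φ.hom.toLinearMap, map_add _⟩
      fun a f => ((hπ M).postcomp (hπ N) (φ := φ.hom.toLinearMap)
        (fun g m => Rep.hom_comm_apply φ g m) a f).symm)
  map_id _ := rfl
  map_comp _ _ := rfl

/-! ### Invariant polynomials -/

theorem partialD_pull (e : V ≃ᵃⁱ[ℝ] V) (v : V) (g : Cω V) :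
    partialD (e.linearIsometryEquiv v) (pull e g) = pull e (partialD v g) := by
  apply Subtype.ext
  funext x
  change fderiv ℝ (fun y => g.1 (e⁻¹ y)) x (e.linearIsometryEquiv v) = fderiv ℝ g.1 (e⁻¹ x) v
  have h1 : HasFDerivAt (fun y => e⁻¹ y) (e⁻¹.linearIsometryEquiv : V →L[ℝ] V) x := by
    have : (fun y => e⁻¹ y) = fun y => e⁻¹.linearIsometryEquiv y + e⁻¹ 0 :=
      funext fun y => apply_eq _ y
    rw [this]
    exact (ContinuousLinearMap.hasFDerivAt (e⁻¹.linearIsometryEquiv : V →L[ℝ] V)).add_const _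
  have h2 := ((Cω.differentiable g (e⁻¹ x)).hasFDerivAt.comp x h1).fderiv
  change fderiv ℝ (fun y => g.1 (e⁻¹ y)) x = _ at h2
  rw [h2]
  exact congrArg (fderiv ℝ g.1 (e⁻¹ x)) (e.linearIsometryEquiv.symm_apply_apply v)

theorem diffOp_pull (e : V ≃ᵃⁱ[ℝ] V) (p : SV V) : ∀ g : Cω V,
    diffOp V (symAct e.linearIsometryEquiv p) (pull e g) = pull e (diffOp V p g) := by
  let S : Subalgebra ℂ (SV V) :=
    { carrier := {p | ∀ g : Cω V,
        diffOp V (symAct e.linearIsometryEquiv p) (pull e g) = pull e (diffOp V p g)}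
      mul_mem' := fun {p q} hp hq g => by
        rw [map_mul, map_mul, map_mul, Module.End.mul_apply, Module.End.mul_apply, hq, hp]
      add_mem' := fun {p q} hp hq g => by
        rw [map_add, map_add, map_add, LinearMap.add_apply, LinearMap.add_apply, map_add, hq, hp]
      algebraMap_mem' := fun r g => by
        rw [AlgHom.commutes, AlgHom.commutes, Module.algebraMap_end_apply,
          Module.algebraMap_end_apply, map_smul] }
  refine ι_mem_of_tmul_mem S (AlgHom.id ℂ _) (fun v g => ?_) p
  rw [AlgHom.id_apply, symAct_ι, linC_tmul, diffOp_ι, diffOp_ι, partialD_pull]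

variable {Φ} in
-- Some `g` carries the chamber to the fundamental one, where `p` acts by `p(∂)`. Invariance is used
-- twice: `p` commutes with `g` in `A(k)`, and `p(∂)` commutes with the pullback along `g`.
theorem Extends.inclS_of_invariant {k : Φ.Multiplicity} {ρ : Representation ℂ Φ.Wa M}
    {π : Φ.A k →ₐ[ℂ] Module.End ℂ (Φ.B M)} (h : Φ.Extends k ρ π) {p : SV V}
    (hp : ∀ g ∈ Φ.W, symAct g p = p) (f : Φ.B M) {C : Set V} (hC : C ∈ Φ.chambers)
    {t : Cω V ⊗[ℂ] M} (hf : ∀ x : Φ.Vreg, x.1 ∈ C → f.1 x = evalT V M t x.1) (x : Φ.Vreg)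
    (hx : x.1 ∈ C) :
    (π (Φ.inclS k p) f).1 x = evalT V M ((diffOp V p).rTensor M t) x.1 := by
  obtain ⟨g, -, hg⟩ := Φ.exists_dominant_translate x.2
  have hC' := Φ.image_chamber g hC
  have hgx : (Φ.move g x).1 ∈ g.1 '' C := ⟨x.1, hx, rfl⟩
  -- The translated function is represented on the translated chamber by the translate of `t`.
  have h1 := h.inclS_of_dominant hC' (fun y hy => Dominant.of_mem_chamber hC' hgx hy hg) p
    (Φ.dot ρ g f) (TensorProduct.map (pull g.1) (ρ g) t) (by
      rintro y ⟨z, hz, hzy⟩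
      rw [evalT_map, coe_dot, dotFun_apply]
      have hy : (Φ.move g⁻¹ y).1 = z := by
        change g.1⁻¹ y.1 = z
        rw [← hzy]
        exact g.1.symm_apply_apply z
      exact congrArg (ρ g) (hf (Φ.move g⁻¹ y) (hy ▸ hz))) _ hgx
  have h2 : π (Φ.inclS k p) (Φ.dot ρ g f) = Φ.dot ρ g (π (Φ.inclS k p) f) := by
    rw [← h.2, ← Module.End.mul_apply, ← Module.End.mul_apply, ← map_mul, ← map_mul,
      Φ.grpA_mul_inclS_of_invariant k hp]
  have h3 : (diffOp V p).rTensor M (TensorProduct.map (pull g.1) (ρ g) t) =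
      TensorProduct.map (pull g.1) (ρ g) ((diffOp V p).rTensor M t) := by
    have hcomp : diffOp V p ∘ₗ pull g.1 = pull g.1 ∘ₗ diffOp V p := by
      ext1 q
      have := diffOp_pull g.1 p q
      rwa [hp _ (Φ.linear_mem_W g)] at this
    rw [LinearMap.rTensor, ← LinearMap.comp_apply, ← LinearMap.comp_apply, ← TensorProduct.map_comp,
      ← TensorProduct.map_comp, hcomp, LinearMap.id_comp, LinearMap.comp_id]
  rw [h2, coe_dot, dotFun_move, h3, evalT_map] at h1
  have h4 := Φ.rep_injective ρ g h1
  rw [h4]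
  exact congrArg (evalT V M ((diffOp V p).rTensor M t)) (g.1.symm_apply_apply x.1)

end RootData
end DunklCherednik

end

theorem mainTheorem2 {V : Type u} [NormedAddCommGroup V] [InnerProductSpace ℝ V]
    [FiniteDimensional ℝ V] (Φ : DunklCherednik.RootData V) (k : Φ.Multiplicity) :
    -- `A(k)` contains `S(V_ℂ)` and `ℂ[W^a]`, and multiplication `S(V_ℂ) ⊗ ℂ[W^a] → A(k)` is
    -- a linear isomorphism
    (Function.Injective (Φ.inclS k) ∧ Function.Injective (Φ.inclW k) ∧
      Function.Bijective (Φ.mulMap k)) ∧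
    -- existence and uniqueness of the representation `π_{k,M}`
    (∀ M : Rep.{w} ℂ Φ.Wa, ∃! π : Φ.A k →ₐ[ℂ] Module.End ℂ (Φ.B M), Φ.Extends k M.ρ π) ∧
    ∀ π : ∀ M : Rep.{w} ℂ Φ.Wa, Φ.A k →ₐ[ℂ] Module.End ℂ (Φ.B M),
      (∀ M, Φ.Extends k M.ρ (π M)) →
      -- `M ↦ B^ω(V; M)`, with `A(k)` acting through `π_{k,M}` and with `φ ↦ (f ↦ φ ∘ f)` on
      -- morphisms, is a functor
      (∃ (F : CategoryTheory.Functor (Rep.{w} ℂ Φ.Wa) (ModuleCat.{max u w} (Φ.A k)))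
          (e : ∀ M : Rep.{w} ℂ Φ.Wa, F.obj M ≃+ Φ.B M),
        (∀ (M : Rep.{w} ℂ Φ.Wa) (a : Φ.A k) (x : F.obj M), e M (a • x) = π M a (e M x)) ∧
        ∀ (M N : Rep.{w} ℂ Φ.Wa) (φ : M ⟶ N) (x : F.obj M) (y : Φ.Vreg),
          (e N ((F.map φ).hom x)).1 y = φ.hom ((e M x).1 y)) ∧
      -- `π_{k,M}(p) = p(∂) ⊗ Id_M` for `p ∈ S(V_ℂ)^W`
      (∀ (M : Rep.{w} ℂ Φ.Wa) (p : DunklCherednik.RootData.SV V),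
        (∀ g ∈ Φ.W, DunklCherednik.RootData.symAct g p = p) →
        ∀ (f : Φ.B M), ∀ C ∈ Φ.chambers,
          ∀ t : TensorProduct ℂ (DunklCherednik.RootData.Cω V) M,
            (∀ x : Φ.Vreg, x.1 ∈ C → f.1 x = DunklCherednik.RootData.evalT V M t x.1) →
            ∀ x : Φ.Vreg, x.1 ∈ C →
              (π M (Φ.inclS k p) f).1 x = DunklCherednik.RootData.evalT V M
                ((DunklCherednik.RootData.diffOp V p).rTensor M t) x.1) := by
  refine ⟨⟨Φ.inclS_injective k, Φ.inclW_injective k, Φ.mulMap_injective k, Φ.mulMap_surjective k⟩,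
    fun M => ⟨Φ.piRep k M.ρ, Φ.piRep_extends k M.ρ,
      fun π hπ => hπ.unique (Φ.piRep_extends k M.ρ)⟩,
    fun π hπ => ⟨⟨Φ.functorB k π hπ, fun M => AddEquiv.refl (Φ.B M), fun _ _ _ => rfl,
      fun _ _ _ _ _ => rfl⟩, fun M p hp f C hC t ht x hx =>
        (hπ M).inclS_of_invariant hp f hC ht x hx⟩⟩
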